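/- Let $G$ be a compact Lie group and let $\rho\colon G\to \mathrm{GL}(V)$ be a smooth representation of $G$ on a finite-dimensional real vector space $V$ (a complex or quaternionic representation is regarded as a real one). A point $v\in V$ is called principal if its isotropy subgroup $G_v=\{g\in G:\rho(g)v=v\}$ is conjugate in $G$ to a subgroup of $G_w$ for every $w\in V$. Principal points exist, all their isotropy subgroups are conjugate, and all their orbits have the same dimension; write $H=G_v$ for the isotropy subgroup of a principal point $v$ and $c(G,V)=\dim_{\mathbb R} V-\dim (G\cdot v)$ for the cohomogeneity. For a compact Lie group $K$ let $\operatorname{rk} K$ be the dimension of a maximal torus of $K$. The homogeneity rank of the representation is the integer $$\operatorname{hrk}(G,V)=\operatorname{rk} G-\operatorname{rk} H-c(G,V).$$ Let $\rho_i\colon G\to\mathrm{GL}(V_i)$ $(i=1,2)$ be two finite-dimensional representations of a compact Lie group $G$ (not necessarily connected). Then, for the direct sum representation on $V_1\oplus V_2$, $$\operatorname{hrk}(G,V_1\oplus V_2)\le \operatorname{hrk}(G,V_1)+\operatorname{hrk}(G,V_2).$$ -/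

import Mathlib

open scoped Manifold ContDiff

/-- The rank of a compact Lie group `K`: the dimension of its maximal tori, i.e. the largest `n`
such that some subgroup of `K` is isomorphic, as a topological group, to the `n`-dimensional
torus. -/
noncomputable def torusRank (K : Type*) [Group K] [TopologicalSpace K] : ℕ :=
  sSup {n : ℕ | ∃ T : Subgroup K, Nonempty (T ≃ₜ* (Fin n → Circle))}

namespace Representation

section Isotropy

variable {G V : Type*} [Group G] [AddCommGroup V] [Module ℝ V]

/-- The isotropy subgroup `G_v`. -/
def isotropy (ρ : Representation ℝ G V) (v : V) : Subgroup G where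
  carrier := {g | ρ g v = v}
  one_mem' := by simp
  mul_mem' {a b} ha hb := by
    have ha' : ρ a v = v := ha
    have hb' : ρ b v = v := hb
    simp [ha', hb']
  inv_mem' {a} ha := by
    have ha' : ρ a v = v := ha
    have h : ρ a⁻¹ (ρ a v) = v := by simp
    rw [ha'] at h
    exact h

/-- `v` is a principal point: its orbit has the maximum orbit type, i.e. `G_v` is conjugate to a
subgroup of every isotropy subgroup. -/
def IsPrincipalPoint (ρ : Representation ℝ G V) (v : V) : Prop :=
  ∀ w : V, ∃ g : G, (ρ.isotropy v).map (MulAut.conj g).toMonoidHom ≤ ρ.isotropy w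

/-- A chosen principal point. For smooth finite-dimensional representations of compact Lie groups
principal points exist, and any two of them have conjugate isotropy subgroups and orbits of the
same dimension. -/
noncomputable def principalPoint (ρ : Representation ℝ G V) : V :=
  Classical.epsilon ρ.IsPrincipalPoint

end Isotropy

section Lie

variable {E H G V : Type*} [NormedAddCommGroup E] [NormedSpace ℝ E] [TopologicalSpace H]
  [TopologicalSpace G] [ChartedSpace H G] [Group G] [NormedAddCommGroup V] [NormedSpace ℝ V]

/-- The representation is smooth: all its orbit maps `g ↦ ρ(g) v` are smooth. In finite dimension
this says that `ρ : G → GL(V)` is a smooth map. -/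
def IsSmooth (I : ModelWithCorners ℝ E H) (ρ : Representation ℝ G V) : Prop :=
  ∀ v : V, ContMDiff I 𝓘(ℝ, V) ∞ (fun g : G => ρ g v)

/-- The tangent space at `v` of the orbit `G · v`: the image of the differential at the identity
of the orbit map `g ↦ ρ(g) v`. -/
noncomputable def orbitTangentSpace (I : ModelWithCorners ℝ E H) (ρ : Representation ℝ G V)
    (v : V) : Submodule ℝ V :=
  LinearMap.range (mfderiv I 𝓘(ℝ, V) (fun g : G => ρ g v) 1 : E →L[ℝ] V).toLinearMap

/-- The cohomogeneity `c(G, V)`: the codimension in `V` of the principal orbits. -/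
noncomputable def cohomogeneity (I : ModelWithCorners ℝ E H) (ρ : Representation ℝ G V) : ℤ :=
  (Module.finrank ℝ V : ℤ) - Module.finrank ℝ (ρ.orbitTangentSpace I ρ.principalPoint)

/-- The homogeneity rank `hrk(G, V) = rk G - rk H - c(G, V)`, with `H` a principal isotropy
subgroup. -/
noncomputable def hrk (I : ModelWithCorners ℝ E H) (ρ : Representation ℝ G V) : ℤ :=
  (torusRank G : ℤ) - torusRank (ρ.isotropy ρ.principalPoint) - ρ.cohomogeneity I

end Lie

end Representation

/-!
Writing `f K = rk K + dim K`, the inequality says `f H₁ + f H₂ ≤ f G + f H₁₂` for the principal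
isotropy groups `H₁`, `H₂`, `H₁₂` of `V₁`, `V₂`, `V₁ ⊕ V₂`.

* Maximal tori `T₁` of `H₁` and `T₂` of `H₂` commute after a conjugation: if `X` and `Y` generate
  dense subgroups of them and `g` maximizes `⟪Ad g X, Y⟫` for an invariant inner product, then
  `[Ad g X, Y] = 0`. The kernel of `T₁ × T₂ → G` lies in `M = g H₁ g⁻¹ ∩ H₂`, so that
  `rk H₁ + rk H₂ ≤ rk G + rk M`, and `M` is the isotropy group of `w = g v₁ + v₂`.
* If a compact group `K` acts orthogonally on `N` with a principal point `n`, then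
  `f K ≤ f K_n + dim N`. This goes by induction on `dim N`: a torus of `K` fixes a nonzero vector
  of `N` up to a subtorus of codimension at most one, and one passes to the slice at that vector,
  which has its line as a trivial summand.
* Apply the second point to the action of `M` on the slice at `w`, after splitting off the normal
  spaces of `v₁` in `V₁` and of `v₂` in `V₂`, on which `M` acts trivially.

All subgroups that occur are pointwise stabilizers of sets of vectors, with Lie algebra the common
kernel of the differentiated representation, so that the closed subgroup theorem is never needed.
-/

open Filter Topology

section Lattice

theorem exists_pos_forall_norm_lt_eq_zero {W : Type*} [NormedAddCommGroup W] [NormedSpace ℝ W]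
    [FiniteDimensional ℝ W] {Λ : AddSubgroup W} (hΛ : IsClosed (Λ : Set W))
    (h : ∀ u : W, (∀ t : ℝ, t • u ∈ Λ) → u = 0) : ∃ ε > 0, ∀ x ∈ Λ, ‖x‖ < ε → x = 0 := by
  by_contra! hsmall
  choose x hxΛ hxn hx0 using fun n : ℕ => hsmall (1 / (n + 1 : ℝ)) Nat.one_div_pos_of_nat
  have hxpos : ∀ n, 0 < ‖x n‖ := fun n => norm_pos_iff.2 (hx0 n)
  have hxlim : Tendsto (fun n => ‖x n‖) atTop (𝓝 0) :=
    squeeze_zero (fun n => norm_nonneg _) (fun n => (hxn n).le)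
      tendsto_one_div_add_atTop_nhds_zero_nat
  obtain ⟨u, hu, φ, hφ, hlim⟩ := (isCompact_sphere (0 : W) 1).tendsto_subseq
    (x := fun n => ‖x n‖⁻¹ • x n) fun n => by simp [norm_smul, (hxpos n).ne']
  -- The line through `u` lies in `Λ`: the multiples of `x (φ n)` approximate it ever more finely.
  have hline : ∀ t : ℝ, t • u ∈ Λ := fun t => by
    have hfloor : Tendsto (fun n => (⌊t / ‖x (φ n)‖⌋ : ℝ) * ‖x (φ n)‖) atTop (𝓝 t) := by
      have hlower : Tendsto (fun n => t - ‖x (φ n)‖) atTop (𝓝 t) := by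
        simpa using tendsto_const_nhds.sub (hxlim.comp hφ.tendsto_atTop)
      refine tendsto_of_tendsto_of_tendsto_of_le_of_le hlower tendsto_const_nhds
        (fun n => ?_) (fun n => (le_div_iff₀ (hxpos _)).1 (Int.floor_le _))
      have := (div_lt_iff₀ (hxpos (φ n))).1 (Int.lt_floor_add_one (t / ‖x (φ n)‖))
      simp only
      linarith
    refine hΛ.mem_of_tendsto (hfloor.smul hlim) (Eventually.of_forall fun n => ?_)
    rw [Function.comp_apply, smul_smul, mul_assoc, mul_inv_cancel₀ (hxpos _).ne', mul_one,
      Int.cast_smul_eq_zsmul]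
    exact Λ.zsmul_mem (hxΛ _) _
  simp [h u hline] at hu

theorem discreteTopology_of_forall_line {W : Type*} [NormedAddCommGroup W] [NormedSpace ℝ W]
    [FiniteDimensional ℝ W] {Λ : AddSubgroup W} (hΛ : IsClosed (Λ : Set W))
    (h : ∀ u : W, (∀ t : ℝ, t • u ∈ Λ) → u = 0) : DiscreteTopology Λ := by
  obtain ⟨ε, hε, hx⟩ := exists_pos_forall_norm_lt_eq_zero hΛ h
  refine discreteTopology_of_isOpen_singleton_zero ?_
  have hball : ({0} : Set Λ) = Subtype.val ⁻¹' Metric.ball (0 : W) ε := by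
    ext y
    simp only [Set.mem_singleton_iff, Set.mem_preimage, mem_ball_zero_iff]
    exact ⟨fun h => by simp [h, hε], fun h => Subtype.ext (hx _ y.2 h)⟩
  rw [hball]
  exact Metric.isOpen_ball.preimage continuous_subtype_val

/-- The lattice of integral points of `ι → ℝ`. -/
abbrev intLattice (ι : Type*) [Fintype ι] : Submodule ℤ (ι → ℝ) :=
  Submodule.span ℤ (Set.range (Pi.basisFun ℝ ι))

theorem mem_intLattice {ι : Type*} [Fintype ι] {x : ι → ℝ} :
    x ∈ intLattice ι ↔ ∀ i, ∃ k : ℤ, (k : ℝ) = x i := by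
  rw [intLattice, (Pi.basisFun ℝ ι).mem_span_iff_repr_mem ℤ]
  simp [Set.mem_range]

theorem single_mem_intLattice {ι : Type*} [Fintype ι] [DecidableEq ι] (i : ι) :
    Pi.single i 1 ∈ intLattice ι :=
  Submodule.subset_span ⟨i, Pi.basisFun_apply ..⟩

theorem eq_zero_of_forall_smul_mem_intLattice {ι : Type*} [Fintype ι] {x : ι → ℝ}
    (hx : ∀ t : ℝ, t • x ∈ intLattice ι) : x = 0 := by
  funext i
  by_contra hi
  obtain ⟨k, hk⟩ := mem_intLattice.1 (hx (2 * x i)⁻¹) i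
  have hk' : (2 : ℝ) * k = 1 := by
    rw [hk, Pi.smul_apply, smul_eq_mul]
    have : x i ≠ 0 := hi
    field_simp
  have : (2 : ℤ) * k = 1 := by exact_mod_cast hk'
  omega

theorem span_eq_top_of_intLattice_subset {ι : Type*} [Fintype ι] {s : Set (ι → ℝ)}
    (hs : (intLattice ι : Set (ι → ℝ)) ⊆ s) : Submodule.span ℝ s = ⊤ :=
  top_le_iff.1 ((IsZLattice.span_top (L := intLattice ι)).ge.trans (Submodule.span_mono hs))

section

variable {W : Type*} [NormedAddCommGroup W] [NormedSpace ℝ W] [FiniteDimensional ℝ W]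

theorem exists_linearEquiv_intLattice (L : Submodule ℤ W) [DiscreteTopology L]
    (hspan : Submodule.span ℝ (L : Set W) = ⊤) :
    ∃ e : W ≃ₗ[ℝ] (Fin (Module.finrank ℝ W) → ℝ),
      ∀ x, x ∈ L ↔ e x ∈ intLattice (Fin (Module.finrank ℝ W)) := by
  have : IsZLattice ℝ L := ⟨hspan⟩
  have : Module.Free ℤ L := ZLattice.module_free ℝ L
  have : Module.Finite ℤ L := ZLattice.module_finite ℝ L
  let b := (Module.finBasis ℤ L).reindex (finCongr (ZLattice.rank ℝ L))
  refine ⟨(b.ofZLatticeBasis ℝ L).equivFun, fun x => ?_⟩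
  conv_lhs => rw [← b.ofZLatticeBasis_span ℝ]
  rw [(b.ofZLatticeBasis ℝ L).mem_span_iff_repr_mem ℤ, mem_intLattice]
  simp [Set.mem_range]

theorem finrank_span_eq_finrank_int (L : Submodule ℤ W) [hL : DiscreteTopology L] :
    Module.finrank ℝ (Submodule.span ℝ (L : Set W)) = Module.finrank ℤ L := by
  rw [← Submodule.span_eq L] at hL
  exact (Real.finrank_eq_int_finrank_of_discrete hL).trans (by rw [Set.finrank, Submodule.span_eq])

variable {W' : Type*} [NormedAddCommGroup W'] [NormedSpace ℝ W'] [FiniteDimensional ℝ W']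

theorem span_inf_ker_of_discreteTopology_map (L : Submodule ℤ W) [DiscreteTopology L]
    [IsZLattice ℝ L] (M : W →ₗ[ℝ] W') [DiscreteTopology (L.map (M.restrictScalars ℤ))] :
    Submodule.span ℝ ((L ⊓ M.ker.restrictScalars ℤ : Submodule ℤ W) : Set W) = M.ker := by
  have : Module.Free ℤ L := ZLattice.module_free ℝ L
  have : Module.Finite ℤ L := ZLattice.module_finite ℝ L
  have : DiscreteTopology (L ⊓ M.ker.restrictScalars ℤ : Submodule ℤ W) :=
    DiscreteTopology.of_subset (s := (L : Set W)) (inferInstanceAs (DiscreteTopology L))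
      (inf_le_left : L ⊓ M.ker.restrictScalars ℤ ≤ L)
  refine Submodule.eq_of_le_of_finrank_eq (Submodule.span_le.2 fun x hx => hx.2) ?_
  rw [finrank_span_eq_finrank_int]
  let f : L →ₗ[ℤ] W' := (M.restrictScalars ℤ).domRestrict L
  have hrange : f.range = L.map (M.restrictScalars ℤ) := LinearMap.range_domRestrict ..
  have hker : f.ker.map L.subtype = L ⊓ M.ker.restrictScalars ℤ := by
    ext x
    simp [f, and_comm]
  have hL := Submodule.finrank_quotient_add_finrank f.ker
  rw [f.quotKerEquivRange.finrank_eq, hrange,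
    (Submodule.equivMapOfInjective L.subtype L.subtype_injective f.ker).finrank_eq, hker] at hL
  have himage : Submodule.span ℝ (L.map (M.restrictScalars ℤ) : Set W') = M.range := by
    rw [Submodule.map_coe, LinearMap.coe_restrictScalars, Submodule.span_image,
      IsZLattice.span_top, Submodule.map_top]
  rw [ZLattice.rank ℝ L, ← finrank_span_eq_finrank_int, himage,
    ← M.finrank_range_add_finrank_ker] at hL
  exact Nat.add_left_cancel hL

end

/-- The largest linear subspace contained in an additive subgroup. -/
def linearPart {W : Type*} [AddCommGroup W] [Module ℝ W] (Λ : AddSubgroup W) :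
    Submodule ℝ W where
  carrier := {u | ∀ t : ℝ, t • u ∈ Λ}
  zero_mem' t := by simp
  add_mem' {a b} ha hb t := by rw [smul_add]; exact Λ.add_mem (ha t) (hb t)
  smul_mem' c x hx t := by rw [smul_smul]; exact hx _

theorem mem_of_mem_linearPart {W : Type*} [AddCommGroup W] [Module ℝ W]
    {Λ : AddSubgroup W} {u : W} (h : u ∈ linearPart Λ) : u ∈ Λ := by
  simpa using h 1

section

variable {W : Type*} [NormedAddCommGroup W] [NormedSpace ℝ W] [FiniteDimensional ℝ W]

/-- `W` modulo the linear part of `Λ` is `ℝᵐ`, with `Λ` the preimage of `ℤᵐ`. -/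
theorem exists_linearMap_comap_intLattice {Λ : AddSubgroup W} (hΛ : IsClosed (Λ : Set W))
    (hspan : Submodule.span ℝ (Λ : Set W) = ⊤) :
    ∃ (m : ℕ) (M : W →ₗ[ℝ] (Fin m → ℝ)), Function.Surjective M ∧ M.ker = linearPart Λ ∧
      ∀ x, x ∈ Λ ↔ M x ∈ intLattice (Fin m) := by
  obtain ⟨U, hU⟩ := Submodule.exists_isCompl (linearPart Λ)
  let P : W →ₗ[ℝ] U := U.projectionOnto (linearPart Λ) hU.symm
  have hPker : P.ker = linearPart Λ := Submodule.ker_projectionOnto hU.symm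
  have hPsurj : Function.Surjective P := fun u => ⟨u, by simp [P]⟩
  let L : Submodule ℤ U := AddSubgroup.toIntSubmodule (Λ.comap U.subtype.toAddMonoidHom)
  have hPmem : ∀ x, x ∈ Λ ↔ (P x : W) ∈ Λ := fun x => by
    have hx : x - P x ∈ linearPart Λ := by
      rw [← hPker, LinearMap.mem_ker, map_sub, sub_eq_zero]
      exact (Submodule.projectionOnto_apply_left hU.symm (P x)).symm
    exact ⟨fun h => by simpa using Λ.sub_mem h (mem_of_mem_linearPart hx),
      fun h => by simpa using Λ.add_mem (mem_of_mem_linearPart hx) h⟩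
  have : DiscreteTopology L := by
    refine discreteTopology_of_forall_line (hΛ.preimage continuous_subtype_val) fun u hu => ?_
    exact Subtype.ext (Submodule.disjoint_def.1 hU.disjoint _ (fun t => hu t) u.2)
  have hLspan : Submodule.span ℝ (L : Set U) = ⊤ := by
    rw [eq_top_iff, ← LinearMap.range_eq_top.2 hPsurj, ← Submodule.map_top, ← hspan,
      Submodule.map_span, Submodule.span_le]
    rintro _ ⟨x, hx, rfl⟩
    exact Submodule.subset_span ((hPmem x).1 hx)
  obtain ⟨e, he⟩ := exists_linearEquiv_intLattice L hLspan
  refine ⟨_, e.toLinearMap ∘ₗ P, e.surjective.comp hPsurj, ?_, fun x => (hPmem x).trans (he _)⟩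
  rw [LinearMap.ker_comp, e.ker, ← hPker, LinearMap.ker]

theorem exists_linearMap_range_eq_of_span_inf {L : Submodule ℤ W} [DiscreteTopology L]
    {U : Submodule ℝ W}
    (hU : Submodule.span ℝ ((L ⊓ U.restrictScalars ℤ : Submodule ℤ W) : Set W) = U) :
    ∃ f : (Fin (Module.finrank ℝ U) → ℝ) →ₗ[ℝ] W, f.range = U ∧
      ∀ z, f z ∈ L ↔ z ∈ intLattice (Fin (Module.finrank ℝ U)) := by
  let L' : Submodule ℤ U := ZLattice.comap ℝ L U.subtype
  have : DiscreteTopology L' :=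
    ZLattice.comap_discreteTopology ℝ L (by fun_prop) U.subtype_injective
  have hspan : Submodule.span ℝ (L' : Set U) = ⊤ := by
    apply Submodule.map_injective_of_injective U.subtype_injective
    rw [Submodule.map_span, Submodule.map_top, Submodule.range_subtype]
    conv_rhs => rw [← hU]
    congr 1
    ext x
    simp [L', ZLattice.coe_comap, and_comm]
  obtain ⟨e, he⟩ := exists_linearEquiv_intLattice L' hspan
  refine ⟨U.subtype ∘ₗ e.symm.toLinearMap, ?_, fun z => ?_⟩
  · rw [LinearMap.range_comp, e.symm.range, Submodule.map_top, Submodule.range_subtype]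
  · rw [← e.apply_symm_apply z, ← he, e.apply_symm_apply]
    rfl

end

theorem exists_linearMap_range_eq_linearPart {ι : Type*} [Fintype ι] {Λ : AddSubgroup (ι → ℝ)}
    (hΛ : IsClosed (Λ : Set (ι → ℝ))) (hZ : ∀ x ∈ intLattice ι, x ∈ Λ) :
    ∃ f : (Fin (Module.finrank ℝ (linearPart Λ)) → ℝ) →ₗ[ℝ] (ι → ℝ), f.range = linearPart Λ ∧
      ∀ z, f z ∈ intLattice ι ↔ z ∈ intLattice (Fin (Module.finrank ℝ (linearPart Λ))) := by
  obtain ⟨m, M, -, hker, hM⟩ :=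
    exists_linearMap_comap_intLattice hΛ (span_eq_top_of_intLattice_subset hZ)
  have : DiscreteTopology ((intLattice ι).map (M.restrictScalars ℤ)) := by
    refine DiscreteTopology.of_subset (s := (intLattice (Fin m) : Set (Fin m → ℝ)))
      (inferInstanceAs (DiscreteTopology (intLattice (Fin m)))) ?_
    rintro _ ⟨x, hx, rfl⟩
    exact (hM x).1 (hZ x hx)
  have hspan := span_inf_ker_of_discreteTopology_map (intLattice ι) M
  rw [hker] at hspan
  exact exists_linearMap_range_eq_of_span_inf hspan

end Lattice

section Torus

/-- Continuous homomorphisms from an additive to a multiplicative topological group, as a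
predicate on functions. One-parameter groups are the case `W = ℝ`. -/
structure IsContHom {W G : Type*} [AddGroup W] [TopologicalSpace W] [Group G] [TopologicalSpace G]
    (ψ : W → G) : Prop where
  continuous : Continuous ψ
  map_add : ∀ x y, ψ (x + y) = ψ x * ψ y

namespace IsContHom

section

variable {W G : Type*} [AddGroup W] [TopologicalSpace W] [Group G] [TopologicalSpace G]
  {ψ φ : W → G}

theorem map_zero (h : IsContHom ψ) : ψ 0 = 1 := by
  simpa using h.map_add 0 0

theorem map_neg (h : IsContHom ψ) (x : W) : ψ (-x) = (ψ x)⁻¹ := by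
  rw [eq_inv_iff_mul_eq_one, ← h.map_add, neg_add_cancel, h.map_zero]

theorem map_sub (h : IsContHom ψ) (x y : W) : ψ (x - y) = ψ x * (ψ y)⁻¹ := by
  rw [sub_eq_add_neg, h.map_add, h.map_neg]

theorem tendsto (h : IsContHom ψ) : Tendsto ψ (𝓝 0) (𝓝 1) :=
  h.map_zero ▸ h.continuous.tendsto 0

theorem conj [IsTopologicalGroup G] (h : IsContHom ψ) (g : G) :
    IsContHom fun x => g * ψ x * g⁻¹ where
  continuous := by have := h.continuous; fun_prop
  map_add x y := by rw [h.map_add]; group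

theorem mul_of_commute [IsTopologicalGroup G] (hψ : IsContHom ψ) (hφ : IsContHom φ)
    (hcomm : ∀ x y, Commute (ψ x) (φ y)) : IsContHom fun x => ψ x * φ x where
  continuous := hψ.continuous.mul hφ.continuous
  map_add x y := by rw [hψ.map_add, hφ.map_add, (hcomm y x).mul_mul_mul_comm]

end

theorem one {W G : Type*} [AddGroup W] [TopologicalSpace W] [Group G] [TopologicalSpace G] :
    IsContHom fun _ : W => (1 : G) :=
  ⟨continuous_const, by simp⟩

section

variable {W G : Type*} [NormedAddCommGroup W] [NormedSpace ℝ W] [Group G] [TopologicalSpace G]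
  {ψ : W → G}

theorem comp_linearMap {U : Type*} [NormedAddCommGroup U] [NormedSpace ℝ U]
    [FiniteDimensional ℝ U] (h : IsContHom ψ) (f : U →ₗ[ℝ] W) : IsContHom fun u => ψ (f u) where
  continuous := h.continuous.comp f.continuous_of_finiteDimensional
  map_add x y := by rw [_root_.map_add, h.map_add]

theorem line (h : IsContHom ψ) (x : W) : IsContHom fun t : ℝ => ψ (t • x) :=
  h.comp_linearMap (LinearMap.toSpanSingleton ℝ W x)

end

/-- The preimage of a subgroup. -/
def comap {W G : Type*} [AddGroup W] [TopologicalSpace W] [Group G] [TopologicalSpace G]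
    {ψ : W → G} (h : IsContHom ψ) (K : Subgroup G) : AddSubgroup W where
  carrier := ψ ⁻¹' K
  zero_mem' := by simp [h.map_zero]
  add_mem' {a b} ha hb := by
    rw [Set.mem_preimage, h.map_add]
    exact K.mul_mem ha hb
  neg_mem' {a} ha := by
    rw [Set.mem_preimage, h.map_neg]
    exact K.inv_mem ha

end IsContHom

/-- A continuous homomorphism from `ι → ℝ` whose kernel is the lattice of integral points: it
parametrizes a torus of dimension the cardinality of `ι`. -/
structure IsTorusParam {ι G : Type*} [Fintype ι] [Group G] [TopologicalSpace G]
    (ψ : (ι → ℝ) → G) : Prop extends IsContHom ψ where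
  eq_one_iff : ∀ x, ψ x = 1 ↔ x ∈ intLattice ι

namespace IsTorusParam

variable {ι G : Type*} [Fintype ι] [Group G] [TopologicalSpace G]

theorem conj [IsTopologicalGroup G] {ψ : (ι → ℝ) → G} (h : IsTorusParam ψ) (g : G) :
    IsTorusParam fun x => g * ψ x * g⁻¹ where
  toIsContHom := h.toIsContHom.conj g
  eq_one_iff x := by rw [← h.eq_one_iff, mul_inv_eq_one, mul_eq_left]

theorem of_subgroup {K : Subgroup G} {ψ : (ι → ℝ) → K} (h : IsTorusParam ψ) :
    IsTorusParam fun x => (ψ x : G) where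
  continuous := continuous_subtype_val.comp h.continuous
  map_add x y := by rw [h.map_add, Subgroup.coe_mul]
  eq_one_iff x := by rw [OneMemClass.coe_eq_one, h.eq_one_iff]

theorem codRestrict {K : Subgroup G} {ψ : (ι → ℝ) → G} (h : IsTorusParam ψ)
    (hK : ∀ x, ψ x ∈ K) : IsTorusParam fun x => (⟨ψ x, hK x⟩ : K) where
  continuous := h.continuous.subtype_mk _
  map_add x y := Subtype.ext (h.map_add x y)
  eq_one_iff x := by rw [← h.eq_one_iff]; exact Subtype.ext_iff

theorem eq_iff_sub_mem {ψ : (ι → ℝ) → G} (h : IsTorusParam ψ) {x y : ι → ℝ} :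
    ψ x = ψ y ↔ x - y ∈ intLattice ι := by
  rw [← h.eq_one_iff, h.map_sub, mul_inv_eq_one]

end IsTorusParam

/-- The covering of the standard torus by Euclidean space. -/
noncomputable def circleExpPi (n : ℕ) (x : Fin n → ℝ) : Fin n → Circle :=
  fun i => Circle.exp (2 * Real.pi * x i)

theorem isTorusParam_circleExpPi (n : ℕ) : IsTorusParam (circleExpPi n) where
  continuous := continuous_pi fun i => Circle.exp.continuous.comp (by fun_prop)
  map_add x y := by
    ext i
    simp [circleExpPi, mul_add, Circle.exp_add]
  eq_one_iff x := by
    rw [mem_intLattice, funext_iff]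
    refine forall_congr' fun i => ?_
    rw [circleExpPi, Pi.one_apply, Circle.exp_eq_one]
    refine exists_congr fun k => ?_
    rw [mul_comm (k : ℝ), mul_right_inj' Real.two_pi_pos.ne', eq_comm]

theorem surjective_exp_two_pi_mul :
    Function.Surjective fun x : ℝ => Circle.exp (2 * Real.pi * x) := fun z => by
  obtain ⟨x, hx⟩ := Circle.exp_surjective z
  exact ⟨x / (2 * Real.pi), by simp only [mul_div_cancel₀ _ Real.two_pi_pos.ne', hx]⟩

theorem circleExpPi_surjective (n : ℕ) : Function.Surjective (circleExpPi n) :=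
  Function.Surjective.piMap fun _ => surjective_exp_two_pi_mul

theorem isOpenMap_circleExpPi (n : ℕ) : IsOpenMap (circleExpPi n) :=
  IsOpenMap.piMap (fun _ => isLocalHomeomorph_circleExp.isOpenMap.comp
    (Homeomorph.mulLeft₀ _ Real.two_pi_pos.ne').isOpenMap)
    (Eventually.of_forall fun _ => surjective_exp_two_pi_mul)

theorem IsTorusParam.exists_injective_monoidHom {K : Type*} [Group K] [TopologicalSpace K] {n : ℕ}
    {ψ : (Fin n → ℝ) → K} (hψ : IsTorusParam ψ) :
    ∃ f : (Fin n → Circle) →* K, Continuous f ∧ Function.Injective f := by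
  have hexp := isTorusParam_circleExpPi n
  have hsurj := circleExpPi_surjective n
  have hquot : IsQuotientMap (circleExpPi n) :=
    (isOpenMap_circleExpPi n).isQuotientMap hexp.continuous hsurj
  have hfiber : ∀ x y, circleExpPi n x = circleExpPi n y ↔ ψ x = ψ y := fun x y => by
    rw [hexp.eq_iff_sub_mem, hψ.eq_iff_sub_mem]
  let s := Function.surjInv hsurj
  have hs : ∀ z, circleExpPi n (s z) = z := Function.surjInv_eq hsurj
  let f : (Fin n → Circle) →* K :=
    { toFun := fun z => ψ (s z)
      map_one' := by rw [hψ.eq_one_iff, ← hexp.eq_one_iff, hs]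
      map_mul' := fun a b => by rw [← hψ.map_add, ← hfiber, hs, hexp.map_add, hs, hs] }
  refine ⟨f, hquot.continuous_iff.2 (hψ.continuous.congr fun x => ?_), fun a b hab => ?_⟩
  · exact ((hfiber _ _).1 (hs _)).symm
  · rw [← hs a, ← hs b]
    exact (hfiber _ _).2 hab

theorem exists_subgroup_equiv_torus_iff {K : Type*} [Group K] [TopologicalSpace K] [T2Space K]
    {n : ℕ} :
    (∃ T : Subgroup K, Nonempty (T ≃ₜ* (Fin n → Circle))) ↔
      ∃ ψ : (Fin n → ℝ) → K, IsTorusParam ψ := by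
  constructor
  · rintro ⟨T, ⟨e⟩⟩
    have hexp := isTorusParam_circleExpPi n
    have hψ : IsTorusParam fun x => e.symm (circleExpPi n x) :=
      ⟨⟨e.symm.continuous.comp hexp.continuous, fun x y => by rw [hexp.map_add, map_mul]⟩,
        fun x => by rw [← hexp.eq_one_iff]; exact EmbeddingLike.map_eq_one_iff⟩
    exact ⟨_, hψ.of_subgroup⟩
  · rintro ⟨ψ, hψ⟩
    obtain ⟨f, hf, hinj⟩ := hψ.exists_injective_monoidHom
    let e : (Fin n → Circle) ≃* f.range := MonoidHom.ofInjective hinj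
    have he : Continuous e := hf.subtype_mk _
    exact ⟨f.range, ⟨ContinuousMulEquiv.symm
      { e with
        continuous_toFun := he
        continuous_invFun := (he.homeoOfEquivCompactToT2 (f := e.toEquiv)).symm.continuous }⟩⟩

theorem torusRank_eq {K : Type*} [Group K] [TopologicalSpace K] [T2Space K] :
    torusRank K = sSup {n : ℕ | ∃ ψ : (Fin n → ℝ) → K, IsTorusParam ψ} := by
  simp_rw [torusRank, exists_subgroup_equiv_torus_iff]

theorem torusRank_top {G : Type*} [Group G] [TopologicalSpace G] [T2Space G] :
    torusRank (⊤ : Subgroup G) = torusRank G := by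
  rw [torusRank_eq, torusRank_eq]
  congr 1
  ext n
  exact ⟨fun ⟨_, hψ⟩ => ⟨_, hψ.of_subgroup⟩,
    fun ⟨_, hψ⟩ => ⟨_, hψ.codRestrict fun _ => Subgroup.mem_top _⟩⟩

theorem exists_forall_int_sum_ne_zero (ι : Type*) [Fintype ι] :
    ∃ x : ι → ℝ, ∀ k : ι → ℤ, k ≠ 0 → ∑ i, (k i : ℝ) * x i ≠ 0 := by
  classical
  let ℓ : (ι → ℤ) → ((ι → ℝ) →ₗ[ℝ] ℝ) := fun k => ∑ i, (k i : ℝ) • LinearMap.proj i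
  have hnull : ∀ k : {k : ι → ℤ // k ≠ 0},
      MeasureTheory.volume ((ℓ k).ker : Set (ι → ℝ)) = 0 := fun k => by
    refine MeasureTheory.Measure.addHaar_submodule _ _ fun htop => k.2 (funext fun i => ?_)
    have hi : (Pi.single i 1 : ι → ℝ) ∈ (ℓ k).ker := htop ▸ Submodule.mem_top
    simpa [ℓ, Pi.single_apply] using hi
  by_contra! hrel
  have hcover : (⋃ k : {k : ι → ℤ // k ≠ 0}, ((ℓ k).ker : Set (ι → ℝ))) = Set.univ := by
    refine Set.eq_univ_of_forall fun x => ?_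
    obtain ⟨k, hk, hkx⟩ := hrel x
    exact Set.mem_iUnion.2 ⟨⟨k, hk⟩, by simpa [ℓ] using hkx⟩
  have hvol := MeasureTheory.measure_iUnion_null hnull
  rw [hcover] at hvol
  exact isOpen_univ.measure_ne_zero MeasureTheory.volume Set.univ_nonempty hvol

theorem eq_univ_of_forall_smul_add_mem {ι : Type*} [Fintype ι] {x : ι → ℝ}
    (hx : ∀ k : ι → ℤ, k ≠ 0 → ∑ i, (k i : ℝ) * x i ≠ 0) {s : Set (ι → ℝ)} (hs : IsClosed s)
    (hsx : ∀ t : ℝ, ∀ z ∈ intLattice ι, t • x + z ∈ s) : s = Set.univ := by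
  classical
  let Λ := ((ℝ ∙ x).toAddSubgroup ⊔ (intLattice ι).toAddSubgroup).topologicalClosure
  have hle := AddSubgroup.le_topologicalClosure
    ((ℝ ∙ x).toAddSubgroup ⊔ (intLattice ι).toAddSubgroup)
  have hZ : ∀ z ∈ intLattice ι, z ∈ Λ := fun z hz => hle (AddSubgroup.mem_sup_right hz)
  have hline : ∀ t : ℝ, t • x ∈ Λ := fun t => hle <| AddSubgroup.mem_sup_left <|
    Submodule.smul_mem _ t (Submodule.mem_span_singleton_self x)
  obtain ⟨m, M, -, -, hM⟩ := exists_linearMap_comap_intLattice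
    (AddSubgroup.isClosed_topologicalClosure _) (span_eq_top_of_intLattice_subset hZ)
  have hMx : M x = 0 := eq_zero_of_forall_smul_mem_intLattice fun t => by
    rw [← map_smul]
    exact (hM _).1 (hline t)
  -- A coordinate of `M` is an integral linear form vanishing at `x`.
  have hM0 : M = 0 := by
    refine LinearMap.ext fun y => funext fun j => ?_
    choose k hk using fun i => mem_intLattice.1 ((hM _).1 (hZ _ (single_mem_intLattice i))) j
    have hMk : ∀ y, M y j = ∑ i, (k i : ℝ) * y i := fun y => by
      conv_lhs => rw [pi_eq_sum_univ' y]
      simp [hk, mul_comm]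
    have hk0 : k = 0 := by
      by_contra hk0
      exact hx k hk0 (by rw [← hMk, hMx, Pi.zero_apply])
    simp [hMk, hk0]
  refine Set.eq_univ_of_forall fun y => closure_minimal ?_ hs ((hM y).2 (by simp [hM0]))
  intro z hz
  obtain ⟨a, ha, b, hb, rfl⟩ := AddSubgroup.mem_sup.1 hz
  obtain ⟨t, rfl⟩ := Submodule.mem_span_singleton.1 ha
  exact hsx t b hb

/-- Topological generators of the torus `ℝⁿ / ℤⁿ`, by Kronecker's theorem. -/
theorem exists_dense_line (ι : Type*) [Fintype ι] :
    ∃ x : ι → ℝ, ∀ s : Set (ι → ℝ), IsClosed s →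
      (∀ t : ℝ, ∀ z ∈ intLattice ι, t • x + z ∈ s) → s = Set.univ := by
  obtain ⟨x, hx⟩ := exists_forall_int_sum_ne_zero ι
  exact ⟨x, fun s => eq_univ_of_forall_smul_add_mem hx⟩

end Torus

section AlmostAdditive

variable {E : Type*} [NormedAddCommGroup E] [NormedSpace ℝ E] [CompleteSpace E] {ξ : ℝ → E}

theorem norm_integral_sub_smul_le {δ t C : ℝ} (hδ : 0 ≤ δ)
    (h₀ : IntervalIntegrable ξ MeasureTheory.volume 0 δ)
    (h₁ : IntervalIntegrable ξ MeasureTheory.volume t (t + δ))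
    (hC : ∀ a ∈ Set.Ioc 0 δ, ‖ξ (a + t) - ξ a - ξ t‖ ≤ C) :
    ‖(∫ a in t..t + δ, ξ a) - (∫ a in 0..δ, ξ a) - δ • ξ t‖ ≤ C * δ := by
  have hshift : IntervalIntegrable (fun a => ξ (a + t)) MeasureTheory.volume 0 δ := by
    simpa [add_comm t δ] using h₁.comp_add_right t
  have hbound : ‖∫ a in 0..δ, (ξ (a + t) - ξ a - ξ t)‖ ≤ C * |δ - 0| :=
    intervalIntegral.norm_integral_le_of_norm_le_const fun a ha =>
      hC a (by rwa [Set.uIoc_of_le hδ] at ha)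
  rwa [intervalIntegral.integral_sub (hshift.sub h₀) (by simp),
    intervalIntegral.integral_sub hshift h₀, intervalIntegral.integral_comp_add_right, zero_add,
    add_comm δ t, intervalIntegral.integral_const, sub_zero, abs_of_nonneg hδ] at hbound

theorem exists_hasDerivAt_norm_sub_le (hξ : ∀ᶠ t in 𝓝 0, ContinuousAt ξ t) {ε : ℝ}
    (hadd : ∀ᶠ p : ℝ × ℝ in 𝓝 0, ‖ξ (p.1 + p.2) - ξ p.1 - ξ p.2‖ ≤ ε * ‖ξ p.2‖) :
    ∃ (u : ℝ → E) (y : E), HasDerivAt u y 0 ∧ u 0 = 0 ∧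
      ∀ᶠ t in 𝓝 0, ‖ξ t - u t‖ ≤ ε * ‖ξ t‖ := by
  obtain ⟨r₁, hr₁, hball₁⟩ := Metric.eventually_nhds_iff_ball.1 hξ
  obtain ⟨r₂, hr₂, hball₂⟩ := Metric.eventually_nhds_iff_ball.1 hadd
  obtain ⟨δ, hδ, hδr⟩ : ∃ δ > 0, 2 * δ < min r₁ r₂ :=
    ⟨min r₁ r₂ / 3, by positivity, by linarith [lt_min hr₁ hr₂]⟩
  have hδr₁ := hδr.trans_le (min_le_left _ _)
  have hδr₂ := hδr.trans_le (min_le_right _ _)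
  have hcont : ContinuousOn ξ (Metric.ball 0 r₁) := fun t ht => (hball₁ t ht).continuousWithinAt
  have hint : ∀ a b, |a| < r₁ → |b| < r₁ → IntervalIntegrable ξ MeasureTheory.volume a b :=
    fun a b ha hb => (hcont.mono ((convex_ball 0 r₁).ordConnected.uIcc_subset
      (by simpa using ha) (by simpa using hb))).intervalIntegrable
  -- Averaging `ξ (a + t) - ξ a ≈ ξ t` over `a ∈ [0, δ]` gives a differentiable function of `t`.
  let F : ℝ → E := fun x => ∫ s in 0..x, ξ s
  have hF : ∀ x, |x| < r₁ → HasDerivAt F (ξ x) x := fun x hx =>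
    intervalIntegral.integral_hasDerivAt_right (hint 0 x (by simpa) hx)
      (hcont.stronglyMeasurableAtFilter Metric.isOpen_ball x (by simpa using hx))
      (hball₁ x (by simpa using hx))
  have hF' : HasDerivAt (fun t => F (t + δ)) (ξ δ) 0 :=
    HasDerivAt.comp_add_const 0 δ (by rw [zero_add]; exact hF δ (by rw [abs_of_pos hδ]; linarith))
  refine ⟨fun t => δ⁻¹ • (F (t + δ) - F t - F δ), _,
    ((hF'.sub (hF 0 (by simpa))).sub_const _).const_smul δ⁻¹, by simp [F], ?_⟩
  filter_upwards [Metric.ball_mem_nhds 0 hδ] with t ht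
  have ht' : |t| < δ := by simpa using ht
  have habs := abs_lt.1 ht'
  have hδ₁ : |δ| < r₁ := by rw [abs_of_pos hδ]; linarith
  have htδ₁ : |t + δ| < r₁ := by rw [abs_lt]; constructor <;> linarith
  have hbound := norm_integral_sub_smul_le (C := ε * ‖ξ t‖) hδ.le (hint 0 δ (by simpa) hδ₁)
    (hint t (t + δ) (by linarith) htδ₁) fun a ha => hball₂ (a, t) <| by
      rw [mem_ball_zero_iff, Prod.norm_mk, max_lt_iff, Real.norm_eq_abs, Real.norm_eq_abs,
        abs_of_pos ha.1]
      constructor <;> linarith [ha.2]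
  rw [← intervalIntegral.integral_interval_sub_left (hint 0 _ (by simpa) htδ₁)
    (hint 0 t (by simpa) (by linarith))] at hbound
  calc ‖ξ t - δ⁻¹ • (F (t + δ) - F t - F δ)‖
      = δ⁻¹ * ‖F (t + δ) - F t - F δ - δ • ξ t‖ := by
        rw [norm_sub_rev, ← norm_smul_of_nonneg (inv_nonneg.2 hδ.le), smul_sub _ _ (δ • ξ t),
          inv_smul_smul₀ hδ.ne']
    _ ≤ δ⁻¹ * (ε * ‖ξ t‖ * δ) := by gcongr
    _ = ε * ‖ξ t‖ := by field_simp

theorem exists_eventually_norm_slope_sub_le (hξ : ∀ᶠ t in 𝓝 0, ContinuousAt ξ t)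
    {ε : ℝ} (hε : 0 < ε)
    (hadd : ∀ᶠ p : ℝ × ℝ in 𝓝 0, ‖ξ (p.1 + p.2) - ξ p.1 - ξ p.2‖ ≤ ε * ‖ξ p.2‖) :
    ∃ y : E, ∀ᶠ t in 𝓝[≠] (0 : ℝ), ‖t⁻¹ • ξ t - y‖ ≤ ε * ‖t⁻¹ • ξ t‖ + ε := by
  obtain ⟨u, y, hu, hu0, hle⟩ := exists_hasDerivAt_norm_sub_le hξ hadd
  refine ⟨y, ?_⟩
  have hslope := hu.tendsto_slope_zero
  simp only [zero_add, hu0, sub_zero] at hslope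
  filter_upwards [hle.filter_mono nhdsWithin_le_nhds,
    hslope.eventually (Metric.closedBall_mem_nhds y hε)] with t ht hty
  calc ‖t⁻¹ • ξ t - y‖ ≤ ‖t⁻¹ • (ξ t - u t)‖ + ‖t⁻¹ • u t - y‖ := by
        rw [smul_sub]; exact norm_sub_le_norm_sub_add_norm_sub ..
    _ ≤ ε * ‖t⁻¹ • ξ t‖ + ε := by
        gcongr
        · rw [norm_smul, norm_smul, mul_left_comm]
          gcongr
        · rwa [← dist_eq_norm]

theorem cauchy_map_of_forall_exists_dist_le {α X : Type*} [PseudoMetricSpace X] {l : Filter α}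
    [l.NeBot] {f : α → X} (h : ∀ ε > 0, ∃ y, ∀ᶠ a in l, dist (f a) y ≤ ε) : Cauchy (map f l) := by
  refine Metric.cauchy_iff.2 ⟨inferInstance, fun ε hε => ?_⟩
  obtain ⟨y, hy⟩ := h (ε / 3) (by positivity)
  refine ⟨_, image_mem_map hy, ?_⟩
  rintro _ ⟨a, ha, rfl⟩ _ ⟨b, hb, rfl⟩
  have ha : dist (f a) y ≤ ε / 3 := ha
  have hb : dist (f b) y ≤ ε / 3 := hb
  linarith [dist_triangle_right (f a) (f b) y]

/-- This is what makes a continuous one-parameter group differentiable. -/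
theorem differentiableAt_zero_of_almost_additive (hξ : ∀ᶠ t in 𝓝 0, ContinuousAt ξ t)
    (hadd : ∀ ε > 0, ∀ᶠ p : ℝ × ℝ in 𝓝 0, ‖ξ (p.1 + p.2) - ξ p.1 - ξ p.2‖ ≤ ε * ‖ξ p.2‖) :
    DifferentiableAt ℝ ξ 0 := by
  have hξ0 : ξ 0 = 0 := by
    have := (hadd (1 / 2) (by norm_num)).self_of_nhds
    simp only [Prod.fst_zero, Prod.snd_zero, add_zero, sub_self, zero_sub, norm_neg] at this
    exact norm_le_zero_iff.1 (by linarith)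
  obtain ⟨z, hz⟩ := exists_eventually_norm_slope_sub_le hξ one_half_pos (hadd _ one_half_pos)
  have hB : ∀ᶠ t in 𝓝[≠] (0 : ℝ), ‖t⁻¹ • ξ t‖ ≤ 2 * ‖z‖ + 1 := by
    filter_upwards [hz] with t ht
    linarith [norm_le_norm_add_norm_sub' (t⁻¹ • ξ t) z]
  have hcauchy : Cauchy (map (fun t : ℝ => t⁻¹ • ξ t) (𝓝[≠] 0)) := by
    refine cauchy_map_of_forall_exists_dist_le fun ε hε => ?_
    have hε' : 0 < ε / (2 * ‖z‖ + 2) := by positivity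
    obtain ⟨y, hy⟩ := exists_eventually_norm_slope_sub_le hξ hε' (hadd _ hε')
    refine ⟨y, ?_⟩
    filter_upwards [hy, hB] with t ht htB
    calc dist (t⁻¹ • ξ t) y ≤ ε / (2 * ‖z‖ + 2) * (‖t⁻¹ • ξ t‖ + 1) := by
          rw [dist_eq_norm, mul_add, mul_one]; exact ht
      _ ≤ ε / (2 * ‖z‖ + 2) * (2 * ‖z‖ + 1 + 1) := by gcongr
      _ = ε := by field_simp; ring
  obtain ⟨y, hy⟩ := cauchy_iff_exists_le_nhds.1 hcauchy
  have hderiv : HasDerivAt ξ y 0 := by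
    rw [hasDerivAt_iff_tendsto_slope_zero]
    simp only [zero_add, hξ0, sub_zero]
    exact hy
  exact hderiv.differentiableAt

end AlmostAdditive

section Calculus

variable {E F V : Type*} [NormedAddCommGroup E] [NormedSpace ℝ E] [NormedAddCommGroup F]
  [NormedSpace ℝ F] [NormedAddCommGroup V] [NormedSpace ℝ V]

theorem eventually_differentiableAt_of_contDiffAt {n : ℕ∞ω} {f : E → F} {x : E}
    (hf : ContDiffAt ℝ n f x) (hn : 1 ≤ n) : ∀ᶠ y in 𝓝 x, DifferentiableAt ℝ f y :=
  ((hf.of_le hn).eventually (by simp)).mono fun _ hy => hy.differentiableAt (by simp)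

theorem hasDerivAt_smul_const_zero (X : E) : HasDerivAt (fun s : ℝ => s • X) X 0 := by
  simpa using (hasDerivAt_id (0 : ℝ)).smul_const X

theorem eventually_eq_of_eventually_hasDerivAt_zero {f : ℝ → V} {a : ℝ}
    (h : ∀ᶠ t in 𝓝 a, HasDerivAt f 0 t) : ∀ᶠ t in 𝓝 a, f t = f a := by
  obtain ⟨ε, hε, hb⟩ := Metric.eventually_nhds_iff_ball.1 h
  filter_upwards [Metric.ball_mem_nhds a hε] with t ht
  have := (convex_ball a ε).norm_image_sub_le_of_norm_hasDerivWithin_le (f := f) (f' := fun _ => 0)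
    (C := 0) (fun x hx => (hb x hx).hasDerivWithinAt) (by simp) (Metric.mem_ball_self hε) ht
  rw [zero_mul] at this
  exact sub_eq_zero.1 (norm_le_zero_iff.1 this)

end Calculus

/-- A chart at the identity of a topological group in which multiplication and conjugation are
smooth near the origin. -/
structure GroupChart (G E : Type*) [Group G] [TopologicalSpace G] [NormedAddCommGroup E]
    [NormedSpace ℝ E] where
  chart : OpenPartialHomeomorph G E
  one_mem_source : (1 : G) ∈ chart.source
  protected map_one : chart 1 = 0
  contDiffAt_mul : ContDiffAt ℝ ∞ (fun p : E × E => chart (chart.symm p.1 * chart.symm p.2)) 0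
  contDiffAt_conj₂ : ContDiffAt ℝ ∞
    (fun p : E × E => chart (chart.symm p.1 * chart.symm p.2 * (chart.symm p.1)⁻¹)) 0
  contDiffAt_conj : ∀ g : G, ContDiffAt ℝ ∞ (fun x : E => chart (g * chart.symm x * g⁻¹)) 0

namespace GroupChart

variable {G E V : Type*} [Group G] [TopologicalSpace G]
  [NormedAddCommGroup E] [NormedSpace ℝ E]
  [NormedAddCommGroup V] [NormedSpace ℝ V]
  (C : GroupChart G E)

/-- Multiplication read in the chart. -/
def mul (p : E × E) : E := C.chart (C.chart.symm p.1 * C.chart.symm p.2)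

theorem symm_zero : C.chart.symm 0 = 1 := by
  rw [← C.map_one, C.chart.left_inv C.one_mem_source]

theorem zero_mem_target : (0 : E) ∈ C.chart.target := by
  rw [← C.map_one]; exact C.chart.map_source C.one_mem_source

theorem tendsto_chart : Tendsto C.chart (𝓝 1) (𝓝 0) := by
  have := C.chart.continuousAt C.one_mem_source
  rwa [ContinuousAt, C.map_one] at this

theorem tendsto_symm : Tendsto C.chart.symm (𝓝 0) (𝓝 1) := by
  have := C.chart.continuousAt_symm C.zero_mem_target
  rwa [ContinuousAt, C.symm_zero] at this

theorem eventually_symm_chart : ∀ᶠ g in 𝓝 (1 : G), C.chart.symm (C.chart g) = g :=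
  C.chart.eventually_left_inverse C.one_mem_source

theorem eventually_chart_symm : ∀ᶠ x in 𝓝 (0 : E), C.chart (C.chart.symm x) = x :=
  C.chart.eventually_right_inverse C.zero_mem_target

theorem mul_zero_right : ∀ᶠ x in 𝓝 (0 : E), C.mul (x, 0) = x := by
  filter_upwards [C.eventually_chart_symm] with x hx
  rw [mul, C.symm_zero, mul_one, hx]

theorem mul_zero_left : ∀ᶠ x in 𝓝 (0 : E), C.mul (0, x) = x := by
  filter_upwards [C.eventually_chart_symm] with x hx
  rw [mul, C.symm_zero, one_mul, hx]

theorem chart_mul {g h : G} (hg : C.chart.symm (C.chart g) = g)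
    (hh : C.chart.symm (C.chart h) = h) :
    C.chart (g * h) = C.mul (C.chart g, C.chart h) := by
  simp only [mul, hg, hh]

theorem hasFDerivAt_mul :
    HasFDerivAt C.mul (ContinuousLinearMap.fst ℝ E E + ContinuousLinearMap.snd ℝ E E) 0 := by
  have hd : HasFDerivAt C.mul (fderiv ℝ C.mul 0) (0, 0) :=
    (C.contDiffAt_mul.differentiableAt (by simp)).hasFDerivAt
  have h1 := (HasFDerivAt.comp (𝕜 := ℝ) (f := fun x : E => (x, (0 : E))) 0 hd
    (hasFDerivAt_prodMk_left 0 0)).unique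
    ((hasFDerivAt_id (𝕜 := ℝ) (0 : E)).congr_of_eventuallyEq C.mul_zero_right)
  have h2 := (HasFDerivAt.comp (𝕜 := ℝ) (f := fun x : E => ((0 : E), x)) 0 hd
    (hasFDerivAt_prodMk_right 0 0)).unique
    ((hasFDerivAt_id (𝕜 := ℝ) (0 : E)).congr_of_eventuallyEq C.mul_zero_left)
  have hD : fderiv ℝ C.mul 0 = ContinuousLinearMap.fst ℝ E E + ContinuousLinearMap.snd ℝ E E := by
    ext x
    · simpa using congrArg (fun f : E →L[ℝ] E => f x) h1
    · simpa using congrArg (fun f : E →L[ℝ] E => f x) h2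
  exact hD ▸ hd

theorem hasStrictFDerivAt_mul : HasStrictFDerivAt C.mul
    (ContinuousLinearMap.fst ℝ E E + ContinuousLinearMap.snd ℝ E E) 0 := by
  rw [← C.hasFDerivAt_mul.fderiv]
  exact C.contDiffAt_mul.hasStrictFDerivAt (by simp)

/-- The left-invariant vector field with value `X` at the identity, read in the chart. -/
noncomputable def field (X x : E) : E := fderiv ℝ C.mul (x, 0) (0, X)

theorem field_zero (X : E) : C.field X 0 = X := by
  have h : fderiv ℝ C.mul (0, 0) = _ := C.hasFDerivAt_mul.fderiv
  simp [field, h]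

theorem contDiffAt_field (X : E) : ContDiffAt ℝ 1 (C.field X) 0 := by
  have h : ContDiffAt ℝ 1 (fderiv ℝ C.mul) ((0 : E), (0 : E)) :=
    C.contDiffAt_mul.fderiv_right (m := 1) (by norm_cast)
  have h2 : ContDiffAt ℝ 1 (fun x : E => fderiv ℝ C.mul (x, 0)) 0 :=
    ContDiffAt.comp (g := fderiv ℝ C.mul) (f := fun x : E => (x, (0 : E))) 0 h (by fun_prop)
  exact h2.clm_apply contDiffAt_const

theorem eventually_hasFDerivAt_mul :
    ∀ᶠ x in 𝓝 (0 : E), HasFDerivAt C.mul (fderiv ℝ C.mul (x, 0)) (x, 0) := by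
  have h : Tendsto (fun x : E => (x, (0 : E))) (𝓝 0) (𝓝 0) :=
    Continuous.tendsto' (by fun_prop) _ _ rfl
  filter_upwards [h.eventually (eventually_differentiableAt_of_contDiffAt C.contDiffAt_mul
    (by simp))] with x hx using hx.hasFDerivAt

/-- The orbit map of `v`, read in the chart. -/
def orbitMap (ρ : Representation ℝ G V) (v : V) (x : E) : V := ρ (C.chart.symm x) v

/-- A representation is smooth if its orbit maps are so near the identity, read in the chart. -/
def IsSmoothRep (ρ : Representation ℝ G V) : Prop :=
  ∀ v, ContDiffAt ℝ ∞ (C.orbitMap ρ v) 0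

variable {C} {ρ : Representation ℝ G V}

@[simp]
theorem orbitMap_zero (v : V) : C.orbitMap ρ v 0 = v := by
  rw [orbitMap, C.symm_zero, map_one, Module.End.one_apply]

theorem orbitMap_chart {g : G} (hg : C.chart.symm (C.chart g) = g) (v : V) :
    C.orbitMap ρ v (C.chart g) = ρ g v := by
  rw [orbitMap, hg]

namespace IsSmoothRep

/-- The differential of a smooth representation at the identity. -/
noncomputable def diff (h : C.IsSmoothRep ρ) : E →ₗ[ℝ] V →ₗ[ℝ] V :=
  LinearMap.mk₂ ℝ (fun X v => fderiv ℝ (C.orbitMap ρ v) 0 X)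
    (fun _ _ _ => map_add _ _ _) (fun _ _ _ => map_smul _ _ _)
    (fun X v w => by
      have hadd : C.orbitMap ρ (v + w) = fun x => C.orbitMap ρ v x + C.orbitMap ρ w x :=
        funext fun x => map_add _ v w
      rw [hadd, fderiv_fun_add ((h v).differentiableAt (by simp))
        ((h w).differentiableAt (by simp)), add_apply])
    (fun c X v => by
      have hsmul : C.orbitMap ρ (c • v) = fun x => c • C.orbitMap ρ v x :=
        funext fun x => map_smul _ c v
      rw [hsmul, fderiv_fun_const_smul ((h v).differentiableAt (by simp)),
        smul_apply])

theorem diff_apply (h : C.IsSmoothRep ρ) (X : E) (v : V) :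
    h.diff X v = fderiv ℝ (C.orbitMap ρ v) 0 X := rfl

theorem hasFDerivAt (h : C.IsSmoothRep ρ) (v : V) :
    HasFDerivAt (C.orbitMap ρ v) (fderiv ℝ (C.orbitMap ρ v) 0) 0 :=
  ((h v).differentiableAt (by simp)).hasFDerivAt

theorem eventually_differentiableAt (h : C.IsSmoothRep ρ) (v : V) :
    ∀ᶠ x in 𝓝 0, DifferentiableAt ℝ (C.orbitMap ρ v) x :=
  eventually_differentiableAt_of_contDiffAt (h v) (by simp)

theorem hasDerivAt_orbitMap_smul (h : C.IsSmoothRep ρ) (X : E) (v : V) :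
    HasDerivAt (fun s : ℝ => C.orbitMap ρ v (s • X)) (h.diff X v) 0 :=
  (h.hasFDerivAt v).comp_hasDerivAt_of_eq 0 (hasDerivAt_smul_const_zero X) (zero_smul ℝ X).symm

theorem hasDerivAt_of_hasDerivAt (h : C.IsSmoothRep ρ) (v : V) {c : ℝ → G} {X : E}
    (hc1 : c 0 = 1) (hc : ContinuousAt c 0) (hX : HasDerivAt (fun t => C.chart (c t)) X 0) :
    HasDerivAt (fun t => ρ (c t) v) (h.diff X v) 0 := by
  refine ((h.hasFDerivAt v).comp_hasDerivAt_of_eq 0 hX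
    (by rw [hc1, C.map_one])).congr_of_eventuallyEq ?_
  rw [ContinuousAt, hc1] at hc
  filter_upwards [hc.eventually C.eventually_symm_chart] with t ht
  exact (orbitMap_chart ht v).symm

theorem tendsto_one (h : C.IsSmoothRep ρ) (v : V) : Tendsto (fun g => ρ g v) (𝓝 1) (𝓝 v) := by
  have hv : Tendsto (C.orbitMap ρ v) (𝓝 0) (𝓝 v) := by
    simpa using (h.hasFDerivAt v).continuousAt.tendsto
  refine (hv.comp C.tendsto_chart).congr' ?_
  filter_upwards [C.eventually_symm_chart] with g hg using orbitMap_chart hg v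

variable [FiniteDimensional ℝ V]

theorem continuous [IsTopologicalGroup G] (h : C.IsSmoothRep ρ) (v : V) :
    Continuous fun g => ρ g v := by
  refine continuous_iff_continuousAt.2 fun g => ?_
  have hg : Tendsto (fun k : G => g⁻¹ * k) (𝓝 g) (𝓝 1) :=
    Continuous.tendsto' (by fun_prop) _ _ (inv_mul_cancel g)
  have hρg : Continuous (ρ g) := (ρ g).continuous_of_finiteDimensional
  refine ((hρg.tendsto v).comp ((h.tendsto_one v).comp hg)).congr fun k => ?_
  simp only [Function.comp_apply, ← Module.End.mul_apply, ← map_mul, mul_inv_cancel_left]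

/-- The derivative of the orbit map of `v` along a left-invariant field. -/
theorem eventually_fderiv_field [ContinuousMul G] (h : C.IsSmoothRep ρ) (X : E) (v : V) :
    ∀ᶠ x in 𝓝 (0 : E),
      fderiv ℝ (C.orbitMap ρ v) x (C.field X x) = C.orbitMap ρ (h.diff X v) x := by
  filter_upwards [h.eventually_differentiableAt v, C.chart.open_target.mem_nhds C.zero_mem_target,
    C.eventually_hasFDerivAt_mul, C.mul_zero_right] with x hx hxt hmul hx0
  have hline : HasDerivAt (fun s : ℝ => C.mul (x, s • X)) (C.field X x) 0 :=
    hmul.comp_hasDerivAt_of_eq 0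
      ((hasDerivAt_const (0 : ℝ) x).prodMk (hasDerivAt_smul_const_zero X)) (by rw [zero_smul])
  have hchart : HasDerivAt (fun s : ℝ => C.orbitMap ρ v (C.mul (x, s • X)))
      (fderiv ℝ (C.orbitMap ρ v) x (C.field X x)) 0 :=
    hx.hasFDerivAt.comp_hasDerivAt_of_eq 0 hline (by rw [zero_smul, hx0])
  have htrans : HasDerivAt (fun s : ℝ => ρ (C.chart.symm x) (C.orbitMap ρ v (s • X)))
      (C.orbitMap ρ (h.diff X v) x) 0 :=
    (LinearMap.toContinuousLinearMap (ρ (C.chart.symm x))).hasFDerivAt.comp_hasDerivAt 0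
      (h.hasDerivAt_orbitMap_smul X v)
  refine hchart.unique (htrans.congr_of_eventuallyEq ?_)
  have hs : Tendsto (fun s : ℝ => C.chart.symm x * C.chart.symm (s • X)) (𝓝 0)
      (𝓝 (C.chart.symm x)) := by
    have hsX : Tendsto (fun s : ℝ => s • X) (𝓝 0) (𝓝 0) :=
      Continuous.tendsto' (by fun_prop) _ _ (by simp)
    simpa using (tendsto_const_nhds (x := C.chart.symm x)).mul (C.tendsto_symm.comp hsX)
  filter_upwards [hs.eventually (C.chart.open_source.mem_nhds (C.chart.map_target hxt))] with s hs
  rw [orbitMap, mul, C.chart.left_inv hs, map_mul, Module.End.mul_apply, orbitMap]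

end IsSmoothRep

theorem exists_integralCurve [CompleteSpace E] (C : GroupChart G E) (X : E) :
    ∃ α : ℝ → E, α 0 = 0 ∧ ∀ᶠ t in 𝓝 0, HasDerivAt α (C.field X (α t)) t := by
  obtain ⟨α, hα0, ε, hε, hα⟩ :=
    (C.contDiffAt_field X).exists_forall_mem_closedBall_exists_eq_forall_mem_Ioo_hasDerivAt₀ 0
  refine ⟨α, hα0, ?_⟩
  filter_upwards [Ioo_mem_nhds (by linarith : 0 - ε < 0) (by linarith : 0 < 0 + ε)] with t ht
  exact hα t ht

variable [FiniteDimensional ℝ V]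

theorem IsSmoothRep.eventually_orbitMap_eq [ContinuousMul G] (h : C.IsSmoothRep ρ) {X : E}
    {w : V} (hw : h.diff X w = 0) {α : ℝ → E} (hα0 : α 0 = 0)
    (hα : ∀ᶠ t in 𝓝 0, HasDerivAt α (C.field X (α t)) t) :
    ∀ᶠ t in 𝓝 0, C.orbitMap ρ w (α t) = w := by
  have hlim : Tendsto α (𝓝 0) (𝓝 0) := by simpa [hα0] using hα.self_of_nhds.continuousAt.tendsto
  have hderiv : ∀ᶠ t in 𝓝 (0 : ℝ), HasDerivAt (fun t => C.orbitMap ρ w (α t)) 0 t := by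
    filter_upwards [hα, hlim.eventually (h.eventually_fderiv_field X w),
      hlim.eventually (h.eventually_differentiableAt w)] with t hαt hfield hdiff
    have := hdiff.hasFDerivAt.comp_hasDerivAt t hαt
    rwa [hfield, hw, orbitMap, map_zero] at this
  filter_upwards [eventually_eq_of_eventually_hasDerivAt_zero hderiv] with t ht
  rw [ht, hα0, orbitMap_zero]

theorem IsSmoothRep.exists_curve_fixing [CompleteSpace E] [ContinuousMul G]
    (h : C.IsSmoothRep ρ) {X : E} {W : Submodule ℝ V} (hX : ∀ w ∈ W, h.diff X w = 0) :
    ∃ c : ℝ → G, c 0 = 1 ∧ ContinuousAt c 0 ∧ HasDerivAt (fun t => C.chart (c t)) X 0 ∧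
      ∀ᶠ t in 𝓝 0, ∀ w ∈ W, ρ (c t) w = w := by
  obtain ⟨α, hα0, hα⟩ := C.exists_integralCurve X
  have hd0 : HasDerivAt α X 0 := by
    have := hα.self_of_nhds
    rwa [hα0, C.field_zero] at this
  have hlim : Tendsto α (𝓝 0) (𝓝 0) := by simpa [hα0] using hd0.continuousAt.tendsto
  have hc1 : C.chart.symm (α 0) = 1 := by rw [hα0, C.symm_zero]
  refine ⟨fun t => C.chart.symm (α t), hc1, ?_, ?_, ?_⟩
  · rw [ContinuousAt, hc1]
    exact C.tendsto_symm.comp hlim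
  · refine hd0.congr_of_eventuallyEq ?_
    filter_upwards [hlim.eventually C.eventually_chart_symm] with t ht using ht
  · obtain ⟨s, hs⟩ : W.FG := IsNoetherian.noetherian W
    have hfix : ∀ w ∈ s, ∀ᶠ t in 𝓝 (0 : ℝ), ρ (C.chart.symm (α t)) w = w := fun w hw =>
      h.eventually_orbitMap_eq (hX w (hs ▸ Submodule.subset_span hw)) hα0 hα
    filter_upwards [(Finset.eventually_all s).2 hfix] with t ht w hw
    have : W ≤ LinearMap.eqLocus (ρ (C.chart.symm (α t))) LinearMap.id := by
      rw [← hs, Submodule.span_le]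
      exact ht
    exact this hw

end GroupChart

theorem IsContHom.eq_of_eventuallyEq {W G : Type*} [AddGroup W] [TopologicalSpace W]
    [IsTopologicalAddGroup W] [ConnectedSpace W] [Group G] [TopologicalSpace G] {c c' : W → G}
    (hc : IsContHom c) (hc' : IsContHom c') (h : c =ᶠ[𝓝 0] c') : c = c' := by
  let U : AddSubgroup W :=
    { carrier := {t | c t = c' t}
      zero_mem' := by rw [Set.mem_ofPred_eq, hc.map_zero, hc'.map_zero]
      add_mem' := fun {s t} (hs : c s = c' s) (ht : c t = c' t) => by
        rw [Set.mem_ofPred_eq, hc.map_add, hc'.map_add, hs, ht]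
      neg_mem' := fun {t} (ht : c t = c' t) => by
        rw [Set.mem_ofPred_eq, hc.map_neg, hc'.map_neg, ht] }
  have hU : IsOpen (U : Set W) := U.isOpen_of_mem_nhds h
  have huniv := IsClopen.eq_univ ⟨U.isClosed_of_isOpen hU, hU⟩ ⟨0, U.zero_mem⟩
  exact funext fun t => huniv.ge (Set.mem_univ t)

section OneParam

variable {G E V : Type*} [Group G] [TopologicalSpace G]
  [NormedAddCommGroup E] [NormedSpace ℝ E] [FiniteDimensional ℝ E]
  [NormedAddCommGroup V] [NormedSpace ℝ V]
  {C : GroupChart G E} {ρ : Representation ℝ G V} {c : ℝ → G}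

namespace GroupChart

theorem differentiableAt_chart_comp (C : GroupChart G E) (hc : IsContHom c) :
    DifferentiableAt ℝ (fun t => C.chart (c t)) 0 := by
  have hsymm : ∀ᶠ t in 𝓝 0, C.chart.symm (C.chart (c t)) = c t :=
    hc.tendsto.eventually C.eventually_symm_chart
  have hfst : Tendsto (fun p : ℝ × ℝ => C.chart (c p.1)) (𝓝 0) (𝓝 0) :=
    (C.tendsto_chart.comp hc.tendsto).comp continuous_fst.continuousAt
  have hsnd : Tendsto (fun p : ℝ × ℝ => C.chart (c p.2)) (𝓝 0) (𝓝 0) :=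
    (C.tendsto_chart.comp hc.tendsto).comp continuous_snd.continuousAt
  refine differentiableAt_zero_of_almost_additive ?_ fun ε hε => ?_
  · filter_upwards [hc.tendsto.eventually
      (C.chart.open_source.eventually_mem C.one_mem_source)] with t ht
    exact ContinuousAt.comp (f := c) (C.chart.continuousAt ht) hc.continuous.continuousAt
  -- Strict differentiability of multiplication compares the products `c s * c t` and `c s * 1`.
  · have hpair : Tendsto (fun p : ℝ × ℝ => ((C.chart (c p.1), C.chart (c p.2)),
        (C.chart (c p.1), (0 : E)))) (𝓝 0) (𝓝 (0, 0)) :=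
      (hfst.prodMk_nhds hsnd).prodMk_nhds (hfst.prodMk_nhds tendsto_const_nhds)
    filter_upwards [hpair.eventually (C.hasStrictFDerivAt_mul.isLittleO.def hε),
      hfst.eventually C.mul_zero_right,
      (continuous_fst.tendsto (0 : ℝ × ℝ)).eventually hsymm,
      (continuous_snd.tendsto (0 : ℝ × ℝ)).eventually hsymm] with p hp hp0 hp1 hp2
    rw [← C.chart_mul hp1 hp2, hp0, ← hc.map_add] at hp
    simpa using hp

/-- The velocity at the identity of a curve in the group, meant for one-parameter groups. -/
noncomputable def velocity (C : GroupChart G E) (c : ℝ → G) : E :=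
  deriv (fun t => C.chart (c t)) 0

theorem hasDerivAt_velocity (C : GroupChart G E) (hc : IsContHom c) :
    HasDerivAt (fun t => C.chart (c t)) (C.velocity c) 0 :=
  (C.differentiableAt_chart_comp hc).hasDerivAt

theorem eventually_hasDerivAt_field (C : GroupChart G E) (hc : IsContHom c) :
    ∀ᶠ t in 𝓝 0, HasDerivAt (fun t => C.chart (c t))
      (C.field (C.velocity c) (C.chart (c t))) t := by
  filter_upwards [(C.tendsto_chart.comp hc.tendsto).eventually C.eventually_hasFDerivAt_mul,
    hc.tendsto.eventually C.eventually_symm_chart] with t hmul ht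
  have hvel : HasDerivAt (fun s => C.chart (c s)) (C.velocity c) (t - t) := by
    rw [sub_self]; exact C.hasDerivAt_velocity hc
  have hpair := (hasDerivAt_const t (C.chart (c t))).prodMk (hvel.comp_sub_const t t)
  refine (hmul.comp_hasDerivAt_of_eq t hpair
    (by rw [sub_self, hc.map_zero, C.map_one, Function.comp_apply])).congr_of_eventuallyEq ?_
  have hsub : Tendsto (fun s => c (s - t)) (𝓝 t) (𝓝 1) :=
    hc.tendsto.comp (Continuous.tendsto' (by fun_prop) _ _ (sub_self t))
  filter_upwards [hsub.eventually C.eventually_symm_chart] with s hs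
  rw [Function.comp_apply, ← C.chart_mul ht hs, ← hc.map_add, add_sub_cancel]

theorem eq_of_velocity_eq (C : GroupChart G E) {c' : ℝ → G} (hc : IsContHom c)
    (hc' : IsContHom c') (h : C.velocity c = C.velocity c') : c = c' := by
  obtain ⟨K, s, hs, hlip⟩ := (C.contDiffAt_field (C.velocity c)).exists_lipschitzOnWith
  have hmem : ∀ {b : ℝ → G}, IsContHom b → ∀ᶠ t in 𝓝 (0 : ℝ), C.chart (b t) ∈ s :=
    fun hb => (C.tendsto_chart.comp hb.tendsto).eventually hs
  have heq := ODE_solution_unique_of_eventually (v := fun _ => C.field (C.velocity c))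
    (s := fun _ => s) (t₀ := 0) (Eventually.of_forall fun _ => hlip)
    ((C.eventually_hasDerivAt_field hc).and (hmem hc))
    ((h ▸ C.eventually_hasDerivAt_field hc').and (hmem hc'))
    (by rw [hc.map_zero, hc'.map_zero])
  refine hc.eq_of_eventuallyEq hc' ?_
  filter_upwards [heq, hc.tendsto.eventually C.eventually_symm_chart,
    hc'.tendsto.eventually C.eventually_symm_chart] with t h1 h2 h3
  rw [← h2, ← h3, h1]

variable [FiniteDimensional ℝ V]

theorem IsSmoothRep.hasDerivAt_comp (h : C.IsSmoothRep ρ) (hc : IsContHom c) (v : V) (t : ℝ) :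
    HasDerivAt (fun t => ρ (c t) v) (ρ (c t) (h.diff (C.velocity c) v)) t := by
  have h0 : HasDerivAt (fun s => ρ (c s) v) (h.diff (C.velocity c) v) (t - t) := by
    rw [sub_self]
    exact h.hasDerivAt_of_hasDerivAt v hc.map_zero hc.continuous.continuousAt
      (C.hasDerivAt_velocity hc)
  refine ((LinearMap.toContinuousLinearMap (ρ (c t))).hasFDerivAt.comp_hasDerivAt t
    (h0.comp_sub_const t t)).congr_of_eventuallyEq (Eventually.of_forall fun s => ?_)
  rw [Function.comp_apply, LinearMap.coe_toContinuousLinearMap', ← Module.End.mul_apply,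
    ← map_mul, ← hc.map_add, add_sub_cancel]

theorem IsSmoothRep.apply_eq_of_diff_velocity_eq_zero (h : C.IsSmoothRep ρ) (hc : IsContHom c)
    {v : V} (hv : h.diff (C.velocity c) v = 0) (t : ℝ) : ρ (c t) v = v := by
  have hderiv : ∀ s, HasDerivAt (fun t => ρ (c t) v) 0 s := fun s => by
    have := h.hasDerivAt_comp hc v s
    rwa [hv, map_zero] at this
  have hconst := is_const_of_deriv_eq_zero (fun s => (hderiv s).differentiableAt)
    (fun s => (hderiv s).deriv) t 0
  simpa [hc.map_zero] using hconst

end GroupChart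

end OneParam

section InvariantInner

theorem exists_linearEquiv_euclidean_of_posDef {V : Type*} [AddCommGroup V] [Module ℝ V]
    [FiniteDimensional ℝ V] (B : V →ₗ[ℝ] V →ₗ[ℝ] ℝ) (hsymm : ∀ v w, B v w = B w v)
    (hpos : ∀ v, v ≠ 0 → 0 < B v v) :
    ∃ e : V ≃ₗ[ℝ] EuclideanSpace ℝ (Fin (Module.finrank ℝ V)),
      ∀ v w, inner ℝ (e v) (e w) = B v w := by
  let core : InnerProductSpace.Core ℝ V :=
    { inner := fun v w => B v w
      conj_inner_symm := fun v w => by simpa using hsymm w v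
      re_inner_nonneg := fun v => by
        rcases eq_or_ne v 0 with rfl | hv
        · simp
        · exact (hpos v hv).le
      add_left := fun u v w => by simp
      smul_left := fun u v r => by simp
      definite := fun v hv => by
        by_contra h
        exact (hpos v h).ne' hv }
  let _ : NormedAddCommGroup V := core.toNormedAddCommGroup
  let _ : InnerProductSpace ℝ V := InnerProductSpace.ofCore core.toCore
  let e := (stdOrthonormalBasis ℝ V).repr
  exact ⟨e.toLinearEquiv, fun v w => e.inner_map_map v w⟩

open MeasureTheory in
theorem exists_invariant_posDef {G V : Type*} [Group G] [TopologicalSpace G]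
    [IsTopologicalGroup G] [CompactSpace G] [NormedAddCommGroup V] [NormedSpace ℝ V]
    [FiniteDimensional ℝ V] (ρ : Representation ℝ G V) (hρ : ∀ v, Continuous fun g => ρ g v) :
    ∃ B : V →ₗ[ℝ] V →ₗ[ℝ] ℝ, (∀ v w, B v w = B w v) ∧ (∀ v, v ≠ 0 → 0 < B v v) ∧
      ∀ g v w, B (ρ g v) (ρ g w) = B v w := by
  borelize G
  let μ : Measure G := Measure.haar
  let e : V ≃ₗ[ℝ] EuclideanSpace ℝ (Fin (Module.finrank ℝ V)) :=
    LinearEquiv.ofFinrankEq _ _ (by simp)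
  have he : Continuous e := e.toLinearMap.continuous_of_finiteDimensional
  have hcont : ∀ v w, Continuous fun g : G => inner ℝ (e (ρ g⁻¹ v)) (e (ρ g⁻¹ w)) := fun v w =>
    (he.comp ((hρ v).comp continuous_inv)).inner (he.comp ((hρ w).comp continuous_inv))
  have hint : ∀ v w, Integrable (fun g : G => inner ℝ (e (ρ g⁻¹ v)) (e (ρ g⁻¹ w))) μ := fun v w =>
    (hcont v w).integrable_of_hasCompactSupport (HasCompactSupport.of_compactSpace _)
  let B : V →ₗ[ℝ] V →ₗ[ℝ] ℝ := LinearMap.mk₂ ℝ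
    (fun v w => ∫ g, inner ℝ (e (ρ g⁻¹ v)) (e (ρ g⁻¹ w)) ∂μ)
    (fun v v' w => by
      simp only [map_add, inner_add_left]
      exact integral_add (hint v w) (hint v' w))
    (fun c v w => by
      simp only [map_smul, real_inner_smul_left]
      exact integral_const_mul _ _)
    (fun v w w' => by
      simp only [map_add, inner_add_right]
      exact integral_add (hint v w) (hint v w'))
    (fun c v w => by
      simp only [map_smul, real_inner_smul_right]
      exact integral_const_mul _ _)
  have hB : ∀ v w, B v w = ∫ g, inner ℝ (e (ρ g⁻¹ v)) (e (ρ g⁻¹ w)) ∂μ := fun v w => rfl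
  refine ⟨B, fun v w => by simp only [hB, real_inner_comm], fun v hv => ?_, fun g v w => ?_⟩
  · rw [hB]
    refine (hcont v v).integral_pos_of_hasCompactSupport_nonneg_nonzero
      (HasCompactSupport.of_compactSpace _) (fun g => real_inner_self_nonneg) (x := 1) ?_
    simpa using hv
  · rw [hB, hB, ← integral_mul_left_eq_self (μ := μ)
      (fun k : G => inner ℝ (e (ρ k⁻¹ v)) (e (ρ k⁻¹ w))) g⁻¹]
    simp only [mul_inv_rev, inv_inv, map_mul, Module.End.mul_apply]

end InvariantInner

namespace GroupChart

section Velocity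

variable {G E : Type*} [Group G] [TopologicalSpace G] [NormedAddCommGroup E] [NormedSpace ℝ E]
  [FiniteDimensional ℝ E] {c : ℝ → G}

theorem velocity_mul (C : GroupChart G E) {c' : ℝ → G} (hc : IsContHom c) (hc' : IsContHom c') :
    C.velocity (fun t => c t * c' t) = C.velocity c + C.velocity c' := by
  have hpair := C.hasFDerivAt_mul.comp_hasDerivAt_of_eq 0
    ((C.hasDerivAt_velocity hc).prodMk (C.hasDerivAt_velocity hc'))
    (by rw [hc.map_zero, hc'.map_zero, C.map_one, Prod.mk_zero_zero])
  refine (hpair.congr_of_eventuallyEq ?_).deriv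
  filter_upwards [hc.tendsto.eventually C.eventually_symm_chart,
    hc'.tendsto.eventually C.eventually_symm_chart] with t ht ht' using C.chart_mul ht ht'

theorem velocity_comp_mul (C : GroupChart G E) (hc : IsContHom c) (a : ℝ) :
    C.velocity (fun t => c (t * a)) = a • C.velocity c := by
  have hscale : HasDerivAt (fun t : ℝ => t * a) a 0 := by
    simpa using (hasDerivAt_id (0 : ℝ)).mul_const a
  exact ((C.hasDerivAt_velocity hc).scomp_of_eq 0 hscale (zero_mul a).symm).deriv

/-- The differential at the origin of a continuous homomorphism from a vector space to the
group. -/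
noncomputable def velocityMap (C : GroupChart G E) {F : Type*} [NormedAddCommGroup F]
    [NormedSpace ℝ F] {ψ : F → G} (hψ : IsContHom ψ) : F →ₗ[ℝ] E where
  toFun x := C.velocity fun t => ψ (t • x)
  map_add' x y := by
    rw [← C.velocity_mul (hψ.line x) (hψ.line y)]
    simp only [smul_add, hψ.map_add]
  map_smul' a x := by
    rw [RingHom.id_apply, ← C.velocity_comp_mul (hψ.line x)]
    simp only [smul_smul]

end Velocity

variable {G E V : Type*} [Group G] [TopologicalSpace G] [NormedAddCommGroup E]
  [NormedSpace ℝ E] [NormedAddCommGroup V] [NormedSpace ℝ V] {ρ : Representation ℝ G V}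

/-- Conjugation by `g`, read in the chart. -/
def conj (C : GroupChart G E) (g : G) (x : E) : E := C.chart (g * C.chart.symm x * g⁻¹)

theorem conj_zero (C : GroupChart G E) (g : G) : C.conj g 0 = 0 := by
  rw [conj, C.symm_zero, mul_one, mul_inv_cancel, C.map_one]

theorem eventually_symm_conj [IsTopologicalGroup G] (C : GroupChart G E) (g : G) :
    ∀ᶠ x in 𝓝 (0 : E), C.chart.symm (C.conj g x) = g * C.chart.symm x * g⁻¹ := by
  have hcont : Continuous fun k : G => g * k * g⁻¹ := by fun_prop
  exact ((hcont.tendsto' 1 1 (by simp)).comp C.tendsto_symm).eventually C.eventually_symm_chart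

theorem hasFDerivAt_conj (C : GroupChart G E) (g : G) :
    HasFDerivAt (C.conj g) (fderiv ℝ (C.conj g) 0) 0 :=
  ((C.contDiffAt_conj g).differentiableAt (by simp)).hasFDerivAt

theorem hasFDerivAt_comp_conj (C : GroupChart G E) (g : G) {f : E → V} {f' : E →L[ℝ] V}
    (hf : HasFDerivAt f f' 0) :
    HasFDerivAt (f ∘ C.conj g) (f'.comp (fderiv ℝ (C.conj g) 0)) 0 :=
  HasFDerivAt.comp 0 ((C.conj_zero g).symm ▸ hf) (C.hasFDerivAt_conj g)

/-- The adjoint representation. -/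
noncomputable def Ad [IsTopologicalGroup G] (C : GroupChart G E) : Representation ℝ G E where
  toFun g := (fderiv ℝ (C.conj g) 0).toLinearMap
  map_one' := by
    have hid : C.conj 1 =ᶠ[𝓝 0] id := by
      filter_upwards [C.eventually_chart_symm] with x hx
      simpa [conj] using hx
    rw [hid.fderiv_eq, fderiv_id]
    rfl
  map_mul' g k := by
    have hcomp : C.conj (g * k) =ᶠ[𝓝 0] C.conj g ∘ C.conj k := by
      filter_upwards [C.eventually_symm_conj k] with x hx
      simp only [Function.comp_apply, conj, mul_inv_rev, mul_assoc] at hx ⊢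
      rw [hx]
      simp only [mul_assoc]
    rw [hcomp.fderiv_eq, (C.hasFDerivAt_comp_conj k (C.hasFDerivAt_conj g)).fderiv]
    rfl

theorem Ad_apply [IsTopologicalGroup G] (C : GroupChart G E) (g : G) (X : E) :
    C.Ad g X = fderiv ℝ (C.conj g) 0 X := rfl

theorem velocity_conj [IsTopologicalGroup G] [FiniteDimensional ℝ E] (C : GroupChart G E)
    {c : ℝ → G} (hc : IsContHom c) (g : G) :
    C.velocity (fun t => g * c t * g⁻¹) = C.Ad g (C.velocity c) := by
  have hconj := (C.hasFDerivAt_conj g).comp_hasDerivAt_of_eq 0 (C.hasDerivAt_velocity hc)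
    (by rw [hc.map_zero, C.map_one])
  refine (hconj.congr_of_eventuallyEq ?_).deriv
  filter_upwards [hc.tendsto.eventually C.eventually_symm_chart] with t ht
  rw [Function.comp_apply, conj, ht]

theorem IsSmoothRep.diff_Ad [IsTopologicalGroup G] {C : GroupChart G E} [FiniteDimensional ℝ V]
    (h : C.IsSmoothRep ρ) (g : G) (X : E) (v : V) :
    h.diff (C.Ad g X) (ρ g v) = ρ g (h.diff X v) := by
  have hleft := C.hasFDerivAt_comp_conj g (h.hasFDerivAt (ρ g v))
  have hright := (LinearMap.toContinuousLinearMap (ρ g)).hasFDerivAt.comp 0 (h.hasFDerivAt v)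
  have heq : C.orbitMap ρ (ρ g v) ∘ C.conj g =ᶠ[𝓝 0]
      LinearMap.toContinuousLinearMap (ρ g) ∘ C.orbitMap ρ v := by
    filter_upwards [C.eventually_symm_conj g] with x hx
    simp only [Function.comp_apply, orbitMap, hx, LinearMap.coe_toContinuousLinearMap',
      ← Module.End.mul_apply, ← map_mul, inv_mul_cancel_right]
  exact congrArg (fun f : E →L[ℝ] V => f X) (hleft.unique (hright.congr_of_eventuallyEq heq))

theorem isSmoothRep_Ad [IsTopologicalGroup G] (C : GroupChart G E) : C.IsSmoothRep C.Ad := by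
  intro Z
  let Q : E × E → E := fun p => C.conj (C.chart.symm p.1) p.2
  have hQ : ContDiffAt ℝ ∞ (fderiv ℝ Q) ((0 : E), (0 : E)) :=
    C.contDiffAt_conj₂.fderiv_right (by simp)
  have hQ₁ : ContDiffAt ℝ ∞ (fun x : E => fderiv ℝ Q (x, 0)) 0 :=
    ContDiffAt.comp (g := fderiv ℝ Q) (f := fun x : E => (x, (0 : E))) 0 hQ (by fun_prop)
  refine (hQ₁.clm_apply (contDiffAt_const (c := ((0 : E), Z)))).congr_of_eventuallyEq ?_
  have hinl : Tendsto (fun x : E => (x, (0 : E))) (𝓝 0) (𝓝 0) :=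
    Continuous.tendsto' (by fun_prop) _ _ rfl
  filter_upwards [hinl.eventually (eventually_differentiableAt_of_contDiffAt C.contDiffAt_conj₂
    (by simp))] with x hx
  have hpartial : HasFDerivAt (C.conj (C.chart.symm x))
      ((fderiv ℝ Q (x, 0)).comp (ContinuousLinearMap.inr ℝ E E)) 0 :=
    HasFDerivAt.comp (𝕜 := ℝ) (g := Q) (f := fun y : E => (x, y)) 0 hx.hasFDerivAt
      (hasFDerivAt_prodMk_right x 0)
  rw [orbitMap, C.Ad_apply, hpartial.fderiv]
  simp

/-- The derivative in `y = 0` of `x * y = (x * y * x⁻¹) * x`. -/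
theorem eventually_fderiv_mul_inr [IsTopologicalGroup G] (C : GroupChart G E) (Z : E) :
    ∀ᶠ x in 𝓝 (0 : E),
      fderiv ℝ C.mul (x, 0) (0, Z) = fderiv ℝ C.mul (0, x) (C.orbitMap C.Ad Z x, 0) := by
  have hinr : Tendsto (fun x : E => ((0 : E), x)) (𝓝 0) (𝓝 0) :=
    Continuous.tendsto' (by fun_prop) _ _ rfl
  filter_upwards [C.eventually_hasFDerivAt_mul, hinr.eventually
    (eventually_differentiableAt_of_contDiffAt C.contDiffAt_mul (by simp))] with x hx₁ hx₂
  have hleft : HasFDerivAt (fun y : E => C.mul (x, y))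
      ((fderiv ℝ C.mul (x, 0)).comp (ContinuousLinearMap.inr ℝ E E)) 0 :=
    HasFDerivAt.comp (𝕜 := ℝ) (g := C.mul) (f := fun y : E => (x, y)) 0 hx₁
      (hasFDerivAt_prodMk_right x 0)
  have hleft' : HasFDerivAt (fun y : E => C.mul (y, x))
      ((fderiv ℝ C.mul (0, x)).comp (ContinuousLinearMap.inl ℝ E E)) 0 :=
    HasFDerivAt.comp (𝕜 := ℝ) (g := C.mul) (f := fun y : E => (y, x)) 0 hx₂.hasFDerivAt
      (hasFDerivAt_prodMk_left 0 x)
  have hright := C.hasFDerivAt_comp_conj (C.chart.symm x) hleft'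
  have heq : (fun y : E => C.mul (x, y)) =ᶠ[𝓝 0]
      (fun y : E => C.mul (y, x)) ∘ C.conj (C.chart.symm x) := by
    filter_upwards [C.eventually_symm_conj (C.chart.symm x)] with y hy
    simp only [Function.comp_apply, mul, hy, inv_mul_cancel_right]
  simpa [orbitMap, C.Ad_apply] using
    congrArg (fun f : E →L[ℝ] E => f Z) (hleft.unique (hright.congr_of_eventuallyEq heq))

theorem fderiv_fderiv_mul_inl_inr [IsTopologicalGroup G] (C : GroupChart G E) (W Z : E) :
    fderiv ℝ (fderiv ℝ C.mul) 0 (W, 0) (0, Z) =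
      fderiv ℝ (fderiv ℝ C.mul) 0 (0, W) (Z, 0) + C.isSmoothRep_Ad.diff W Z := by
  have hD : HasFDerivAt (fderiv ℝ C.mul) (fderiv ℝ (fderiv ℝ C.mul) 0) ((0 : E), (0 : E)) :=
    ((C.contDiffAt_mul.fderiv_right (m := 1) (by norm_cast)).differentiableAt
      (by simp)).hasFDerivAt
  have hinl := HasFDerivAt.comp (g := fderiv ℝ C.mul) (f := fun x : E => (x, (0 : E))) 0 hD
    (hasFDerivAt_prodMk_left 0 0)
  have hinr := HasFDerivAt.comp (g := fderiv ℝ C.mul) (f := fun x : E => ((0 : E), x)) 0 hD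
    (hasFDerivAt_prodMk_right 0 0)
  have hleft := hinl.clm_apply (hasFDerivAt_const ((0 : E), Z) (0 : E))
  have hright := hinr.clm_apply
    ((C.isSmoothRep_Ad.hasFDerivAt Z).prodMk (hasFDerivAt_const (0 : E) (0 : E)))
  have hval := congrArg (fun f : E →L[ℝ] E => f W)
    (hleft.unique (hright.congr_of_eventuallyEq (C.eventually_fderiv_mul_inr Z)))
  have hmul : fderiv ℝ C.mul (0, 0) = _ := C.hasFDerivAt_mul.fderiv
  simp only [Function.comp_apply, hmul, ContinuousLinearMap.comp_zero, zero_add,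
    ContinuousLinearMap.flip_apply, ContinuousLinearMap.comp_apply,
    ContinuousLinearMap.inl_apply, ContinuousLinearMap.add_comp,
    ContinuousLinearMap.fst_comp_prod, ContinuousLinearMap.snd_comp_prod, add_zero,
    orbitMap_zero, add_apply, ContinuousLinearMap.inr_apply] at hval
  rw [hval, add_comm, C.isSmoothRep_Ad.diff_apply]

/-- Antisymmetry of the Lie bracket `[W, Z] = d/dt Ad(exp tW) Z`. -/
theorem diff_Ad_antisymm [IsTopologicalGroup G] (C : GroupChart G E) (W Z : E) :
    C.isSmoothRep_Ad.diff W Z = -C.isSmoothRep_Ad.diff Z W := by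
  have hsymm : IsSymmSndFDerivAt ℝ C.mul 0 :=
    C.contDiffAt_mul.isSymmSndFDerivAt (by simpa using ENat.LEInfty.out)
  have hWZ := C.fderiv_fderiv_mul_inl_inr W Z
  have hZW := C.fderiv_fderiv_mul_inl_inr Z W
  rw [hsymm (Z, 0)] at hZW
  rw [hsymm (W, 0), hZW, add_right_comm, add_assoc, left_eq_add] at hWZ
  exact eq_neg_of_add_eq_zero_left hWZ

end GroupChart

namespace GroupChart

variable {G E V : Type*} [Group G] [TopologicalSpace G] [NormedAddCommGroup E]
  [NormedSpace ℝ E] [NormedAddCommGroup V] [NormedSpace ℝ V] {ρ : Representation ℝ G V}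

theorem IsSmoothRep.diff_skew [FiniteDimensional ℝ V] {C : GroupChart G E} (h : C.IsSmoothRep ρ)
    {B : V →ₗ[ℝ] V →ₗ[ℝ] ℝ} (hB : ∀ g v w, B (ρ g v) (ρ g w) = B v w) (X : E) (v w : V) :
    B (h.diff X v) w = -B v (h.diff X w) := by
  have hcurve := ((LinearMap.toContinuousBilinearMap B).isBoundedBilinearMap.hasFDerivAt
    (C.orbitMap ρ v (0 : E), C.orbitMap ρ w 0)).comp_hasDerivAt_of_eq 0
    ((h.hasDerivAt_orbitMap_smul X v).prodMk (h.hasDerivAt_orbitMap_smul X w))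
    (by rw [zero_smul])
  have hconst : HasDerivAt
      (fun s : ℝ => B (C.orbitMap ρ v (s • X)) (C.orbitMap ρ w (s • X))) 0 0 := by
    simpa only [orbitMap, hB] using hasDerivAt_const (0 : ℝ) (B v w)
  have hsum : B v (h.diff X w) + B (h.diff X v) w = 0 := by
    simpa using hcurve.unique hconst
  linarith

variable [FiniteDimensional ℝ E]

/-- At a maximum of `g ↦ ⟨Ad(g) X, Y⟩` the bracket `[Ad(g) X, Y]` vanishes. -/
theorem exists_diff_Ad_eq_zero [IsTopologicalGroup G] [CompactSpace G] (C : GroupChart G E)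
    (X Y : E) : ∃ g, C.isSmoothRep_Ad.diff (C.Ad g X) Y = 0 := by
  have hAd := C.isSmoothRep_Ad
  obtain ⟨B, -, hpos, hinv⟩ := exists_invariant_posDef C.Ad hAd.continuous
  let β : E →L[ℝ] ℝ := LinearMap.toContinuousLinearMap (B.flip Y)
  obtain ⟨g, -, hg⟩ := isCompact_univ.exists_isMaxOn (Set.univ_nonempty (α := G))
    (f := fun g => β (C.Ad g X)) (β.continuous.comp (hAd.continuous X)).continuousOn
  have hcrit : ∀ W, B (hAd.diff W (C.Ad g X)) Y = 0 := fun W => by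
    have hmax : IsLocalMax (fun s : ℝ => β (C.orbitMap C.Ad (C.Ad g X) (s • W))) 0 :=
      Eventually.of_forall fun s => by
        simpa [orbitMap, C.symm_zero, ← Module.End.mul_apply, ← map_mul] using
          hg (Set.mem_univ (C.chart.symm (s • W) * g))
    exact hmax.hasDerivAt_eq_zero
      (β.hasFDerivAt.comp_hasDerivAt 0 (hAd.hasDerivAt_orbitMap_smul W _))
  refine ⟨g, not_not.1 fun hne => (hpos _ hne).ne' ?_⟩
  have hzero := hcrit (hAd.diff (C.Ad g X) Y)
  rw [C.diff_Ad_antisymm, map_neg, LinearMap.neg_apply, hAd.diff_skew hinv, neg_neg] at hzero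
  exact hzero

theorem commute_of_diff_Ad_eq_zero [IsTopologicalGroup G] [T2Space G] (C : GroupChart G E)
    {c c' : ℝ → G} (hc : IsContHom c) (hc' : IsContHom c')
    (h : C.isSmoothRep_Ad.diff (C.velocity c) (C.velocity c') = 0) (t s : ℝ) :
    Commute (c t) (c' s) := by
  have hconj := C.eq_of_velocity_eq (hc'.conj (c t)) hc' <| by
    rw [C.velocity_conj hc', C.isSmoothRep_Ad.apply_eq_of_diff_velocity_eq_zero hc h]
  exact mul_inv_eq_iff_eq_mul.1 (congrFun hconj s)

end GroupChart

section Rank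

theorem exists_forall_commute_of_line (ι : Type*) [Fintype ι] {G : Type*} [Group G]
    [TopologicalSpace G] [ContinuousMul G] [T2Space G] :
    ∃ x : ι → ℝ, ∀ ψ : (ι → ℝ) → G, IsTorusParam ψ → ∀ k,
      (∀ t : ℝ, Commute (ψ (t • x)) k) → ∀ z, Commute (ψ z) k := by
  obtain ⟨x, hx⟩ := exists_dense_line ι
  refine ⟨x, fun ψ hψ k hk => Set.eq_univ_iff_forall.1 (hx {z | Commute (ψ z) k} ?_ ?_)⟩
  · have := hψ.continuous
    exact isClosed_eq (by fun_prop) (by fun_prop)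
  · intro t z hz
    rw [Set.mem_ofPred_eq, hψ.map_add, (hψ.eq_one_iff z).2 hz, mul_one]
    exact hk t

namespace IsTorusParam

variable {ι G E : Type*} [Fintype ι] [Group G] [TopologicalSpace G]
  [NormedAddCommGroup E] [NormedSpace ℝ E] [FiniteDimensional ℝ E] {ψ : (ι → ℝ) → G}

theorem velocityMap_injective (hψ : IsTorusParam ψ) (C : GroupChart G E) :
    Function.Injective (C.velocityMap hψ.toIsContHom) := by
  refine (injective_iff_map_eq_zero _).2 fun x hx =>
    eq_zero_of_forall_smul_mem_intLattice fun t => (hψ.eq_one_iff _).1 ?_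
  refine congrFun (C.eq_of_velocity_eq (hψ.line x) IsContHom.one (hx.trans ?_)) t
  simp [GroupChart.velocity]

theorem card_le (hψ : IsTorusParam ψ) (C : GroupChart G E) :
    Fintype.card ι ≤ Module.finrank ℝ E := by
  simpa using LinearMap.finrank_le_finrank_of_injective (hψ.velocityMap_injective C)

theorem exists_commute_conj [IsTopologicalGroup G] [CompactSpace G] [T2Space G]
    {κ : Type*} [Fintype κ] {φ : (κ → ℝ) → G} (hψ : IsTorusParam ψ) (hφ : IsTorusParam φ)
    (C : GroupChart G E) :
    ∃ g : G, ∀ x y, Commute (g * ψ x * g⁻¹) (φ y) := by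
  obtain ⟨x, hx⟩ := exists_forall_commute_of_line ι (G := G)
  obtain ⟨y, hy⟩ := exists_forall_commute_of_line κ (G := G)
  obtain ⟨g, hg⟩ := C.exists_diff_Ad_eq_zero (C.velocity fun t => ψ (t • x))
    (C.velocity fun t => φ (t • y))
  have hline : ∀ t s : ℝ, Commute (g * ψ (t • x) * g⁻¹) (φ (s • y)) :=
    C.commute_of_diff_Ad_eq_zero ((hψ.line x).conj g) (hφ.line y)
      (by rw [C.velocity_conj (hψ.line x), hg])
  exact ⟨g, fun z z' => hx _ (hψ.conj g) _
    (fun t => (hy _ hφ _ (fun s => (hline t s).symm) z').symm) z⟩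

end IsTorusParam

variable {G E : Type*} [Group G] [TopologicalSpace G]
  [NormedAddCommGroup E] [NormedSpace ℝ E] [FiniteDimensional ℝ E]

theorem bddAbove_isTorusParam (C : GroupChart G E) (K : Subgroup G) :
    BddAbove {n : ℕ | ∃ ψ : (Fin n → ℝ) → K, IsTorusParam ψ} := by
  refine ⟨Module.finrank ℝ E, ?_⟩
  rintro n ⟨ψ, hψ⟩
  simpa using hψ.of_subgroup.card_le C

variable [T2Space G]

theorem le_torusRank (C : GroupChart G E) {K : Subgroup G} {n : ℕ} {ψ : (Fin n → ℝ) → G}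
    (hψ : IsTorusParam ψ) (hK : ∀ x, ψ x ∈ K) : n ≤ torusRank K := by
  rw [torusRank_eq]
  exact le_csSup (bddAbove_isTorusParam C K) ⟨_, hψ.codRestrict hK⟩

theorem exists_isTorusParam_torusRank (C : GroupChart G E) (K : Subgroup G) :
    ∃ ψ : (Fin (torusRank K) → ℝ) → G, IsTorusParam ψ ∧ ∀ x, ψ x ∈ K := by
  have hne : {n : ℕ | ∃ ψ : (Fin n → ℝ) → K, IsTorusParam ψ}.Nonempty :=
    ⟨0, fun _ => 1, IsContHom.one, fun x => by simp [mem_intLattice]⟩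
  have hmax := Nat.sSup_mem hne (bddAbove_isTorusParam C K)
  rw [← torusRank_eq] at hmax
  obtain ⟨ψ, hψ⟩ := hmax
  exact ⟨_, hψ.of_subgroup, fun x => (ψ x).2⟩

theorem torusRank_le_of_conj [IsTopologicalGroup G] (C : GroupChart G E) {K L : Subgroup G} (g : G)
    (h : ∀ k ∈ K, g * k * g⁻¹ ∈ L) : torusRank K ≤ torusRank L := by
  obtain ⟨ψ, hψ, hK⟩ := exists_isTorusParam_torusRank C K
  exact le_torusRank C (hψ.conj g) fun x => h _ (hK x)

theorem finrank_linearPart_le_torusRank (C : GroupChart G E) {ι : Type*} [Fintype ι]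
    {ψ : (ι → ℝ) → G} (hψ : IsContHom ψ) {Λ : AddSubgroup (ι → ℝ)}
    (hΛ : IsClosed (Λ : Set (ι → ℝ))) (hZ : ∀ x ∈ intLattice ι, x ∈ Λ)
    (hker : ∀ x ∈ Λ, ψ x = 1 ↔ x ∈ intLattice ι) {K : Subgroup G} (hK : ∀ x ∈ Λ, ψ x ∈ K) :
    Module.finrank ℝ (linearPart Λ) ≤ torusRank K := by
  obtain ⟨f, hf, hfZ⟩ := exists_linearMap_range_eq_linearPart hΛ hZ
  have hfΛ : ∀ z, f z ∈ Λ := fun z => mem_of_mem_linearPart (hf.le (f.mem_range_self z))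
  exact le_torusRank C ⟨hψ.comp_linearMap f, fun z => by rw [hker _ (hfΛ z), hfZ]⟩
    fun z => hK _ (hfΛ z)

theorem finrank_le_torusRank_add (C : GroupChart G E) {W : Type*} [NormedAddCommGroup W]
    [NormedSpace ℝ W] [FiniteDimensional ℝ W] {θ : W → G} (hθ : IsContHom θ)
    (hspan : Submodule.span ℝ (hθ.comap ⊥ : Set W) = ⊤) :
    Module.finrank ℝ W ≤ torusRank G + Module.finrank ℝ (linearPart (hθ.comap ⊥)) := by
  obtain ⟨m, M, hM, hker, hmem⟩ :=
    exists_linearMap_comap_intLattice (isClosed_singleton.preimage hθ.continuous) hspan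
  obtain ⟨R, hR⟩ := M.exists_rightInverse_of_surjective (LinearMap.range_eq_top.2 hM)
  have hm : m ≤ torusRank (⊤ : Subgroup G) := by
    refine le_torusRank C (ψ := fun z => θ (R z)) ⟨hθ.comp_linearMap R, fun z => ?_⟩
      fun _ => Subgroup.mem_top _
    have hz : M (R z) = z := LinearMap.congr_fun hR z
    rw [← hz, ← hmem, hz]
    rfl
  rw [torusRank_top] at hm
  have hrank := M.finrank_range_add_finrank_ker
  rw [LinearMap.range_eq_top.2 hM, finrank_top, Module.finrank_fin_fun, hker] at hrank
  omega

theorem exists_torusRank_add_le [IsTopologicalGroup G] [CompactSpace G] (C : GroupChart G E)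
    (K L : Subgroup G) :
    ∃ g : G, ∀ M : Subgroup G, (∀ k ∈ K, g * k * g⁻¹ ∈ L → g * k * g⁻¹ ∈ M) →
      torusRank K + torusRank L ≤ torusRank G + torusRank M := by
  obtain ⟨ψ₀, hψ₀, hψ₀K⟩ := exists_isTorusParam_torusRank C K
  obtain ⟨φ, hφ, hφL⟩ := exists_isTorusParam_torusRank C L
  obtain ⟨g, hg⟩ := hψ₀.exists_commute_conj hφ C
  refine ⟨g, fun M hM => ?_⟩
  let ι := Fin (torusRank K) ⊕ Fin (torusRank L)
  let p₁ : (ι → ℝ) →ₗ[ℝ] (Fin (torusRank K) → ℝ) := LinearMap.funLeft ℝ ℝ Sum.inl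
  let p₂ : (ι → ℝ) →ₗ[ℝ] (Fin (torusRank L) → ℝ) := LinearMap.funLeft ℝ ℝ Sum.inr
  have hint : ∀ x, x ∈ intLattice ι ↔ p₁ x ∈ intLattice _ ∧ p₂ x ∈ intLattice _ := fun x => by
    simp only [mem_intLattice, ι, Sum.forall]
    rfl
  have hψ := hψ₀.conj g
  have hθ := (hψ.comp_linearMap p₁).mul_of_commute (hφ.comp_linearMap (-p₂)) fun _ _ => hg _ _
  have hmem : ∀ x, x ∈ hθ.comap ⊥ ↔ g * ψ₀ (p₁ x) * g⁻¹ = φ (p₂ x) := fun x => by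
    rw [← mul_inv_eq_one, ← hφ.map_neg]
    rfl
  have hZ : ∀ x ∈ intLattice ι, x ∈ hθ.comap ⊥ := fun x hx => by
    rw [hmem, (hψ.eq_one_iff _).2 ((hint x).1 hx).1, (hφ.eq_one_iff _).2 ((hint x).1 hx).2]
  have hrankM : Module.finrank ℝ (linearPart (hθ.comap ⊥)) ≤ torusRank M := by
    refine finrank_linearPart_le_torusRank C (hψ.comp_linearMap p₁)
      (isClosed_singleton.preimage hθ.continuous) hZ (fun x hx => ?_) fun x hx => ?_
    · rw [hint, ← hψ.eq_one_iff, ← hφ.eq_one_iff, ← (hmem x).1 hx, and_self]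
    · exact hM _ (hψ₀K _) ((hmem x).1 hx ▸ hφL _)
  have hrankG := finrank_le_torusRank_add C hθ (span_eq_top_of_intLattice_subset hZ)
  have hcard : Module.finrank ℝ (ι → ℝ) = torusRank K + torusRank L := by simp [ι]
  omega

end Rank

section Fixed

variable {G V : Type*} [Group G] [AddCommGroup V] [Module ℝ V] (ρ : Representation ℝ G V)

/-- The pointwise stabilizer of a set of vectors. -/
def fixator (S : Set V) : Subgroup G where
  carrier := {g | ∀ s ∈ S, ρ g s = s}
  one_mem' := by simp
  mul_mem' {a b} ha hb s hs := by rw [map_mul, Module.End.mul_apply, hb s hs, ha s hs]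
  inv_mem' {a} ha s hs := by
    have h : ρ a⁻¹ (ρ a s) = s := by simp
    rwa [ha s hs] at h

/-- The space of vectors fixed by a subgroup. -/
def fixedSpace (K : Subgroup G) : Submodule ℝ V where
  carrier := {v | ∀ g ∈ K, ρ g v = v}
  zero_mem' := by simp
  add_mem' {a b} ha hb g hg := by rw [map_add, ha g hg, hb g hg]
  smul_mem' c v hv g hg := by rw [map_smul, hv g hg]

/-- `N` is invariant under the subgroup `K`. -/
def IsInvariantUnder (K : Subgroup G) (N : Submodule ℝ V) : Prop :=
  ∀ g ∈ K, ∀ v ∈ N, ρ g v ∈ N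

variable {ρ}

theorem mem_fixator {S : Set V} {g : G} : g ∈ fixator ρ S ↔ ∀ s ∈ S, ρ g s = s := Iff.rfl

theorem mem_fixator_insert {S : Set V} {n : V} {g : G} :
    g ∈ fixator ρ (insert n S) ↔ ρ g n = n ∧ g ∈ fixator ρ S := by
  simp only [mem_fixator, Set.forall_mem_insert]

theorem fixator_insert_le (S : Set V) (n : V) : fixator ρ (insert n S) ≤ fixator ρ S :=
  fun _ hg => (mem_fixator_insert.1 hg).2

theorem conj_mem_fixator_insert {S : Set V} {w : V} {g k : G} (hg : g ∈ fixator ρ S)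
    (hk : k ∈ fixator ρ (insert w S)) : g * k * g⁻¹ ∈ fixator ρ (insert (ρ g w) S) := by
  obtain ⟨hkw, hkS⟩ := mem_fixator_insert.1 hk
  refine mem_fixator_insert.2 ⟨?_, mul_mem (mul_mem hg hkS) (inv_mem hg)⟩
  simp only [map_mul, Module.End.mul_apply, Representation.inv_self_apply, hkw]

theorem fixator_insert_sub {S : Set V} {n w a : V} (hw : w ∈ fixedSpace ρ (fixator ρ (insert n S)))
    (ha : a ∈ fixedSpace ρ (fixator ρ (insert w S))) :
    fixator ρ (insert (n - a) (insert w S)) = fixator ρ (insert n S) := by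
  ext g
  simp only [mem_fixator_insert]
  constructor
  · rintro ⟨hna, hg⟩
    rw [map_sub, ha g (mem_fixator_insert.2 hg), sub_left_inj] at hna
    exact ⟨hna, hg.2⟩
  · intro hg
    have hgw := hw g (mem_fixator_insert.2 hg)
    rw [map_sub, hg.1, ha g (mem_fixator_insert.2 ⟨hgw, hg.2⟩)]
    exact ⟨rfl, hgw, hg.2⟩

namespace IsInvariantUnder

variable {K L : Subgroup G} {N N' : Submodule ℝ V}

theorem mono (h : IsInvariantUnder ρ K N) (hLK : L ≤ K) : IsInvariantUnder ρ L N :=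
  fun g hg => h g (hLK hg)

theorem inf (h : IsInvariantUnder ρ K N) (h' : IsInvariantUnder ρ K N') :
    IsInvariantUnder ρ K (N ⊓ N') :=
  fun g hg v hv => ⟨h g hg v hv.1, h' g hg v hv.2⟩

theorem sup (h : IsInvariantUnder ρ K N) (h' : IsInvariantUnder ρ K N') :
    IsInvariantUnder ρ K (N ⊔ N') := fun g hg v hv => by
  obtain ⟨a, ha, b, hb, rfl⟩ := Submodule.mem_sup.1 hv
  rw [map_add]
  exact Submodule.add_mem_sup (h g hg a ha) (h' g hg b hb)

theorem of_le_fixedSpace (h : N ≤ fixedSpace ρ K) : IsInvariantUnder ρ K N := fun g hg v hv => by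
  rwa [h hv g hg]

end IsInvariantUnder

end Fixed

section Orthogonal

variable {G V : Type*} [Group G] [NormedAddCommGroup V] [InnerProductSpace ℝ V]

/-- `ρ` acts by orthogonal transformations. -/
def IsOrthogonalRep (ρ : Representation ℝ G V) : Prop :=
  ∀ g v w, inner ℝ (ρ g v) (ρ g w) = inner ℝ v w

namespace IsOrthogonalRep

variable {ρ : Representation ℝ G V}

theorem inner_apply_right (h : IsOrthogonalRep ρ) (g : G) (v w : V) :
    inner ℝ v (ρ g w) = inner ℝ (ρ g⁻¹ v) w := by
  rw [← h g (ρ g⁻¹ v) w, Representation.self_inv_apply]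

theorem norm_map (h : IsOrthogonalRep ρ) (g : G) (v : V) : ‖ρ g v‖ = ‖v‖ := by
  rw [@norm_eq_sqrt_real_inner V, h, ← norm_eq_sqrt_real_inner]

theorem inner_sub_self (h : IsOrthogonalRep ρ) (g : G) (v : V) :
    inner ℝ (ρ g v - v) v = -(‖ρ g v - v‖ ^ 2 / 2) := by
  rw [norm_sub_sq_real, h.norm_map, inner_sub_left, real_inner_self_eq_norm_sq]
  ring

theorem eq_of_inner_sub_self_eq_zero (h : IsOrthogonalRep ρ) {g : G} {v : V}
    (hv : inner ℝ (ρ g v - v) v = 0) : ρ g v = v := by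
  rw [h.inner_sub_self] at hv
  simpa [sub_eq_zero] using hv

end IsOrthogonalRep

theorem IsInvariantUnder.orthogonal {ρ : Representation ℝ G V} {K : Subgroup G}
    {N : Submodule ℝ V} (h : IsInvariantUnder ρ K N) (hρ : IsOrthogonalRep ρ) :
    IsInvariantUnder ρ K Nᗮ := fun g hg v hv u hu => by
  rw [hρ.inner_apply_right]
  exact hv _ (h _ (inv_mem hg) u hu)

end Orthogonal

section LinearAlgebra

theorem range_eq_range_sup_map_ker {K F V : Type*} [Field K] [AddCommGroup F] [Module K F]
    [FiniteDimensional K F] [AddCommGroup V] [Module K V] {p q : F →ₗ[K] V}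
    (hker : p.ker ≤ q.ker) (hrange : q.range ≤ p.range) (hdisj : Disjoint q.range (q.ker.map p)) :
    p.range = q.range ⊔ q.ker.map p := by
  have hle : q.range ⊔ q.ker.map p ≤ p.range := sup_le hrange LinearMap.map_le_range
  have hdim := (p.domRestrict q.ker).finrank_range_add_finrank_ker
  rw [LinearMap.range_domRestrict, LinearMap.ker_domRestrict,
    (Submodule.comapSubtypeEquivOfLe hker).finrank_eq] at hdim
  have hp := p.finrank_range_add_finrank_ker
  have hq := q.finrank_range_add_finrank_ker
  have hsup := Submodule.finrank_sup_add_finrank_inf_eq q.range (q.ker.map p)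
  rw [hdisj.eq_bot, finrank_bot] at hsup
  exact (Submodule.eq_of_le_of_finrank_eq hle (by omega)).symm

theorem derivative_mem_of_eventually_mem {V : Type*} [NormedAddCommGroup V] [NormedSpace ℝ V]
    [FiniteDimensional ℝ V] {N : Submodule ℝ V} {f : ℝ → V} {f' : V} {t : ℝ}
    (hf : HasDerivAt f f' t) (hmem : ∀ᶠ s in 𝓝 t, f s ∈ N) : f' ∈ N := by
  refine N.closed_of_finiteDimensional.mem_of_tendsto (hasDerivAt_iff_tendsto_slope.1 hf) ?_
  filter_upwards [hmem.filter_mono nhdsWithin_le_nhds] with s hs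
  exact N.smul_mem _ (N.sub_mem hs hmem.self_of_nhds)

theorem finrank_orthogonal_inf_add {V : Type*} [NormedAddCommGroup V] [InnerProductSpace ℝ V]
    [FiniteDimensional ℝ V] {T A N : Submodule ℝ V} (hTN : T ≤ N) (hAN : A ≤ N) (hTA : A ≤ Tᗮ) :
    Module.finrank ℝ ↥((T ⊔ A)ᗮ ⊓ N) + Module.finrank ℝ T + Module.finrank ℝ A =
      Module.finrank ℝ N := by
  have hsup := Submodule.finrank_sup_add_finrank_inf_eq T A
  rw [(T.orthogonal_disjoint.mono_right hTA).eq_bot, finrank_bot] at hsup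
  have hcompl := Submodule.finrank_add_inf_finrank_orthogonal (sup_le hTN hAN)
  omega

end LinearAlgebra

namespace GroupChart.IsSmoothRep

section LieFix

variable {G E V : Type*} [Group G] [TopologicalSpace G] [NormedAddCommGroup E] [NormedSpace ℝ E]
  [NormedAddCommGroup V] [NormedSpace ℝ V] {C : GroupChart G E} {ρ : Representation ℝ G V}

/-- The directions killing a set of vectors: the Lie algebra of its fixator. -/
def lieFix (h : C.IsSmoothRep ρ) (S : Set V) : Submodule ℝ E where
  carrier := {X | ∀ s ∈ S, h.diff X s = 0}
  zero_mem' := by simp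
  add_mem' {a b} ha hb s hs := by simp [ha s hs, hb s hs]
  smul_mem' c X hX s hs := by simp [hX s hs]

theorem mem_lieFix {h : C.IsSmoothRep ρ} {S : Set V} {X : E} :
    X ∈ h.lieFix S ↔ ∀ s ∈ S, h.diff X s = 0 := Iff.rfl

theorem mem_lieFix_insert {h : C.IsSmoothRep ρ} {S : Set V} {n : V} {X : E} :
    X ∈ h.lieFix (insert n S) ↔ h.diff X n = 0 ∧ X ∈ h.lieFix S := by
  simp only [mem_lieFix, Set.forall_mem_insert]

@[simp]
theorem lieFix_empty (h : C.IsSmoothRep ρ) : h.lieFix ∅ = ⊤ :=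
  eq_top_iff.2 fun _ _ => mem_lieFix.2 fun _ hs => hs.elim

/-- The tangent space at `n` of the orbit of the fixator of `S`. -/
noncomputable def tangent (h : C.IsSmoothRep ρ) (S : Set V) (n : V) : Submodule ℝ V :=
  (h.lieFix S).map (h.diff.flip n)

theorem mem_tangent {h : C.IsSmoothRep ρ} {S : Set V} {n u : V} :
    u ∈ h.tangent S n ↔ ∃ X ∈ h.lieFix S, h.diff X n = u := Iff.rfl

theorem diff_mem_tangent (h : C.IsSmoothRep ρ) {S : Set V} (n : V) {X : E} (hX : X ∈ h.lieFix S) :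
    h.diff X n ∈ h.tangent S n := ⟨X, hX, rfl⟩

theorem finrank_tangent_add [FiniteDimensional ℝ E] (h : C.IsSmoothRep ρ) (S : Set V) (n : V) :
    Module.finrank ℝ (h.tangent S n) + Module.finrank ℝ (h.lieFix (insert n S)) =
      Module.finrank ℝ (h.lieFix S) := by
  have hle : h.lieFix (insert n S) ≤ h.lieFix S := fun X hX => (mem_lieFix_insert.1 hX).2
  have hdim := ((h.diff.flip n).domRestrict (h.lieFix S)).finrank_range_add_finrank_ker
  have hker : ((h.diff.flip n).domRestrict (h.lieFix S)).ker =
      (h.lieFix (insert n S)).submoduleOf (h.lieFix S) := by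
    ext X
    exact ⟨fun hX => mem_lieFix_insert.2 ⟨hX, X.2⟩, fun hX => (mem_lieFix_insert.1 hX).1⟩
  rwa [LinearMap.range_domRestrict, hker, (Submodule.submoduleOfEquivOfLe hle).finrank_eq] at hdim

variable [FiniteDimensional ℝ V]

theorem Ad_mem_lieFix [IsTopologicalGroup G] (h : C.IsSmoothRep ρ) {S : Set V} {X : E}
    (hX : X ∈ h.lieFix S) {g : G} (hg : g ∈ fixator ρ S) : C.Ad g X ∈ h.lieFix S := fun s hs => by
  rw [← hg s hs, h.diff_Ad, hX s hs, map_zero]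

theorem isInvariantUnder_tangent [IsTopologicalGroup G] (h : C.IsSmoothRep ρ) (S : Set V) (n : V) :
    IsInvariantUnder ρ (fixator ρ (insert n S)) (h.tangent S n) := by
  rintro g hg _ ⟨X, hX, rfl⟩
  obtain ⟨hn, hS⟩ := mem_fixator_insert.1 hg
  refine mem_tangent.2 ⟨C.Ad g X, h.Ad_mem_lieFix hX hS, ?_⟩
  conv_lhs => rw [← hn, h.diff_Ad]
  rfl

theorem exists_curve_fixator [CompleteSpace E] [ContinuousMul G] (h : C.IsSmoothRep ρ) {S : Set V}
    {X : E} (hX : X ∈ h.lieFix S) :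
    ∃ c : ℝ → G, c 0 = 1 ∧ (∀ v, HasDerivAt (fun t => ρ (c t) v) (h.diff X v) 0) ∧
      ∀ᶠ t in 𝓝 0, c t ∈ fixator ρ S := by
  have hspan : Submodule.span ℝ S ≤ (h.diff X).ker := Submodule.span_le.2 hX
  obtain ⟨c, hc1, hcc, hcX, hfix⟩ := h.exists_curve_fixing fun w hw => hspan hw
  refine ⟨c, hc1, fun v => h.hasDerivAt_of_hasDerivAt v hc1 hcc hcX, ?_⟩
  filter_upwards [hfix] with t ht s hs using ht s (Submodule.subset_span hs)

theorem diff_mem_of_isInvariantUnder [CompleteSpace E] [ContinuousMul G] (h : C.IsSmoothRep ρ)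
    {S : Set V} {N : Submodule ℝ V} (hN : IsInvariantUnder ρ (fixator ρ S) N) {X : E}
    (hX : X ∈ h.lieFix S) {n : V} (hn : n ∈ N) : h.diff X n ∈ N := by
  obtain ⟨c, -, hcd, hcS⟩ := h.exists_curve_fixator hX
  exact derivative_mem_of_eventually_mem (hcd n) (hcS.mono fun t ht => hN _ ht n hn)

theorem diff_eq_zero_of_mem_fixedSpace [CompleteSpace E] [ContinuousMul G] (h : C.IsSmoothRep ρ)
    {S : Set V} {X : E} (hX : X ∈ h.lieFix S) {v : V} (hv : v ∈ fixedSpace ρ (fixator ρ S)) :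
    h.diff X v = 0 := by
  obtain ⟨c, -, hcd, hcS⟩ := h.exists_curve_fixator hX
  refine (hcd v).unique ((hasDerivAt_const (0 : ℝ) v).congr_of_eventuallyEq ?_)
  filter_upwards [hcS] with t ht using hv _ ht

theorem lieFix_le_of_fixator_le [CompleteSpace E] [ContinuousMul G] (h : C.IsSmoothRep ρ)
    {S S' : Set V} (hle : fixator ρ S ≤ fixator ρ S') : h.lieFix S ≤ h.lieFix S' :=
  fun _ hX s hs => h.diff_eq_zero_of_mem_fixedSpace hX fun _ hg => hle hg s hs

/-- The span of the `Ad(k) Z - Z`, for `k` in the fixator of `insert n S` and `Z` in the Lie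
algebra of the fixator of `S`. -/
def lieMoved [IsTopologicalGroup G] (h : C.IsSmoothRep ρ) (S : Set V) (n : V) : Submodule ℝ E :=
  Submodule.span ℝ {Y | ∃ k ∈ fixator ρ (insert n S), ∃ Z ∈ h.lieFix S, Y = C.Ad k Z - Z}

theorem lieMoved_le_lieFix [IsTopologicalGroup G] (h : C.IsSmoothRep ρ) (S : Set V) (n : V) :
    h.lieMoved S n ≤ h.lieFix S := by
  refine Submodule.span_le.2 ?_
  rintro _ ⟨k, hk, Z, hZ, rfl⟩
  exact sub_mem (h.Ad_mem_lieFix hZ (fixator_insert_le S n hk)) hZ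

end LieFix

variable {G E V : Type*} [Group G] [TopologicalSpace G] [NormedAddCommGroup E] [NormedSpace ℝ E]
  [NormedAddCommGroup V] [InnerProductSpace ℝ V] {C : GroupChart G E} {ρ : Representation ℝ G V}
  {h : C.IsSmoothRep ρ}

theorem mem_orthogonal_tangent {S : Set V} {n v : V} :
    v ∈ (h.tangent S n)ᗮ ↔ ∀ X ∈ h.lieFix S, inner ℝ (h.diff X n) v = 0 := by
  simp only [Submodule.mem_orthogonal, mem_tangent, forall_exists_index, and_imp,
    forall_apply_eq_imp_iff₂]

variable [FiniteDimensional ℝ V]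

theorem inner_diff_left (h : C.IsSmoothRep ρ) (hρ : IsOrthogonalRep ρ) (X : E) (v w : V) :
    inner ℝ (h.diff X v) w = -inner ℝ v (h.diff X w) :=
  h.diff_skew (B := innerₗ V) hρ X v w

/-- `n` is a regular point for the action of the fixator of `S` on `N`: its isotropy group acts
trivially on the normal space of its orbit. -/
structure IsRegularIn (h : C.IsSmoothRep ρ) (S : Set V) (N : Submodule ℝ V) (n : V) : Prop where
  mem : n ∈ N
  normal_le_fixedSpace :
    N ⊓ (h.tangent S n)ᗮ ≤ fixedSpace ρ (fixator ρ (insert n S))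

theorem IsRegularIn.mem_fixedSpace_of_orthogonal {S : Set V} {N : Submodule ℝ V} {n w : V}
    (hn : h.IsRegularIn S N n) (hρ : IsOrthogonalRep ρ)
    (hw : w ∈ N) (hperp : n ∈ (h.tangent S w)ᗮ) :
    w ∈ fixedSpace ρ (fixator ρ (insert n S)) := by
  refine hn.normal_le_fixedSpace ⟨hw, mem_orthogonal_tangent.2 fun X hX => ?_⟩
  rw [h.inner_diff_left hρ, real_inner_comm, mem_orthogonal_tangent.1 hperp X hX, neg_zero]

variable [IsTopologicalGroup G] [FiniteDimensional ℝ E]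

/-- First-order condition at the point of an orbit closest to `n`. -/
theorem mem_orthogonal_tangent_of_forall_inner_le (h : C.IsSmoothRep ρ) {S : Set V} {w n : V}
    (hmax : ∀ g ∈ fixator ρ S, inner ℝ (ρ g w) n ≤ inner ℝ w n) : n ∈ (h.tangent S w)ᗮ := by
  refine mem_orthogonal_tangent.2 fun X hX => ?_
  obtain ⟨c, hc1, hcd, hcS⟩ := h.exists_curve_fixator hX
  have hderiv : HasDerivAt (fun t => inner ℝ (ρ (c t) w) n) (inner ℝ (h.diff X w) n) 0 := by
    simpa using (hcd w).inner ℝ (hasDerivAt_const (0 : ℝ) n)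
  refine IsLocalMax.hasDerivAt_eq_zero ?_ hderiv
  filter_upwards [hcS] with t ht
  simpa [hc1] using hmax _ ht

namespace IsRegularIn

variable {S : Set V} {N : Submodule ℝ V} {n w : V}

theorem apply_sub_mem (hn : h.IsRegularIn S N n) (hN : IsInvariantUnder ρ (fixator ρ S) N) {k : G}
    (hk : k ∈ fixator ρ (insert n S)) {u : V} (hu : u ∈ N) :
    ρ k u - u ∈ (h.lieMoved S n).map (h.diff.flip n) := by
  obtain ⟨Z, hZ, hZu⟩ := mem_tangent.1 ((h.tangent S n).starProjection_apply_mem u)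
  have hnormal : u - h.diff Z n ∈ N ⊓ (h.tangent S n)ᗮ :=
    ⟨N.sub_mem hu (h.diff_mem_of_isInvariantUnder hN hZ hn.mem),
      hZu ▸ (h.tangent S n).sub_starProjection_mem_orthogonal u⟩
  have hfix := hn.normal_le_fixedSpace hnormal k hk
  have hAd := h.diff_Ad k Z n
  rw [(mem_fixator_insert.1 hk).1] at hAd
  refine ⟨C.Ad k Z - Z, Submodule.subset_span ⟨k, hk, Z, hZ, rfl⟩, ?_⟩
  rw [LinearMap.flip_apply, map_sub, LinearMap.sub_apply, hAd]
  rw [map_sub, sub_eq_sub_iff_add_eq_add] at hfix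
  rw [sub_eq_sub_iff_add_eq_add, add_comm, hfix, add_comm]

theorem map_lieMoved_le (hn : h.IsRegularIn S N n) (hN : IsInvariantUnder ρ (fixator ρ S) N)
    (hw : w ∈ N) (hfix : w ∈ fixedSpace ρ (fixator ρ (insert n S))) :
    (h.lieMoved S n).map (h.diff.flip w) ≤ (h.lieMoved S n).map (h.diff.flip n) := by
  refine (Submodule.map_span_le _ _ _).2 ?_
  rintro _ ⟨k, hk, Z, hZ, rfl⟩
  have hAd := h.diff_Ad k Z w
  rw [hfix k hk] at hAd
  rw [LinearMap.flip_apply, map_sub, LinearMap.sub_apply, hAd]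
  exact hn.apply_sub_mem hN hk (h.diff_mem_of_isInvariantUnder hN hZ hw)

theorem map_lieMoved_le_sup (hn : h.IsRegularIn S N n) (hρ : IsOrthogonalRep ρ)
    (hN : IsInvariantUnder ρ (fixator ρ S) N) (hw : w ∈ N)
    (hfix : w ∈ fixedSpace ρ (fixator ρ (insert n S))) (hperp : n ∈ (h.tangent S w)ᗮ) :
    (h.lieMoved S n).map (h.diff.flip n) ≤ h.tangent S w ⊔ h.tangent (insert w S) n := by
  have hmoved := h.lieMoved_le_lieFix S n
  let p := (h.diff.flip n).domRestrict (h.lieMoved S n)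
  let q := (h.diff.flip w).domRestrict (h.lieMoved S n)
  have hq : q.range ≤ h.tangent S w := by
    rw [LinearMap.range_domRestrict]
    exact Submodule.map_mono hmoved
  have hqker : q.ker.map p ≤ h.tangent (insert w S) n := by
    rintro _ ⟨X, hX, rfl⟩
    exact h.diff_mem_tangent n (mem_lieFix_insert.2 ⟨hX, hmoved X.2⟩)
  have horth : h.tangent (insert w S) n ≤ (h.tangent S w)ᗮ := by
    rintro _ ⟨X, hX, rfl⟩
    exact h.diff_mem_of_isInvariantUnder ((h.isInvariantUnder_tangent S w).orthogonal hρ) hX hperp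
  have hrange : p.range = q.range ⊔ q.ker.map p := by
    refine range_eq_range_sup_map_ker (fun X hX => ?_) ?_
      ((h.tangent S w).orthogonal_disjoint.mono hq (hqker.trans horth))
    · exact h.diff_eq_zero_of_mem_fixedSpace (mem_lieFix_insert.2 ⟨hX, hmoved X.2⟩) hfix
    · rw [LinearMap.range_domRestrict, LinearMap.range_domRestrict]
      exact hn.map_lieMoved_le hN hw hfix
  rw [← LinearMap.range_domRestrict, show p.range = _ from hrange]
  exact sup_le_sup hq hqker

theorem mem_fixedSpace_of_mem_orthogonal (hn : h.IsRegularIn S N n) (hρ : IsOrthogonalRep ρ)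
    (hN : IsInvariantUnder ρ (fixator ρ S) N) (hw : w ∈ N)
    (hfix : w ∈ fixedSpace ρ (fixator ρ (insert n S))) (hperp : n ∈ (h.tangent S w)ᗮ) {m : V}
    (hm : m ∈ N) (hmw : m ∈ (h.tangent S w)ᗮ) (hmn : m ∈ (h.tangent (insert w S) n)ᗮ) :
    m ∈ fixedSpace ρ (fixator ρ (insert n S)) := fun k hk => by
  have hmem := hn.map_lieMoved_le_sup hρ hN hw hfix hperp (hn.apply_sub_mem hN hk hm)
  have horth : m ∈ (h.tangent S w ⊔ h.tangent (insert w S) n)ᗮ := by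
    rw [← Submodule.inf_orthogonal]
    exact ⟨hmw, hmn⟩
  exact hρ.eq_of_inner_sub_self_eq_zero (horth _ hmem)

/-- Passage from `n` to the slice at a point `w` closest to `n` in its orbit. -/
theorem slice (hn : h.IsRegularIn S N n) (hρ : IsOrthogonalRep ρ)
    (hN : IsInvariantUnder ρ (fixator ρ S) N) (hw : w ∈ N) (hperp : n ∈ (h.tangent S w)ᗮ)
    {A : Submodule ℝ V} (hAN : A ≤ N) (hAperp : A ≤ (h.tangent S w)ᗮ)
    (hAfix : A ≤ fixedSpace ρ (fixator ρ (insert w S))) :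
    ∃ (N' : Submodule ℝ V) (n' : V), h.IsRegularIn (insert w S) N' n' ∧
      IsInvariantUnder ρ (fixator ρ (insert w S)) N' ∧
      fixator ρ (insert n' (insert w S)) = fixator ρ (insert n S) ∧
      Module.finrank ℝ N' + Module.finrank ℝ A + Module.finrank ℝ (h.lieFix S) =
        Module.finrank ℝ N + Module.finrank ℝ (h.lieFix (insert w S)) := by
  let a := A.starProjection n
  have ha : a ∈ A := A.starProjection_apply_mem n
  have hTN : h.tangent S w ≤ N := by
    rintro _ ⟨X, hX, rfl⟩
    exact h.diff_mem_of_isInvariantUnder hN hX hw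
  have hfix := hn.mem_fixedSpace_of_orthogonal hρ hw hperp
  have hfixator : fixator ρ (insert (n - a) (insert w S)) = fixator ρ (insert n S) :=
    fixator_insert_sub hfix (hAfix ha)
  have htangent : h.tangent (insert w S) (n - a) = h.tangent (insert w S) n := by
    refine Submodule.ext fun u => exists_congr fun X => and_congr_right fun hX => ?_
    rw [LinearMap.flip_apply, LinearMap.flip_apply, map_sub,
      h.diff_eq_zero_of_mem_fixedSpace hX (hAfix ha), sub_zero]
  have hnormal : n - a ∈ (h.tangent S w ⊔ A)ᗮ := by
    rw [← Submodule.inf_orthogonal]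
    exact ⟨sub_mem hperp (hAperp ha), A.sub_starProjection_mem_orthogonal n⟩
  have hT : IsInvariantUnder ρ (fixator ρ (insert w S)) (h.tangent S w ⊔ A) :=
    (h.isInvariantUnder_tangent S w).sup (.of_le_fixedSpace hAfix)
  refine ⟨(h.tangent S w ⊔ A)ᗮ ⊓ N, n - a, ⟨⟨hnormal, N.sub_mem hn.mem (hAN ha)⟩, ?_⟩,
    (hT.orthogonal hρ).inf (hN.mono (fixator_insert_le S w)), hfixator, ?_⟩
  · rw [hfixator, htangent]
    rintro m ⟨⟨hmTA, hmN⟩, hmn⟩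
    exact hn.mem_fixedSpace_of_mem_orthogonal hρ hN hw hfix hperp hmN
      (Submodule.orthogonal_le le_sup_left hmTA) hmn
  · have hdim := finrank_orthogonal_inf_add hTN hAN hAperp
    have htan := h.finrank_tangent_add S w
    omega

end IsRegularIn

end GroupChart.IsSmoothRep

section SkewFamily

variable {F V : Type*} [AddCommGroup F] [Module ℝ F] [NormedAddCommGroup V]
  [InnerProductSpace ℝ V] {D : F →ₗ[ℝ] V →ₗ[ℝ] V}

/-- A common eigenvector of the symmetric operators `D x ∘ D y`. -/
theorem exists_forall_apply_apply_eq_smul_of_skew [FiniteDimensional ℝ V] {N : Submodule ℝ V}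
    (hN0 : N ≠ ⊥) (hN : ∀ x, ∀ v ∈ N, D x v ∈ N)
    (hskew : ∀ x v w, inner ℝ (D x v) w = -inner ℝ v (D x w))
    (hcomm : ∀ x y v, D x (D y v) = D y (D x v)) :
    ∃ w ∈ N, w ≠ 0 ∧ ∀ x y, ∃ c : ℝ, D x (D y w) = c • w := by
  let T (p : F × F) : N →ₗ[ℝ] N := (D p.1 ∘ₗ D p.2).restrict fun v hv => hN _ _ (hN _ v hv)
  have hT : ∀ p, (T p).IsSymmetric := fun p v w => by
    change inner ℝ (D p.1 (D p.2 v)) (w : V) = inner ℝ (v : V) (D p.1 (D p.2 w))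
    rw [hskew, hskew, neg_neg, hcomm]
  have hTcomm : Pairwise (Function.onFun Commute T) := fun p q _ => by
    ext v
    change D p.1 (D p.2 (D q.1 (D q.2 v))) = D q.1 (D q.2 (D p.1 (D p.2 v)))
    rw [hcomm p.2 q.1, hcomm p.2 q.2, hcomm p.1 q.1, hcomm p.1 q.2]
  have hsup := LinearMap.IsSymmetric.iSup_iInf_eq_top_of_commute hT hTcomm
  have hnontriv : Nontrivial N := Submodule.nontrivial_iff_ne_bot.2 hN0
  obtain ⟨χ, hχ⟩ : ∃ χ : F × F → ℝ, ⨅ p, Module.End.eigenspace (T p) (χ p) ≠ ⊥ := by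
    by_contra! hbot
    simp [hbot] at hsup
  obtain ⟨w, hw, hw0⟩ := Submodule.exists_mem_ne_zero_of_ne_bot hχ
  refine ⟨w, w.2, fun h => hw0 (Subtype.ext h), fun x y => ⟨χ (x, y), ?_⟩⟩
  exact congrArg Subtype.val (Module.End.mem_eigenspace_iff.1 (Submodule.mem_iInf _ |>.1 hw (x, y)))

theorem finrank_range_flip_le_one_of_skew
    (hskew : ∀ x v w, inner ℝ (D x v) w = -inner ℝ v (D x w))
    (hcomm : ∀ x y v, D x (D y v) = D y (D x v)) {w : V}
    (hw : ∀ x y, ∃ c : ℝ, D x (D y w) = c • w) : Module.finrank ℝ (D.flip w).range ≤ 1 := by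
  by_cases hzero : ∀ x, D x w = 0
  · rw [LinearMap.range_eq_bot.2 (LinearMap.ext hzero), finrank_bot]
    exact zero_le_one
  push Not at hzero
  obtain ⟨x₀, hx₀⟩ := hzero
  obtain ⟨c₀, hc₀⟩ := hw x₀ x₀
  have hc₀0 : c₀ ≠ 0 := by
    rintro rfl
    have hself := hskew x₀ w (D x₀ w)
    rw [hc₀, zero_smul, inner_zero_right, neg_zero] at hself
    exact hx₀ (inner_self_eq_zero.1 hself)
  have hle : (D.flip w).range ≤ ℝ ∙ D x₀ w := by
    rintro _ ⟨y, rfl⟩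
    obtain ⟨c, hc⟩ := hw y x₀
    have hy : c₀ • D y w = c • D x₀ w := by
      rw [← map_smul (D y), ← hc₀, hcomm y, hc, map_smul]
    refine Submodule.mem_span_singleton.2 ⟨c₀⁻¹ * c, ?_⟩
    rw [mul_smul, ← hy, inv_smul_smul₀ hc₀0]
    rfl
  exact (Submodule.finrank_mono hle).trans (finrank_span_singleton hx₀).le

end SkewFamily

namespace GroupChart

theorem torusRank_fixator_insert_le {G E V : Type*} [Group G] [TopologicalSpace G]
    [IsTopologicalGroup G] [T2Space G] [NormedAddCommGroup E] [NormedSpace ℝ E]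
    [FiniteDimensional ℝ E] [AddCommGroup V] [Module ℝ V] {ρ : Representation ℝ G V}
    (C : GroupChart G E) (S : Set V) (w : V) {g : G} (hg : g ∈ fixator ρ S) :
    torusRank (fixator ρ (insert w S)) ≤ torusRank (fixator ρ (insert (ρ g w) S)) :=
  torusRank_le_of_conj C g fun _ => conj_mem_fixator_insert hg

namespace IsSmoothRep

section Torus

variable {G E V F : Type*} [Group G] [TopologicalSpace G]
  [NormedAddCommGroup E] [NormedSpace ℝ E]
  [NormedAddCommGroup V] [NormedSpace ℝ V] [FiniteDimensional ℝ V]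
  [NormedAddCommGroup F] [NormedSpace ℝ F]
  {C : GroupChart G E} {ρ : Representation ℝ G V} {ψ : F → G}

theorem isClosed_fixator [IsTopologicalGroup G] (h : C.IsSmoothRep ρ) (S : Set V) :
    IsClosed (fixator ρ S : Set G) := by
  simp only [fixator, Subgroup.coe_set_mk, Submonoid.coe_set_mk, Subsemigroup.coe_set_mk,
    Set.ofPred_forall]
  exact isClosed_biInter fun s _ => isClosed_eq (h.continuous s) continuous_const

variable [FiniteDimensional ℝ E]

theorem hasDerivAt_comp_smul (h : C.IsSmoothRep ρ) (hψ : IsContHom ψ) (x : F) (v : V) :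
    HasDerivAt (fun t : ℝ => ρ (ψ (t • x)) v) (h.diff (C.velocityMap hψ x) v) 0 := by
  have hderiv := h.hasDerivAt_comp (hψ.line x) v 0
  rwa [(hψ.line x).map_zero, map_one] at hderiv

theorem diff_velocityMap_apply (h : C.IsSmoothRep ρ) (hψ : IsContHom ψ) (x y : F) (v : V) :
    h.diff (C.velocityMap hψ x) (ρ (ψ y) v) = ρ (ψ y) (h.diff (C.velocityMap hψ x) v) := by
  refine (h.hasDerivAt_comp_smul hψ x _).unique
    (((LinearMap.toContinuousLinearMap (ρ (ψ y))).hasFDerivAt.comp_hasDerivAt 0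
      (h.hasDerivAt_comp_smul hψ x v)).congr_of_eventuallyEq (.of_forall fun t => ?_))
  simp only [Function.comp_apply, LinearMap.coe_toContinuousLinearMap', ← Module.End.mul_apply,
    ← map_mul, ← hψ.map_add, add_comm]

theorem diff_velocityMap_comm (h : C.IsSmoothRep ρ) (hψ : IsContHom ψ) (x y : F) (v : V) :
    h.diff (C.velocityMap hψ x) (h.diff (C.velocityMap hψ y) v) =
      h.diff (C.velocityMap hψ y) (h.diff (C.velocityMap hψ x) v) :=
  ((LinearMap.toContinuousLinearMap (h.diff (C.velocityMap hψ x))).hasFDerivAt.comp_hasDerivAt 0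
    (h.hasDerivAt_comp_smul hψ y v)).unique ((h.hasDerivAt_comp_smul hψ y _).congr_of_eventuallyEq
      (.of_forall fun _ => h.diff_velocityMap_apply hψ x _ v))

theorem velocityMap_mem_lieFix (h : C.IsSmoothRep ρ) (hψ : IsContHom ψ) {S : Set V}
    (hψS : ∀ x, ψ x ∈ fixator ρ S) (x : F) : C.velocityMap hψ x ∈ h.lieFix S := fun s hs =>
  (h.hasDerivAt_comp_smul hψ x s).unique ((hasDerivAt_const (0 : ℝ) s).congr_of_eventuallyEq
    (.of_forall fun _ => hψS _ s hs))

end Torus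

variable {G E V : Type*} [Group G] [TopologicalSpace G] [IsTopologicalGroup G]
  [NormedAddCommGroup E] [NormedSpace ℝ E] [FiniteDimensional ℝ E]
  [NormedAddCommGroup V] [InnerProductSpace ℝ V] [FiniteDimensional ℝ V]
  {C : GroupChart G E} {ρ : Representation ℝ G V}

theorem exists_mem_orthogonal_tangent [CompactSpace G] (h : C.IsSmoothRep ρ) (S : Set V) (w n : V) :
    ∃ g ∈ fixator ρ S, n ∈ (h.tangent S (ρ g w))ᗮ := by
  obtain ⟨g, hg, hmax⟩ := (h.isClosed_fixator S).isCompact.exists_isMaxOn ⟨1, one_mem _⟩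
    (f := fun g => inner ℝ (ρ g w) n) ((h.continuous w).inner continuous_const).continuousOn
  refine ⟨g, hg, mem_orthogonal_tangent_of_forall_inner_le h fun k hk => ?_⟩
  rw [← Module.End.mul_apply, ← map_mul]
  exact hmax (mul_mem hk hg)

variable [T2Space G]

theorem exists_torusRank_le_add_one (h : C.IsSmoothRep ρ) (hρ : IsOrthogonalRep ρ) {S : Set V}
    {N : Submodule ℝ V} (hN0 : N ≠ ⊥) (hN : IsInvariantUnder ρ (fixator ρ S) N) :
    ∃ w ∈ N, w ≠ 0 ∧ torusRank (fixator ρ S) ≤ torusRank (fixator ρ (insert w S)) + 1 := by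
  obtain ⟨ψ, hψ, hψS⟩ := exists_isTorusParam_torusRank C (fixator ρ S)
  let D := h.diff ∘ₗ C.velocityMap hψ.toIsContHom
  have hskew : ∀ x v w, inner ℝ (D x v) w = -inner ℝ v (D x w) :=
    fun x v w => h.inner_diff_left hρ _ v w
  have hcomm : ∀ x y v, D x (D y v) = D y (D x v) := h.diff_velocityMap_comm _
  obtain ⟨w, hwN, hw0, hw⟩ := exists_forall_apply_apply_eq_smul_of_skew hN0
    (fun x v => h.diff_mem_of_isInvariantUnder hN (h.velocityMap_mem_lieFix _ hψS x)) hskew hcomm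
  refine ⟨w, hwN, hw0, ?_⟩
  have hline := finrank_range_flip_le_one_of_skew hskew hcomm hw
  let Λ := hψ.comap (fixator ρ {w})
  have hΛ : ∀ x, x ∈ Λ ↔ ρ (ψ x) w = w := fun _ => forall_eq
  have hrank : Module.finrank ℝ (linearPart Λ) ≤ torusRank (fixator ρ (insert w S)) :=
    finrank_linearPart_le_torusRank C hψ.toIsContHom
      ((h.isClosed_fixator {w}).preimage hψ.continuous)
      (fun x hx => by rw [hΛ, (hψ.eq_one_iff x).2 hx, map_one, Module.End.one_apply])
      (fun x _ => hψ.eq_one_iff x) (fun x hx => mem_fixator_insert.2 ⟨(hΛ x).1 hx, hψS x⟩)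
  have hker : (D.flip w).ker ≤ linearPart Λ := fun x hx t =>
    (hΛ _).2 (h.apply_eq_of_diff_velocity_eq_zero (hψ.line x) hx t)
  have hdim := (D.flip w).finrank_range_add_finrank_ker
  rw [Module.finrank_fin_fun] at hdim
  have := Submodule.finrank_mono hker
  omega

theorem exists_torusRank_le_add_one_and_mem_orthogonal [CompactSpace G] (h : C.IsSmoothRep ρ)
    (hρ : IsOrthogonalRep ρ) {S : Set V} {N : Submodule ℝ V} (hN0 : N ≠ ⊥)
    (hN : IsInvariantUnder ρ (fixator ρ S) N) (n : V) :
    ∃ w ∈ N, w ≠ 0 ∧ n ∈ (h.tangent S w)ᗮ ∧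
      torusRank (fixator ρ S) ≤ torusRank (fixator ρ (insert w S)) + 1 := by
  obtain ⟨w, hwN, hw0, hrank⟩ := h.exists_torusRank_le_add_one hρ hN0 hN
  obtain ⟨g, hg, hperp⟩ := h.exists_mem_orthogonal_tangent S w n
  refine ⟨ρ g w, hN g hg w hwN, ?_, hperp,
    hrank.trans (Nat.add_le_add_right (torusRank_fixator_insert_le C S w hg) 1)⟩
  rwa [← norm_ne_zero_iff, hρ.norm_map, norm_ne_zero_iff]

theorem IsRegularIn.torusRank_add_le [CompactSpace G] {h : C.IsSmoothRep ρ}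
    (hρ : IsOrthogonalRep ρ) {S : Set V} {N : Submodule ℝ V} {n : V} (hn : h.IsRegularIn S N n)
    (hN : IsInvariantUnder ρ (fixator ρ S) N) :
    torusRank (fixator ρ S) + Module.finrank ℝ (h.lieFix S) ≤
      torusRank (fixator ρ (insert n S)) + Module.finrank ℝ (h.lieFix (insert n S)) +
        Module.finrank ℝ N := by
  induction hd : Module.finrank ℝ N using Nat.strong_induction_on generalizing S N n with
  | _ d ih =>
    by_cases hN0 : N = ⊥
    · have hn0 : n = 0 := (Submodule.mem_bot ℝ).1 (hN0 ▸ hn.mem)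
      have heq : fixator ρ (insert n S) = fixator ρ S :=
        (fixator_insert_le S n).antisymm fun g hg =>
          mem_fixator_insert.2 ⟨by rw [hn0, map_zero], hg⟩
      have hlie := Submodule.finrank_mono (h.lieFix_le_of_fixator_le heq.ge)
      rw [heq]
      omega
    obtain ⟨w, hwN, hw0, hperp, hrank⟩ :=
      h.exists_torusRank_le_add_one_and_mem_orthogonal hρ hN0 hN n
    have hline : ℝ ∙ w ≤ (h.tangent S w)ᗮ := by
      rw [Submodule.span_singleton_le_iff_mem, mem_orthogonal_tangent]
      intro X _
      have hself := h.inner_diff_left hρ X w w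
      rw [real_inner_comm] at hself ⊢
      linarith
    have hfix : ℝ ∙ w ≤ fixedSpace ρ (fixator ρ (insert w S)) := by
      rw [Submodule.span_singleton_le_iff_mem]
      exact fun g hg => (mem_fixator_insert.1 hg).1
    obtain ⟨N', n', hn', hN', heq, hdim⟩ := hn.slice hρ hN hwN hperp
      ((Submodule.span_singleton_le_iff_mem _ _).2 hwN) hline hfix
    rw [finrank_span_singleton hw0] at hdim
    have hdrop := h.finrank_tangent_add S w
    have hslice := ih _ (by omega) hn' hN' rfl
    have hlie := Submodule.finrank_mono (h.lieFix_le_of_fixator_le heq.le)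
    rw [heq] at hslice
    omega

end IsSmoothRep

end GroupChart

theorem isBigO_sub_sq_of_contDiffAt {E F : Type*} [NormedAddCommGroup E] [NormedSpace ℝ E]
    [NormedAddCommGroup F] [NormedSpace ℝ F] {f : E → F} (hf : ContDiffAt ℝ 2 f 0)
    (hf' : fderiv ℝ f 0 = 0) : (fun x => f x - f 0) =O[𝓝 0] fun x => ‖x‖ ^ 2 := by
  have hd : DifferentiableAt ℝ (fderiv ℝ f) 0 :=
    (hf.fderiv_right (m := 1) le_rfl).differentiableAt one_ne_zero
  obtain ⟨c, hc0, hc⟩ := hd.isBigO_sub.exists_nonneg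
  have hc := hc.bound
  simp only [hf', sub_zero] at hc
  obtain ⟨r, hr, hball⟩ := Metric.eventually_nhds_iff_ball.1
    (hc.and (eventually_differentiableAt_of_contDiffAt hf one_le_two))
  refine .of_bound c ?_
  filter_upwards [Metric.ball_mem_nhds 0 hr] with x hx
  have hsub : Metric.closedBall 0 ‖x‖ ⊆ Metric.ball (0 : E) r :=
    Metric.closedBall_subset_ball (mem_ball_zero_iff.1 hx)
  have hbound := (convex_closedBall (0 : E) ‖x‖).norm_image_sub_le_of_norm_fderiv_le
    (fun y hy => (hball y (hsub hy)).2)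
    (fun y hy => (hball y (hsub hy)).1.trans
      (mul_le_mul_of_nonneg_left (mem_closedBall_zero_iff.1 hy) hc0))
    (Metric.mem_closedBall_self (norm_nonneg x)) (mem_closedBall_zero_iff.2 le_rfl)
  rwa [sub_zero, mul_assoc, ← sq, ← Real.norm_of_nonneg (sq_nonneg ‖x‖)] at hbound

namespace GroupChart

section Shortest

variable {G E V : Type*} [Group G] [TopologicalSpace G] [NormedAddCommGroup E] [NormedSpace ℝ E]
  [NormedAddCommGroup V] [NormedSpace ℝ V] {C : GroupChart G E} {ρ : Representation ℝ G V}

/-- `x` is a shortest chart parameter for the point `orbitMap ρ w x` of the orbit of `w`. -/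
def IsShortest (C : GroupChart G E) (ρ : Representation ℝ G V) (w : V) (x : E) : Prop :=
  ∀ y, C.orbitMap ρ w y = C.orbitMap ρ w x → ‖x‖ ≤ ‖y‖

theorem IsSmoothRep.diff_eq_zero_of_isLittleO (h : C.IsSmoothRep ρ) {w : V} {X : E}
    {ι : Type*} {l : Filter ι} [l.NeBot] {x : ι → E} (hx0 : ∀ i, x i ≠ 0) (hx : Tendsto x l (𝓝 0))
    (hxX : (fun i => x i - ‖x i‖ • X) =o[l] x)
    (hxw : (fun i => C.orbitMap ρ w (x i) - w) =o[l] x) : h.diff X w = 0 := by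
  let D := fderiv ℝ (C.orbitMap ρ w) 0
  have hD : (fun i => C.orbitMap ρ w (x i) - w - D (x i)) =o[l] x := by
    simpa [Function.comp_def] using (h.hasFDerivAt w).isLittleO.comp_tendsto hx
  have hDX : (fun i => D (x i - ‖x i‖ • X)) =o[l] x := (D.isBigO_comp _ l).trans_isLittleO hxX
  have hsmul : (fun i => ‖x i‖ • D X) =o[l] x := by
    refine ((hxw.sub hD).sub hDX).congr_left fun i => ?_
    rw [map_sub, map_smul]
    abel
  refine norm_le_zero_iff.1 (le_of_forall_pos_le_add fun ε hε => ?_)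
  obtain ⟨i, hi⟩ := (hsmul.bound hε).exists
  rw [norm_smul, norm_norm, mul_comm ε] at hi
  rw [zero_add]
  exact le_of_mul_le_mul_left hi (norm_pos_iff.2 (hx0 i))

variable [FiniteDimensional ℝ V]

/-- Moving back along a curve in the isotropy group of `w` with velocity `X` shortens `x`. -/
theorem IsSmoothRep.eventually_not_isShortest [CompleteSpace E] [ContinuousMul G]
    (h : C.IsSmoothRep ρ) {w : V} {X : E} (hX : h.diff X w = 0) {ι : Type*} {l : Filter ι}
    {x : ι → E} (hx : Tendsto x l (𝓝 0)) (hxX : (fun i => x i - ‖x i‖ • X) =o[l] x) :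
    ∀ᶠ i in l, x i ≠ 0 → ¬ C.IsShortest ρ w (x i) := by
  obtain ⟨c, hc1, hcc, hcX, hcw⟩ := h.exists_curve_fixing (W := ℝ ∙ w) (X := X) fun u hu => by
    obtain ⟨a, rfl⟩ := Submodule.mem_span_singleton.1 hu
    rw [map_smul, hX, smul_zero]
  have ht : Tendsto (fun i => -‖x i‖) l (𝓝 0) := by simpa using hx.norm.neg
  have hct : Tendsto (fun i => c (-‖x i‖)) l (𝓝 1) := by
    rw [ContinuousAt, hc1] at hcc
    exact hcc.comp ht
  let y : ι → E := fun i => C.chart (c (-‖x i‖))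
  have hy : Tendsto y l (𝓝 0) := C.tendsto_chart.comp hct
  have hyX : (fun i => y i + ‖x i‖ • X) =o[l] x := by
    have := (hasDerivAt_iff_isLittleO.1 hcX).comp_tendsto ht
    simpa [Function.comp_def, hc1, C.map_one, y, Asymptotics.isLittleO_norm_right] using this
  have hsum : (fun i => x i + y i) =o[l] x := by simpa using hxX.add hyX
  have hpair : (fun i => (x i, y i)) =O[l] x :=
    (Asymptotics.isBigO_refl x l).prod_left
      (by simpa using hsum.isBigO.sub (Asymptotics.isBigO_refl x l))
  have hmul : (fun i => C.mul (x i, y i)) =o[l] x := by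
    have hderiv := (C.hasFDerivAt_mul.isLittleO.comp_tendsto (hx.prodMk_nhds hy)).trans_isBigO
      (by simpa [Function.comp_def] using hpair)
    have h0 : C.mul 0 = 0 := C.mul_zero_right.self_of_nhds
    simpa [Function.comp_def, h0] using hderiv.add hsum
  have hprod : Tendsto (fun i => C.chart.symm (x i) * c (-‖x i‖)) l (𝓝 1) := by
    simpa using (C.tendsto_symm.comp hx).mul hct
  filter_upwards [hmul.bound one_half_pos, ht.eventually hcw,
    hprod.eventually C.eventually_symm_chart, hct.eventually C.eventually_symm_chart]
    with i hi hfix hmem hci hxi hshort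
  have horbit : C.orbitMap ρ w (C.mul (x i, y i)) = C.orbitMap ρ w (x i) := by
    rw [orbitMap, mul, hci, hmem, map_mul, Module.End.mul_apply,
      hfix w (Submodule.mem_span_singleton_self w), orbitMap]
  have := hshort _ horbit
  have := norm_pos_iff.2 hxi
  linarith

theorem IsSmoothRep.exists_norm_le_of_isShortest [FiniteDimensional ℝ E] [ContinuousMul G]
    (h : C.IsSmoothRep ρ) (w : V) :
    ∃ c, ∀ᶠ x in 𝓝 0, C.IsShortest ρ w x → ‖x‖ ≤ c * ‖C.orbitMap ρ w x - w‖ := by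
  by_contra! H
  have hseq : ∀ n : ℕ, ∃ x, ‖x‖ < 1 / ((n : ℝ) + 1) ∧ C.IsShortest ρ w x ∧
      n * ‖C.orbitMap ρ w x - w‖ < ‖x‖ := fun n => by
    obtain ⟨x, ⟨hshort, hlt⟩, hx⟩ := ((H n).and_eventually
      (Metric.ball_mem_nhds (0 : E) Nat.one_div_pos_of_nat)).exists
    exact ⟨x, mem_ball_zero_iff.1 hx, hshort, hlt⟩
  choose x hxlt hshort hlt using hseq
  have hx0 : ∀ n, x n ≠ 0 := fun n =>
    norm_pos_iff.1 ((mul_nonneg n.cast_nonneg (norm_nonneg _)).trans_lt (hlt n))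
  have hlim : Tendsto x atTop (𝓝 0) :=
    squeeze_zero_norm (fun n => (hxlt n).le) tendsto_one_div_add_atTop_nhds_zero_nat
  have hxw : (fun n => C.orbitMap ρ w (x n) - w) =o[atTop] x :=
    Asymptotics.isLittleO_iff_nat_mul_le.2 fun m => by
      filter_upwards [eventually_ge_atTop m] with n hn
      exact (mul_le_mul_of_nonneg_right (Nat.cast_le.2 hn) (norm_nonneg _)).trans (hlt n).le
  obtain ⟨X, -, φ, hφ, hX⟩ := (isCompact_sphere (0 : E) 1).tendsto_subseq
    (x := fun n => ‖x n‖⁻¹ • x n) fun n => by simp [norm_smul, hx0]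
  have hlimφ := hlim.comp hφ.tendsto_atTop
  have hxX : (fun n => x (φ n) - ‖x (φ n)‖ • X) =o[atTop] (x ∘ φ) := by
    refine ((Asymptotics.isBigO_refl (fun n => ‖x (φ n)‖) atTop).smul_isLittleO
      ((Asymptotics.isLittleO_one_iff ℝ).2 (tendsto_sub_nhds_zero_iff.2 hX))).congr'
        (Eventually.of_forall fun n => ?_) EventuallyEq.rfl |>.trans_isBigO ?_
    · simp [smul_sub, smul_smul, hx0]
    · simpa using (Asymptotics.isBigO_refl (x ∘ φ) atTop).norm_left
  have hXw := h.diff_eq_zero_of_isLittleO (fun n => hx0 (φ n)) hlimφ hxX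
    (hxw.comp_tendsto hφ.tendsto_atTop)
  obtain ⟨n, hn⟩ := (h.eventually_not_isShortest hXw hlimφ hxX).exists
  exact hn (hx0 _) (hshort _)

theorem IsSmoothRep.eventually_exists_isShortest [FiniteDimensional ℝ E] [IsTopologicalGroup G]
    (h : C.IsSmoothRep ρ) (w : V) : ∀ᶠ g in 𝓝 1, ∃ x,
      C.IsShortest ρ w x ∧ C.orbitMap ρ w x = ρ g w ∧ ‖x‖ ≤ ‖C.chart g‖ := by
  obtain ⟨r, hr, hball⟩ := Metric.eventually_nhds_iff_ball.1
    (C.chart.open_target.eventually_mem C.zero_mem_target)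
  filter_upwards [C.eventually_symm_chart,
    C.tendsto_chart.eventually (Metric.ball_mem_nhds 0 hr)] with g hg hgr
  have hsub : Metric.closedBall 0 ‖C.chart g‖ ⊆ C.chart.target :=
    (Metric.closedBall_subset_ball (mem_ball_zero_iff.1 hgr)).trans hball
  have hcont : ContinuousOn (C.orbitMap ρ w) (Metric.closedBall 0 ‖C.chart g‖) :=
    (h.continuous w).comp_continuousOn (C.chart.continuousOn_symm.mono hsub)
  have hcompact : IsCompact (Metric.closedBall 0 ‖C.chart g‖ ∩ C.orbitMap ρ w ⁻¹' {ρ g w}) :=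
    (isCompact_closedBall 0 _).of_isClosed_subset
      (hcont.preimage_isClosed_of_isClosed Metric.isClosed_closedBall isClosed_singleton)
      Set.inter_subset_left
  obtain ⟨x, ⟨hxg, hxw⟩, hmin⟩ := hcompact.exists_isMinOn
    ⟨C.chart g, by simp, orbitMap_chart hg w⟩ continuous_norm.continuousOn
  have hxle := mem_closedBall_zero_iff.1 hxg
  refine ⟨x, fun y hy => ?_, hxw, hxle⟩
  rcases le_total ‖y‖ ‖C.chart g‖ with hle | hle
  · exact hmin ⟨mem_closedBall_zero_iff.2 hle, hy.trans hxw⟩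
  · exact hxle.trans hle

theorem IsSmoothRep.exists_eventually_exists_norm_le [FiniteDimensional ℝ E] [IsTopologicalGroup G]
    (h : C.IsSmoothRep ρ) (w : V) : ∃ c, ∀ U ∈ 𝓝 (0 : E), ∀ᶠ g in 𝓝 1, ∃ x ∈ U,
      C.orbitMap ρ w x = ρ g w ∧ ‖x‖ ≤ c * ‖ρ g w - w‖ := by
  obtain ⟨c, hc⟩ := h.exists_norm_le_of_isShortest w
  refine ⟨c, fun U hU => ?_⟩
  obtain ⟨r, hr, hball⟩ := Metric.eventually_nhds_iff_ball.1 (hc.and hU)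
  filter_upwards [h.eventually_exists_isShortest w,
    C.tendsto_chart.eventually (Metric.ball_mem_nhds 0 hr)] with g ⟨x, hshort, hxw, hx⟩ hgr
  obtain ⟨hle, hxU⟩ := hball x (mem_ball_zero_iff.2 (hx.trans_lt (mem_ball_zero_iff.1 hgr)))
  exact ⟨x, hxU, hxw, hxw ▸ hle hshort⟩

end Shortest

variable {G E V : Type*} [Group G] [TopologicalSpace G] [IsTopologicalGroup G]
  [NormedAddCommGroup E] [NormedSpace ℝ E] [FiniteDimensional ℝ E]
  [NormedAddCommGroup V] [InnerProductSpace ℝ V] [FiniteDimensional ℝ V]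
  {C : GroupChart G E} {ρ : Representation ℝ G V}

namespace IsSmoothRep

theorem exists_eventually_inner_sub_le (h : C.IsSmoothRep ρ) {w m : V}
    (hm : m ∈ (h.tangent ∅ w)ᗮ) :
    ∃ c, ∀ᶠ g in 𝓝 1, inner ℝ (ρ g w - w) m ≤ c * ‖ρ g w - w‖ ^ 2 := by
  let f : E → ℝ := fun x => inner ℝ (C.orbitMap ρ w x) m
  have hf : ContDiffAt ℝ 2 f 0 :=
    ((h w).of_le (by norm_cast)).inner ℝ contDiffAt_const
  have hf' : fderiv ℝ f 0 = 0 := by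
    ext X
    rw [fderiv_inner_apply ℝ (h.hasFDerivAt w).differentiableAt (differentiableAt_const m)]
    simpa [h.diff_apply] using mem_orthogonal_tangent.1 hm X (by simp)
  obtain ⟨b, hb0, hb⟩ := (isBigO_sub_sq_of_contDiffAt hf hf').exists_nonneg
  obtain ⟨c, hc⟩ := h.exists_eventually_exists_norm_le w
  refine ⟨b * c ^ 2, ?_⟩
  filter_upwards [hc _ hb.bound] with g ⟨x, hx, hxw, hle⟩
  calc inner ℝ (ρ g w - w) m = f x - f 0 := by simp [f, hxw, inner_sub_left]
    _ ≤ b * ‖x‖ ^ 2 := by simpa using (Real.le_norm_self _).trans hx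
    _ ≤ b * (c * ‖ρ g w - w‖) ^ 2 := by gcongr
    _ = b * c ^ 2 * ‖ρ g w - w‖ ^ 2 := by ring

theorem exists_eventually_nhds_inner_sub_le (h : C.IsSmoothRep ρ) {w m : V}
    (hm : m ∈ (h.tangent ∅ w)ᗮ) (g₀ : G) :
    ∃ c, ∀ᶠ g in 𝓝 g₀, inner ℝ (ρ g w - w) m ≤ c * ‖ρ g w - w‖ ^ 2 := by
  by_cases hg₀ : ρ g₀ w = w
  · obtain ⟨c, hc⟩ := h.exists_eventually_inner_sub_le hm
    have hlim : Tendsto (fun g => g * g₀⁻¹) (𝓝 g₀) (𝓝 1) :=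
      Continuous.tendsto' (by fun_prop) _ _ (mul_inv_cancel g₀)
    refine ⟨c, (hlim.eventually hc).mono fun g hg => ?_⟩
    have hg₀' : ρ g₀⁻¹ w = w := by simpa using congrArg (ρ g₀⁻¹) hg₀.symm
    rwa [map_mul, Module.End.mul_apply, hg₀'] at hg
  · have hcont : Continuous fun g => ρ g w - w := (h.continuous w).sub continuous_const
    have hne : ρ g₀ w - w ≠ 0 := sub_ne_zero.2 hg₀
    have hquot : ContinuousAt (fun g => inner ℝ (ρ g w - w) m / ‖ρ g w - w‖ ^ 2) g₀ :=
      (hcont.inner continuous_const).continuousAt.div (hcont.norm.pow 2).continuousAt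
        (pow_ne_zero 2 (norm_ne_zero_iff.2 hne))
    refine ⟨inner ℝ (ρ g₀ w - w) m / ‖ρ g₀ w - w‖ ^ 2 + 1, ?_⟩
    filter_upwards [hcont.continuousAt.eventually_ne hne,
      hquot.eventually_lt_const (lt_add_one _)] with g hg hlt
    exact ((div_lt_iff₀ (pow_pos (norm_pos_iff.2 hg) 2)).1 hlt).le

theorem exists_inner_sub_le [CompactSpace G] (h : C.IsSmoothRep ρ) {w m : V}
    (hm : m ∈ (h.tangent ∅ w)ᗮ) :
    ∃ c, ∀ g, inner ℝ (ρ g w - w) m ≤ c * ‖ρ g w - w‖ ^ 2 := by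
  suffices ∃ c, ∀ g ∈ Set.univ, inner ℝ (ρ g w - w) m ≤ c * ‖ρ g w - w‖ ^ 2 by simpa
  refine isCompact_univ.induction_on
    (p := fun s => ∃ c, ∀ g ∈ s, inner ℝ (ρ g w - w) m ≤ c * ‖ρ g w - w‖ ^ 2)
    ⟨0, by simp⟩ (fun s t hst ⟨c, hc⟩ => ⟨c, fun g hg => hc g (hst hg)⟩) ?_ fun g₀ _ => ?_
  · rintro s t ⟨c, hc⟩ ⟨d, hd⟩
    refine ⟨max c d, ?_⟩
    rintro g (hg | hg)
    · exact (hc g hg).trans (by gcongr; exact le_max_left c d)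
    · exact (hd g hg).trans (by gcongr; exact le_max_right c d)
  · rw [nhdsWithin_univ]
    obtain ⟨c, hc⟩ := h.exists_eventually_nhds_inner_sub_le hm g₀
    exact ⟨_, hc, c, fun g hg => hg⟩

theorem exists_fixator_add_smul_le [CompactSpace G] (h : C.IsSmoothRep ρ)
    (hρ : IsOrthogonalRep ρ) {w m : V} (hm : m ∈ (h.tangent ∅ w)ᗮ) :
    ∃ ε : ℝ, ε ≠ 0 ∧ fixator ρ {w + ε • m} ≤ fixator ρ {w} := by
  obtain ⟨c, hc⟩ := h.exists_inner_sub_le hm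
  have hc0 : 0 < |c| + 1 := by positivity
  let ε := (2 * (|c| + 1))⁻¹
  have hε : 0 < ε := by positivity
  have hεc : 2 * ε * c < 1 := by
    have : 2 * ε * c = c / (|c| + 1) := by simp only [ε]; field_simp
    rw [this, div_lt_one hc0]
    exact (le_abs_self c).trans_lt (lt_add_one _)
  refine ⟨ε, hε.ne', fun g hg v hv => ?_⟩
  rw [Set.mem_singleton_iff.1 hv]
  have hgm : ρ g (ε • m) = ε • m - (ρ g w - w) := by
    have := hg _ rfl
    rw [map_add] at this
    rw [sub_sub_eq_add_sub, add_comm, ← this, add_sub_cancel_left]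
  have hnorm : ‖ρ g w - w‖ ^ 2 = 2 * ε * inner ℝ (ρ g w - w) m := by
    have := hρ.norm_map g (ε • m)
    rw [hgm, ← sq_eq_sq₀ (norm_nonneg _) (norm_nonneg _), norm_sub_sq_real, inner_smul_left,
      real_inner_comm] at this
    simp only [conj_trivial] at this
    linarith
  have hle := hnorm.le.trans (mul_le_mul_of_nonneg_left (hc g) (by positivity))
  have hzero : ‖ρ g w - w‖ ^ 2 ≤ 0 := by nlinarith [sq_nonneg ‖ρ g w - w‖]
  simpa [sub_eq_zero] using hzero.antisymm (sq_nonneg _)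

theorem exists_isRegularIn [CompactSpace G] (h : C.IsSmoothRep ρ) (hρ : IsOrthogonalRep ρ)
    (N : Submodule ℝ V) : ∃ n, h.IsRegularIn ∅ N n := by
  let F : V → Submodule ℝ V := fun w => N ⊓ fixedSpace ρ (fixator ρ {w})
  have hF : ∀ w ∈ N, w ∈ F w := fun w hw => ⟨hw, fun g hg => hg w rfl⟩
  obtain ⟨_, ⟨w, hw, rfl⟩, hmax⟩ := (wellFounded_gt (α := Submodule ℝ V)).has_min (F '' N)
    ⟨F 0, 0, N.zero_mem, rfl⟩
  refine ⟨w, hw, ?_⟩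
  rintro m ⟨hmN, hm⟩
  obtain ⟨ε, hε, hle⟩ := h.exists_fixator_add_smul_le hρ hm
  have hmem : w + ε • m ∈ N := N.add_mem hw (N.smul_mem ε hmN)
  have hFle : F w ≤ F (w + ε • m) :=
    inf_le_inf_left N fun v hv g hg => hv g (hle hg)
  have hεm : w + ε • m ∈ F w :=
    eq_of_le_of_not_lt hFle (hmax _ ⟨_, hmem, rfl⟩) ▸ hF _ hmem
  rw [Submodule.add_mem_iff_right _ (hF w hw), Submodule.smul_mem_iff _ hε] at hεm
  rw [insert_empty_eq]
  exact hεm.2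

end IsSmoothRep
end GroupChart

theorem finrank_inf_orthogonal_add {V : Type*} [NormedAddCommGroup V] [InnerProductSpace ℝ V]
    [FiniteDimensional ℝ V] {T₁ T₂ N₁ N₂ : Submodule ℝ V} (hN : N₁ ⟂ N₂) :
    Module.finrank ℝ ↥(N₁ ⊓ T₁ᗮ ⊔ N₂ ⊓ T₂ᗮ) =
      Module.finrank ℝ ↥(N₁ ⊓ T₁ᗮ) + Module.finrank ℝ ↥(N₂ ⊓ T₂ᗮ) := by
  have hdisj : Disjoint (N₁ ⊓ T₁ᗮ) (N₂ ⊓ T₂ᗮ) := hN.disjoint.mono inf_le_left inf_le_left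
  rw [← Submodule.finrank_sup_add_finrank_inf_eq, hdisj.eq_bot, finrank_bot, add_zero]

theorem fixator_insert_add_le {G V : Type*} [Group G] [AddCommGroup V] [Module ℝ V]
    {ρ : Representation ℝ G V} {S : Set V} {N₁ N₂ : Submodule ℝ V} (hN : Disjoint N₁ N₂)
    (h₁ : IsInvariantUnder ρ (fixator ρ S) N₁) (h₂ : IsInvariantUnder ρ (fixator ρ S) N₂)
    {a b : V} (ha : a ∈ N₁) (hb : b ∈ N₂) :
    fixator ρ (insert (a + b) S) ≤ fixator ρ (insert a S) ⊓ fixator ρ (insert b S) := by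
  intro g hg
  obtain ⟨hgab, hgS⟩ := mem_fixator_insert.1 hg
  rw [map_add] at hgab
  have hsub : ρ g a - a = b - ρ g b := by rw [sub_eq_sub_iff_add_eq_add, hgab, add_comm]
  have hzero : ρ g a - a = 0 :=
    Submodule.disjoint_def.1 hN _ (N₁.sub_mem (h₁ g hgS a ha) ha)
      (hsub ▸ N₂.sub_mem hb (h₂ g hgS b hb))
  exact ⟨mem_fixator_insert.2 ⟨sub_eq_zero.1 hzero, hgS⟩,
    mem_fixator_insert.2 ⟨(sub_eq_zero.1 (hsub.symm.trans hzero)).symm, hgS⟩⟩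

namespace GroupChart.IsSmoothRep

section Conjugation

variable {G E V : Type*} [Group G] [TopologicalSpace G] [IsTopologicalGroup G]
  [NormedAddCommGroup E] [NormedSpace ℝ E] [FiniteDimensional ℝ E]
  [NormedAddCommGroup V] [NormedSpace ℝ V] [FiniteDimensional ℝ V]
  {C : GroupChart G E} {ρ : Representation ℝ G V}

theorem finrank_lieFix_le_of_conj (h : C.IsSmoothRep ρ) {S S' : Set V} (g : G)
    (hg : ∀ k ∈ fixator ρ S, g * k * g⁻¹ ∈ fixator ρ S') :
    Module.finrank ℝ (h.lieFix S) ≤ Module.finrank ℝ (h.lieFix S') := by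
  have hle : (h.lieFix S).map (C.Ad g) ≤ h.lieFix S' := by
    rintro _ ⟨X, hX, rfl⟩ s hs
    have hfix : ρ g⁻¹ s ∈ fixedSpace ρ (fixator ρ S) := fun k hk => by
      have := hg k hk s hs
      rw [map_mul, map_mul, Module.End.mul_apply, Module.End.mul_apply] at this
      conv_rhs => rw [← this, Representation.inv_self_apply]
    rw [← Representation.self_inv_apply ρ g s, h.diff_Ad,
      h.diff_eq_zero_of_mem_fixedSpace hX hfix, map_zero]
  have hinj : Function.Injective (C.Ad g) :=
    Function.LeftInverse.injective (Representation.inv_self_apply C.Ad g)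
  rw [((h.lieFix S).equivMapOfInjective (C.Ad g) hinj).finrank_eq]
  exact Submodule.finrank_mono hle

theorem finrank_lieFix_insert_le (h : C.IsSmoothRep ρ) (S : Set V) (w : V) {g : G}
    (hg : g ∈ fixator ρ S) :
    Module.finrank ℝ (h.lieFix (insert w S)) ≤ Module.finrank ℝ (h.lieFix (insert (ρ g w) S)) :=
  h.finrank_lieFix_le_of_conj g fun _ => conj_mem_fixator_insert hg

end Conjugation

variable {G E V : Type*} [Group G] [TopologicalSpace G]
  [NormedAddCommGroup E] [NormedSpace ℝ E]
  [NormedAddCommGroup V] [InnerProductSpace ℝ V]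
  {C : GroupChart G E} {ρ : Representation ℝ G V} {h : C.IsSmoothRep ρ}
  {S : Set V} {N N₁ N₂ : Submodule ℝ V} {n n₁ n₂ : V}

theorem IsRegularIn.normal_le_fixedSpace_add (hn₁ : h.IsRegularIn S N₁ n₁)
    (hn₂ : h.IsRegularIn S N₂ n₂) (hN₁ : IsInvariantUnder ρ (fixator ρ S) N₁)
    (hN₂ : IsInvariantUnder ρ (fixator ρ S) N₂) (hdisj : Disjoint N₁ N₂) :
    N₁ ⊓ (h.tangent S n₁)ᗮ ⊔ N₂ ⊓ (h.tangent S n₂)ᗮ ≤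
      fixedSpace ρ (fixator ρ (insert (n₁ + n₂) S)) := by
  have hle := fixator_insert_add_le hdisj hN₁ hN₂ hn₁.mem hn₂.mem
  exact sup_le (fun m hm g hg => hn₁.normal_le_fixedSpace hm g (hle hg).1)
    fun m hm g hg => hn₂.normal_le_fixedSpace hm g (hle hg).2

variable [FiniteDimensional ℝ V]

variable [IsTopologicalGroup G]

theorem IsRegularIn.apply (hn : h.IsRegularIn S N n) (hρ : IsOrthogonalRep ρ)
    (hN : IsInvariantUnder ρ (fixator ρ S) N) {g : G} (hg : g ∈ fixator ρ S) :
    h.IsRegularIn S N (ρ g n) := by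
  refine ⟨hN g hg n hn.mem, ?_⟩
  rintro m ⟨hmN, hm⟩ k hk
  have hperp : ρ g⁻¹ m ∈ (h.tangent S n)ᗮ := mem_orthogonal_tangent.2 fun X hX => by
    rw [hρ.inner_apply_right, inv_inv, ← h.diff_Ad]
    exact mem_orthogonal_tangent.1 hm _ (h.Ad_mem_lieFix hX hg)
  have hconj : g⁻¹ * k * g ∈ fixator ρ (insert n S) := by
    simpa using conj_mem_fixator_insert (inv_mem hg) hk
  have hfix := hn.normal_le_fixedSpace ⟨hN _ (inv_mem hg) m hmN, hperp⟩ _ hconj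
  simp only [map_mul, Module.End.mul_apply, Representation.self_inv_apply] at hfix
  simpa using congrArg (ρ g) hfix

variable [FiniteDimensional ℝ E]

theorem normal_le_orthogonal_tangent_add (h : C.IsSmoothRep ρ)
    (hN₁ : IsInvariantUnder ρ (fixator ρ S) N₁) (hN₂ : IsInvariantUnder ρ (fixator ρ S) N₂)
    (horth : N₁ ⟂ N₂) (hn₁ : n₁ ∈ N₁) (hn₂ : n₂ ∈ N₂) :
    N₁ ⊓ (h.tangent S n₁)ᗮ ⊔ N₂ ⊓ (h.tangent S n₂)ᗮ ≤ (h.tangent S (n₁ + n₂))ᗮ := by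
  refine sup_le ?_ ?_ <;> rintro m ⟨hmN, hm⟩ <;>
    refine mem_orthogonal_tangent.2 fun X hX => ?_ <;>
    rw [map_add, inner_add_left, mem_orthogonal_tangent.1 hm X hX]
  · rw [horth.symm.inner_eq (h.diff_mem_of_isInvariantUnder hN₂ hX hn₂) hmN, add_zero]
  · rw [horth.inner_eq (h.diff_mem_of_isInvariantUnder hN₁ hX hn₁) hmN, zero_add]

namespace IsRegularIn

theorem exists_conj_mem_fixator [CompactSpace G] (hn : h.IsRegularIn S N n)
    (hρ : IsOrthogonalRep ρ) (hN : IsInvariantUnder ρ (fixator ρ S) N) {w : V} (hw : w ∈ N) :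
    ∃ g, ∀ k ∈ fixator ρ (insert n S), g * k * g⁻¹ ∈ fixator ρ (insert w S) := by
  obtain ⟨g, hg, hperp⟩ := h.exists_mem_orthogonal_tangent S w n
  have hfix := hn.mem_fixedSpace_of_orthogonal hρ (hN g hg w hw) hperp
  refine ⟨g⁻¹, fun k hk => ?_⟩
  have hk' : k ∈ fixator ρ (insert (ρ g w) S) :=
    mem_fixator_insert.2 ⟨hfix k hk, (mem_fixator_insert.1 hk).2⟩
  simpa using conj_mem_fixator_insert (inv_mem hg) hk'

theorem finrank_normal_add (hn : h.IsRegularIn S N n) (hN : IsInvariantUnder ρ (fixator ρ S) N) :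
    Module.finrank ℝ ↥(N ⊓ (h.tangent S n)ᗮ) + Module.finrank ℝ (h.lieFix S) =
      Module.finrank ℝ N + Module.finrank ℝ (h.lieFix (insert n S)) := by
  have hle : h.tangent S n ≤ N := by
    rintro _ ⟨X, hX, rfl⟩
    exact h.diff_mem_of_isInvariantUnder hN hX hn.mem
  have hcompl := Submodule.finrank_add_inf_finrank_orthogonal hle
  have htangent := h.finrank_tangent_add S n
  rw [inf_comm] at hcompl
  omega

end IsRegularIn

/-- The slice at `n₁ + n₂` splits off the normal spaces of `n₁` in `N₁` and of `n₂` in `N₂`, on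
which the isotropy group acts trivially. -/
theorem IsRegularIn.torusRank_fixator_add_le [T2Space G] [CompactSpace G] {y : V}
    (hy : h.IsRegularIn S N y) (hn₁ : h.IsRegularIn S N₁ n₁) (hn₂ : h.IsRegularIn S N₂ n₂)
    (hρ : IsOrthogonalRep ρ) (hN₁ : IsInvariantUnder ρ (fixator ρ S) N₁)
    (hN₂ : IsInvariantUnder ρ (fixator ρ S) N₂) (horth : N₁ ⟂ N₂) (hsup : N₁ ⊔ N₂ = N)
    (hperp : y ∈ (h.tangent S (n₁ + n₂))ᗮ) :
    torusRank (fixator ρ (insert (n₁ + n₂) S)) + Module.finrank ℝ (h.lieFix (insert n₁ S)) +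
        Module.finrank ℝ (h.lieFix (insert n₂ S)) ≤
      torusRank (fixator ρ (insert y S)) + Module.finrank ℝ (h.lieFix S) +
        Module.finrank ℝ (h.lieFix (insert y S)) := by
  subst hsup
  obtain ⟨N', y', hy', hN', hfix, hdim⟩ := hy.slice hρ (hN₁.sup hN₂)
    (Submodule.add_mem_sup hn₁.mem hn₂.mem) hperp (sup_le_sup inf_le_left inf_le_left)
    (h.normal_le_orthogonal_tangent_add hN₁ hN₂ horth hn₁.mem hn₂.mem)
    (hn₁.normal_le_fixedSpace_add hn₂ hN₁ hN₂ horth.disjoint)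
  have hslice := hy'.torusRank_add_le hρ hN'
  have hlie := Submodule.finrank_mono (h.lieFix_le_of_fixator_le hfix.le)
  have hdisj := Submodule.finrank_sup_add_finrank_inf_eq N₁ N₂
  have hnormal := finrank_inf_orthogonal_add (T₁ := h.tangent S n₁) (T₂ := h.tangent S n₂) horth
  have hnormal₁ := hn₁.finrank_normal_add hN₁
  have hnormal₂ := hn₂.finrank_normal_add hN₂
  rw [horth.disjoint.eq_bot, finrank_bot] at hdisj
  rw [hfix] at hslice
  omega

/-- The inequality `f(H₁) + f(H₂) ≤ f(G) + f(H₁₂)` for `f = rk + dim`. -/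
theorem IsRegularIn.torusRank_add_torusRank_le [T2Space G] [CompactSpace G] {v₁ v₂ y : V}
    (hy : h.IsRegularIn ∅ N y) (hv₁ : h.IsRegularIn ∅ N₁ v₁)
    (hv₂ : h.IsRegularIn ∅ N₂ v₂) (hρ : IsOrthogonalRep ρ)
    (hN₁ : IsInvariantUnder ρ (fixator ρ ∅) N₁) (hN₂ : IsInvariantUnder ρ (fixator ρ ∅) N₂)
    (horth : N₁ ⟂ N₂) (hsup : N₁ ⊔ N₂ = N) :
    torusRank (fixator ρ {v₁}) + torusRank (fixator ρ {v₂}) +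
        Module.finrank ℝ (h.lieFix {v₁}) + Module.finrank ℝ (h.lieFix {v₂}) ≤
      torusRank G + torusRank (fixator ρ {y}) + Module.finrank ℝ E +
        Module.finrank ℝ (h.lieFix {y}) := by
  have htop : ∀ g, g ∈ fixator ρ ∅ := fun g s hs => hs.elim
  obtain ⟨g, hg⟩ := exists_torusRank_add_le C (fixator ρ {v₁}) (fixator ρ {v₂})
  obtain ⟨k, -, hk⟩ := h.exists_mem_orthogonal_tangent ∅ (ρ g v₁ + v₂) y
  have hrank := hg (fixator ρ {ρ g v₁ + v₂}) fun a ha hga => by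
    rw [← insert_empty_eq] at ha
    have hconj := (mem_fixator_insert.1 (conj_mem_fixator_insert (htop g) ha)).1
    rintro _ rfl
    rw [map_add, hconj, hga v₂ rfl]
  have hrank' := torusRank_fixator_insert_le C ∅ (ρ g v₁ + v₂) (htop k)
  have hlie₁ := (h.finrank_lieFix_insert_le ∅ v₁ (htop g)).trans
    (h.finrank_lieFix_insert_le ∅ _ (htop k))
  have hlie₂ := h.finrank_lieFix_insert_le ∅ v₂ (htop k)
  rw [map_add] at hk hrank'
  have hsum := hy.torusRank_fixator_add_le ((hv₁.apply hρ hN₁ (htop g)).apply hρ hN₁ (htop k))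
    (hv₂.apply hρ hN₂ (htop k)) hρ hN₁ hN₂ horth hsup hk
  rw [lieFix_empty, finrank_top] at hsum
  rw [← insert_empty_eq v₁, ← insert_empty_eq v₂, ← insert_empty_eq (ρ g v₁ + v₂)] at hrank
  rw [← insert_empty_eq v₁, ← insert_empty_eq v₂, ← insert_empty_eq y]
  omega

end GroupChart.IsSmoothRep

section Intertwining

variable {G V W : Type*} [Group G] [AddCommGroup V] [Module ℝ V] [AddCommGroup W] [Module ℝ W]
  {σ : Representation ℝ G V} {ρ : Representation ℝ G W}

theorem isInvariantUnder_range (j : σ.IntertwiningMap ρ) (K : Subgroup G) :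
    IsInvariantUnder ρ K j.toLinearMap.range := by
  rintro g - _ ⟨v, rfl⟩
  exact ⟨σ g v, j.isIntertwining σ ρ g v⟩

theorem fixator_singleton_apply {j : σ.IntertwiningMap ρ} (hj : Function.Injective j) (v : V) :
    fixator ρ {j v} = fixator σ {v} := by
  ext g
  simp only [mem_fixator, Set.mem_singleton_iff, forall_eq, ← j.isIntertwining σ ρ, hj.eq_iff]

theorem range_comp_inl_sup_range_comp_inr {U : Type*} [AddCommGroup U] [Module ℝ U]
    {τ : Representation ℝ G U} (f : (σ.prod ρ).IntertwiningMap τ) :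
    (f.comp (.inl ℝ σ ρ)).toLinearMap.range ⊔ (f.comp (.inr ℝ σ ρ)).toLinearMap.range =
      f.toLinearMap.range := by
  have hsup : (LinearMap.inl ℝ V W).range ⊔ (LinearMap.inr ℝ V W).range = ⊤ :=
    LinearMap.sup_range_inl_inr
  rw [LinearMap.range_eq_map f.toLinearMap, ← hsup, Submodule.map_sup, ← LinearMap.range_comp,
    ← LinearMap.range_comp]
  rfl

end Intertwining

theorem isotropy_eq_fixator {G V : Type*} [Group G] [AddCommGroup V] [Module ℝ V]
    (σ : Representation ℝ G V) (v : V) : σ.isotropy v = fixator σ {v} :=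
  Subgroup.ext fun g => (forall_eq (p := fun w => σ g w = w)).symm

theorem isPrincipalPoint_iff {G V : Type*} [Group G] [AddCommGroup V] [Module ℝ V]
    {σ : Representation ℝ G V} {v : V} :
    σ.IsPrincipalPoint v ↔ ∀ w, ∃ g, ∀ k ∈ fixator σ {v}, g * k * g⁻¹ ∈ fixator σ {w} := by
  simp only [Representation.IsPrincipalPoint, isotropy_eq_fixator, Subgroup.map_le_iff_le_comap]
  rfl

namespace GroupChart.IsSmoothRep

variable {G E V W : Type*} [Group G] [TopologicalSpace G]
  [NormedAddCommGroup E] [NormedSpace ℝ E]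
  [NormedAddCommGroup V] [NormedSpace ℝ V] [FiniteDimensional ℝ V]
  [NormedAddCommGroup W] [NormedSpace ℝ W]
  {C : GroupChart G E} {σ : Representation ℝ G V} {ρ : Representation ℝ G W}

theorem of_surjective (h : C.IsSmoothRep σ) (j : σ.IntertwiningMap ρ)
    (hj : Function.Surjective j) : C.IsSmoothRep ρ := by
  intro w
  obtain ⟨v, rfl⟩ := hj w
  have hcomp := j.toLinearMap.toContinuousLinearMap.contDiff.contDiffAt.comp (0 : E) (h v)
  exact hcomp.congr_of_eventuallyEq
    (Eventually.of_forall fun x => (j.isIntertwining σ ρ (C.chart.symm x) v).symm)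

theorem diff_intertwining (hσ : C.IsSmoothRep σ) (hρ : C.IsSmoothRep ρ)
    (j : σ.IntertwiningMap ρ) (X : E) (v : V) : hρ.diff X (j v) = j (hσ.diff X v) := by
  have hcomp := j.toLinearMap.toContinuousLinearMap.hasFDerivAt.comp 0 (hσ.hasFDerivAt v)
  have horbit : HasFDerivAt (C.orbitMap ρ (j v)) _ 0 := hcomp.congr_of_eventuallyEq
    (Eventually.of_forall fun x => (j.isIntertwining σ ρ (C.chart.symm x) v).symm)
  rw [hρ.diff_apply, horbit.fderiv]
  rfl

theorem lieFix_singleton_apply (hσ : C.IsSmoothRep σ) (hρ : C.IsSmoothRep ρ)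
    {j : σ.IntertwiningMap ρ} (hj : Function.Injective j) (v : V) :
    hρ.lieFix {j v} = hσ.lieFix {v} := by
  ext X
  simp only [mem_lieFix, Set.mem_singleton_iff, forall_eq, hσ.diff_intertwining hρ,
    map_eq_zero_iff j hj]

end GroupChart.IsSmoothRep

theorem exists_isOrthogonalRep_equiv_prod {G V₁ V₂ : Type*} [Group G] [TopologicalSpace G]
    [IsTopologicalGroup G] [CompactSpace G]
    [NormedAddCommGroup V₁] [NormedSpace ℝ V₁] [FiniteDimensional ℝ V₁]
    [NormedAddCommGroup V₂] [NormedSpace ℝ V₂] [FiniteDimensional ℝ V₂]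
    (ρ₁ : Representation ℝ G V₁) (ρ₂ : Representation ℝ G V₂)
    (h₁ : ∀ v, Continuous fun g => ρ₁ g v) (h₂ : ∀ v, Continuous fun g => ρ₂ g v) :
    ∃ (ρ : Representation ℝ G (EuclideanSpace ℝ (Fin (Module.finrank ℝ (V₁ × V₂)))))
      (e : (ρ₁.prod ρ₂).Equiv ρ),
      IsOrthogonalRep ρ ∧ ∀ v w, inner ℝ (e (v, 0)) (e (0, w)) = 0 := by
  obtain ⟨B₁, hsymm₁, hpos₁, hinv₁⟩ := exists_invariant_posDef ρ₁ h₁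
  obtain ⟨B₂, hsymm₂, hpos₂, hinv₂⟩ := exists_invariant_posDef ρ₂ h₂
  have hpos : ∀ v : V₁ × V₂, v ≠ 0 → 0 < B₁ v.1 v.1 + B₂ v.2 v.2 := fun v hv => by
    obtain hv₁ | hv₁ := eq_or_ne v.1 0 <;> obtain hv₂ | hv₂ := eq_or_ne v.2 0
    · exact absurd (Prod.ext hv₁ hv₂) hv
    · simpa [hv₁] using hpos₂ _ hv₂
    · simpa [hv₂] using hpos₁ _ hv₁
    · exact add_pos (hpos₁ _ hv₁) (hpos₂ _ hv₂)
  obtain ⟨e, he⟩ := exists_linearEquiv_euclidean_of_posDef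
    (B₁.compl₁₂ (.fst ℝ V₁ V₂) (.fst ℝ V₁ V₂) + B₂.compl₁₂ (.snd ℝ V₁ V₂) (.snd ℝ V₁ V₂))
    (fun v w => congrArg₂ (· + ·) (hsymm₁ v.1 w.1) (hsymm₂ v.2 w.2)) hpos
  let ρ : Representation ℝ G (EuclideanSpace ℝ (Fin (Module.finrank ℝ (V₁ × V₂)))) :=
    (e.conjRingEquiv : Module.End ℝ (V₁ × V₂) →* _).comp (ρ₁.prod ρ₂)
  have hρ : ∀ g v, ρ g (e v) = e (ρ₁.prod ρ₂ g v) := fun g v =>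
    congrArg (fun u => e (ρ₁.prod ρ₂ g u)) (e.symm_apply_apply v)
  refine ⟨ρ, .mk e fun g => LinearMap.ext fun v => (hρ g v).symm, fun g v w => ?_, fun v w => ?_⟩
  · obtain ⟨v, rfl⟩ := e.surjective v
    obtain ⟨w, rfl⟩ := e.surjective w
    rw [hρ, hρ, he, he]
    exact congrArg₂ (· + ·) (hinv₁ g v.1 w.1) (hinv₂ g v.2 w.2)
  · exact (he _ _).trans (by simp)

section LieGroupChart

variable {E H G : Type*} [NormedAddCommGroup E] [NormedSpace ℝ E]
  [TopologicalSpace H] (I : ModelWithCorners ℝ E H) [I.Boundaryless]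
  [Group G] [TopologicalSpace G] [ChartedSpace H G]

/-- The preferred chart at the identity, translated so that the identity goes to the origin. -/
noncomputable def centeredChart : OpenPartialHomeomorph G E :=
  ((chartAt H (1 : G)).transHomeomorph I.toHomeomorph).transHomeomorph
    (Homeomorph.subRight (extChartAt I (1 : G) 1))

theorem centeredChart_apply (g : G) :
    centeredChart I g = extChartAt I (1 : G) g - extChartAt I (1 : G) 1 := rfl

theorem centeredChart_symm_apply (x : E) :
    (centeredChart I).symm x = (extChartAt I (1 : G)).symm (x + extChartAt I (1 : G) 1) := rfl

theorem one_mem_centeredChart_source : (1 : G) ∈ (centeredChart (G := G) I).source :=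
  mem_chart_source H (1 : G)

theorem centeredChart_one : centeredChart I (1 : G) = 0 := by
  rw [centeredChart_apply, sub_self]

theorem centeredChart_symm_zero : (centeredChart I).symm 0 = (1 : G) := by
  rw [centeredChart_symm_apply, zero_add, extChartAt_to_inv]

theorem contMDiffAt_centeredChart : ContMDiffAt I 𝓘(ℝ, E) ∞ (centeredChart (G := G) I) 1 :=
  contMDiffAt_extChartAt.sub contMDiffAt_const

theorem contDiffAt_centeredChart_comp {F : Type*} [NormedAddCommGroup F] [NormedSpace ℝ F]
    {f : F → G} {x : F} (hf : ContMDiffAt 𝓘(ℝ, F) I ∞ f x) (hfx : f x = 1) :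
    ContDiffAt ℝ ∞ (fun y => centeredChart I (f y)) x :=
  ((contMDiffAt_centeredChart I).comp_of_eq hf hfx).contDiffAt

variable [LieGroup I ∞ G]

theorem contMDiffAt_centeredChart_symm :
    ContMDiffAt 𝓘(ℝ, E) I ∞ (centeredChart (G := G) I).symm 0 := by
  have hsymm : ContMDiffAt 𝓘(ℝ, E) I ∞ (extChartAt I (1 : G)).symm (extChartAt I (1 : G) 1) :=
    (contMDiffOn_extChartAt_symm (1 : G)).contMDiffAt (extChartAt_target_mem_nhds 1)
  exact hsymm.comp_of_eq (f := fun x : E => x + extChartAt I (1 : G) 1)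
    (contDiff_id.add contDiff_const).contMDiff.contMDiffAt (zero_add _)

/-- The chart at the identity of a Lie group. -/
noncomputable def lieGroupChart (G : Type*) [Group G] [TopologicalSpace G] [ChartedSpace H G]
    [LieGroup I ∞ G] : GroupChart G E :=
  have hsymm := contMDiffAt_centeredChart_symm (G := G) I
  have hfst : ContMDiffAt 𝓘(ℝ, E × E) I ∞
      (fun p : E × E => (centeredChart (G := G) I).symm p.1) 0 :=
    hsymm.comp (0 : E × E) contDiff_fst.contMDiff.contMDiffAt
  have hsnd : ContMDiffAt 𝓘(ℝ, E × E) I ∞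
      (fun p : E × E => (centeredChart (G := G) I).symm p.2) 0 :=
    hsymm.comp (0 : E × E) contDiff_snd.contMDiff.contMDiffAt
  { chart := centeredChart I
    one_mem_source := one_mem_centeredChart_source I
    map_one := centeredChart_one I
    contDiffAt_mul := contDiffAt_centeredChart_comp I (hfst.mul hsnd)
      (by simp [centeredChart_symm_zero])
    contDiffAt_conj₂ := contDiffAt_centeredChart_comp I ((hfst.mul hsnd).mul hfst.inv)
      (by simp [centeredChart_symm_zero])
    contDiffAt_conj := fun g => contDiffAt_centeredChart_comp I
      ((contMDiffAt_const.mul hsymm).mul contMDiffAt_const) (by simp [centeredChart_symm_zero]) }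

variable {V : Type*} [NormedAddCommGroup V] [NormedSpace ℝ V] {σ : Representation ℝ G V}

theorem isSmoothRep_lieGroupChart (hσ : σ.IsSmooth I) : (lieGroupChart I G).IsSmoothRep σ :=
  fun v => ((hσ v).contMDiffAt.comp (0 : E) (contMDiffAt_centeredChart_symm I)).contDiffAt

theorem orbitTangentSpace_eq_range (hσ : σ.IsSmooth I) (v : V) :
    σ.orbitTangentSpace I v = ((isSmoothRep_lieGroupChart I hσ).diff.flip v).range := by
  have hdiff : MDifferentiableAt I 𝓘(ℝ, V) (fun g : G => σ g v) 1 :=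
    (hσ v).contMDiffAt.mdifferentiableAt (by simp)
  have hderiv : (mfderiv I 𝓘(ℝ, V) (fun g : G => σ g v) 1 : E →L[ℝ] V) =
      fderiv ℝ (fun x : E => σ ((centeredChart I).symm x) v) 0 := by
    rw [hdiff.mfderiv, I.range_eq_univ, fderivWithin_univ]
    simp only [centeredChart_symm_apply]
    rw [fderiv_comp_add_right (f := fun y => σ ((extChartAt I (1 : G)).symm y) v), zero_add]
    rfl
  rw [Representation.orbitTangentSpace, hderiv]
  rfl

theorem finrank_orbitTangentSpace_add [FiniteDimensional ℝ E] (hσ : σ.IsSmooth I) (v : V) :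
    Module.finrank ℝ (σ.orbitTangentSpace I v) +
        Module.finrank ℝ ((isSmoothRep_lieGroupChart I hσ).lieFix {v}) = Module.finrank ℝ E := by
  have hker : (isSmoothRep_lieGroupChart I hσ).lieFix {v} =
      ((isSmoothRep_lieGroupChart I hσ).diff.flip v).ker :=
    Submodule.ext fun _ => forall_eq (a' := v)
  rw [orbitTangentSpace_eq_range I hσ, hker]
  exact LinearMap.finrank_range_add_finrank_ker _

end LieGroupChart

section HomogeneityRank

variable {E H G V : Type*} [NormedAddCommGroup E] [NormedSpace ℝ E] [FiniteDimensional ℝ E]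
  [TopologicalSpace H] (I : ModelWithCorners ℝ E H) [I.Boundaryless]
  [Group G] [TopologicalSpace G] [ChartedSpace H G] [LieGroup I ∞ G] [T2Space G]
  [NormedAddCommGroup V] [NormedSpace ℝ V] [FiniteDimensional ℝ V] {σ : Representation ℝ G V}

theorem hrk_eq_of_isPrincipalPoint (hσ : σ.IsSmooth I) {v : V} (hv : σ.IsPrincipalPoint v) :
    σ.hrk I = torusRank G - torusRank (fixator σ {v}) - Module.finrank ℝ V + Module.finrank ℝ E -
      Module.finrank ℝ ((isSmoothRep_lieGroupChart I hσ).lieFix {v}) := by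
  have := topologicalGroup_of_lieGroup I ∞ (G := G)
  have hp : σ.IsPrincipalPoint σ.principalPoint := Classical.epsilon_spec ⟨v, hv⟩
  have hsmooth := isSmoothRep_lieGroupChart I hσ
  obtain ⟨g, hg⟩ := isPrincipalPoint_iff.1 hv σ.principalPoint
  obtain ⟨k, hk⟩ := isPrincipalPoint_iff.1 hp v
  have hrank := (torusRank_le_of_conj (lieGroupChart I G) g hg).antisymm
    (torusRank_le_of_conj (lieGroupChart I G) k hk)
  have hlie := (hsmooth.finrank_lieFix_le_of_conj g hg).antisymm
    (hsmooth.finrank_lieFix_le_of_conj k hk)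
  have horbit := finrank_orbitTangentSpace_add I hσ σ.principalPoint
  rw [Representation.hrk, Representation.cohomogeneity, isotropy_eq_fixator]
  omega

theorem exists_isRegularIn_range_hrk_eq [CompactSpace G] {W : Type*} [NormedAddCommGroup W]
    [InnerProductSpace ℝ W] [FiniteDimensional ℝ W] {ρ : Representation ℝ G W}
    (hσ : σ.IsSmooth I) (h : (lieGroupChart I G).IsSmoothRep ρ) (hρ : IsOrthogonalRep ρ)
    {j : σ.IntertwiningMap ρ} (hj : Function.Injective j) :
    ∃ n, h.IsRegularIn ∅ j.toLinearMap.range n ∧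
      σ.hrk I = torusRank G - torusRank (fixator ρ {n}) - Module.finrank ℝ V +
        Module.finrank ℝ E - Module.finrank ℝ (h.lieFix {n}) := by
  have := topologicalGroup_of_lieGroup I ∞ (G := G)
  obtain ⟨n, hn⟩ := h.exists_isRegularIn hρ j.toLinearMap.range
  obtain ⟨v, rfl⟩ := hn.mem
  rw [j.toLinearMap_apply] at hn
  have hv : σ.IsPrincipalPoint v := isPrincipalPoint_iff.2 fun w => by
    have hconj := hn.exists_conj_mem_fixator hρ (isInvariantUnder_range j _) ⟨w, rfl⟩
    rwa [j.toLinearMap_apply, insert_empty_eq, insert_empty_eq, fixator_singleton_apply hj,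
      fixator_singleton_apply hj] at hconj
  refine ⟨j v, hn, ?_⟩
  rw [hrk_eq_of_isPrincipalPoint I hσ hv, fixator_singleton_apply hj,
    (isSmoothRep_lieGroupChart I hσ).lieFix_singleton_apply h hj]

end HomogeneityRank

theorem lemma2p2 {E H G V₁ V₂ : Type*}
    [NormedAddCommGroup E] [NormedSpace ℝ E] [FiniteDimensional ℝ E]
    [TopologicalSpace H] (I : ModelWithCorners ℝ E H) [I.Boundaryless]
    [Group G] [TopologicalSpace G] [ChartedSpace H G] [LieGroup I ∞ G]
    [T2Space G] [CompactSpace G]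
    [NormedAddCommGroup V₁] [NormedSpace ℝ V₁] [FiniteDimensional ℝ V₁]
    [NormedAddCommGroup V₂] [NormedSpace ℝ V₂] [FiniteDimensional ℝ V₂]
    (ρ₁ : Representation ℝ G V₁) (ρ₂ : Representation ℝ G V₂)
    (h₁ : ρ₁.IsSmooth I) (h₂ : ρ₂.IsSmooth I) :
    (ρ₁.prod ρ₂).hrk I ≤ ρ₁.hrk I + ρ₂.hrk I := by
  have := topologicalGroup_of_lieGroup I ∞ (G := G)
  have h₁₂ : (ρ₁.prod ρ₂).IsSmooth I := fun v => (h₁ v.1).prodMk_space (h₂ v.2)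
  obtain ⟨ρ, e, hρ, horth⟩ := exists_isOrthogonalRep_equiv_prod ρ₁ ρ₂
    (fun v => (h₁ v).continuous) (fun v => (h₂ v).continuous)
  have h := (isSmoothRep_lieGroupChart I h₁₂).of_surjective e.toIntertwiningMap
    e.toLinearEquiv.surjective
  let j₁ := e.toIntertwiningMap.comp (.inl ℝ ρ₁ ρ₂)
  let j₂ := e.toIntertwiningMap.comp (.inr ℝ ρ₁ ρ₂)
  have hj₁ : Function.Injective j₁ := e.toLinearEquiv.injective.comp LinearMap.inl_injective
  have hj₂ : Function.Injective j₂ := e.toLinearEquiv.injective.comp LinearMap.inr_injective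
  have hj := e.toLinearEquiv.injective
  obtain ⟨v₁, hv₁, hrk₁⟩ := exists_isRegularIn_range_hrk_eq I h₁ h hρ hj₁
  obtain ⟨v₂, hv₂, hrk₂⟩ := exists_isRegularIn_range_hrk_eq I h₂ h hρ hj₂
  obtain ⟨v, hv, hrk⟩ := exists_isRegularIn_range_hrk_eq I h₁₂ h hρ (j := e.toIntertwiningMap) hj
  have hperp : j₁.toLinearMap.range ⟂ j₂.toLinearMap.range :=
    Submodule.isOrtho_iff_inner_eq.2 fun _ ⟨a, ha⟩ _ ⟨b, hb⟩ => ha ▸ hb ▸ horth a b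
  have hineq := hv.torusRank_add_torusRank_le hv₁ hv₂ hρ (isInvariantUnder_range j₁ _)
    (isInvariantUnder_range j₂ _) hperp
    (range_comp_inl_sup_range_comp_inr _)
  have hdim := Module.finrank_prod (R := ℝ) (M := V₁) (M' := V₂)
  omega
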